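/- All graphs are finite; a signed graph $(G,\sigma)$ is a multigraph $G$ (loops and parallel edges allowed) with a signature $\sigma:E(G)\to\{+,-\}$. Let $K^s_{10;3}$ be the signed graph with vertex set $\{0,1,\dots,9\}$ in which $i$ and $j$ are joined by a negative edge if and only if $3\le |i-j|\le 7$, and by a positive edge if and only if $|i-j|\le 2$ or $|i-j|\ge 8$ (so there is a positive loop at every vertex). A circular $10/3$-coloring of $(G,\sigma)$ is a map $f:V(G)\to\{0,\dots,9\}$ such that for every edge $e=uv$ of $G$ (with $u=v$ if $e$ is a loop) there is an edge of sign $\sigma(e)$ between $f(u)$ and $f(v)$ in $K^s_{10;3}$. A signed graph is $10/3$-critical if it admits no circular $10/3$-coloring, but each of its proper subgraphs (with the restricted signature) admits one. Switching a vertex set $X$ reverses the signs of all edges with exactly one end in $X$. Two signed graphs are isomorphic if, after switching some vertex set in one of them, there is an isomorphism of multigraphs between them that preserves the signs of the edges. Let $\widetilde K_2$ (the digon) be the signed graph with two vertices joined by exactly two parallel edges, one positive and one negative, and let $(K_4,-)$ be the complete graph $K_4$ with all edges negative. **Theorem.** Let $(G,\sigma)$ be a $10/3$-critical signed graph without negative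 loops that is isomorphic neither to $\widetilde K_2$ nor to $(K_4,-)$. Then $$|E(G)|\ \ge\ \frac{3|V(G)|+1}{2};$$ equivalently, the potential $3|V(G)|-2|E(G)|$ is at most $-1$. -/

import Mathlib

open scoped Graph

/-!
A signed graph is given by a multigraph `G : Graph α β` (loops and parallel edges are allowed)
together with a sign function `σ : β → ℤˣ`; only the values of `σ` on the edge set of `G` are used.
A subgraph of a signed graph is a subgraph `H ≤ G` with the restriction of `σ`, so it carries the
same sign function.
-/

namespace SignedGraph

/-- The signature obtained from `σ` by switching the vertex set `X`: the signs of the edges of `G`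
with one end in `X` and the other end outside `X` are reversed, all other signs are kept. -/
noncomputable def switch {α β : Type*} (G : Graph α β) (σ : β → ℤˣ) (X : Set α) : β → ℤˣ :=
  fun e => by
    classical
    exact if ∃ x y, G.IsLink e x y ∧ x ∈ X ∧ y ∉ X then -σ e else σ e

/-- There is an edge-sign preserving homomorphism of `(G, σ)` to `(H, π)`: a map of the vertices
such that every edge of `G` has, between the images of its ends, an edge of `H` of the same sign. -/
def SPHom {α β γ δ : Type*} (G : Graph α β) (σ : β → ℤˣ) (H : Graph γ δ) (π : δ → ℤˣ) : Prop :=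
  ∃ f : V(G) → V(H), ∀ (e : β) (x y : V(G)), G.IsLink e x y →
    ∃ e' : δ, H.IsLink e' (f x) (f y) ∧ π e' = σ e

/-- Isomorphism of signed graphs, which is understood up to switching: after switching some vertex
set of `G`, there are bijections of the vertices and of the edges that preserve incidence and
signs. -/
def Iso {α β γ δ : Type*} (G : Graph α β) (σ : β → ℤˣ) (H : Graph γ δ) (π : δ → ℤˣ) : Prop :=
  ∃ (X : Set α) (φ : V(G) ≃ V(H)) (ψ : E(G) ≃ E(H)),
    (∀ (e : E(G)) (x y : V(G)), G.IsLink e x y ↔ H.IsLink (ψ e) (φ x) (φ y)) ∧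
    ∀ e : E(G), π (ψ e) = switch G σ X e

/-- Whether `i` and `j` are joined in the signed circular clique `K_{p;q}^s` by an edge of the given
sign (with `p` even): by a negative edge iff `q ≤ |i - j| ≤ p - q`, and by a positive edge iff
`|i - j| ≤ p / 2 - q` or `|i - j| ≥ p / 2 + q`. -/
def circularCliqueAdj (p q : ℕ) (i j : Fin p) (s : ℤˣ) : Prop :=
  (s = -1 ∧ (q : ℤ) ≤ |(i : ℤ) - j| ∧ |(i : ℤ) - j| ≤ p - q) ∨
  (s = 1 ∧ (|(i : ℤ) - j| ≤ p / 2 - q ∨ p / 2 + q ≤ |(i : ℤ) - j|))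

theorem circularCliqueAdj_comm {p q : ℕ} {i j : Fin p} {s : ℤˣ} :
    circularCliqueAdj p q i j s ↔ circularCliqueAdj p q j i s := by
  unfold circularCliqueAdj
  rw [abs_sub_comm]

/-- The underlying multigraph of the signed circular clique `K_{p;q}^s` on `{0, …, p - 1}`. An edge
is named by its pair of ends and its sign, so that its signature is `Prod.snd`. -/
def circularClique (p q : ℕ) : Graph (Fin p) (Sym2 (Fin p) × ℤˣ) where
  vertexSet := Set.univ
  IsLink e i j := e.1 = s(i, j) ∧ circularCliqueAdj p q i j e.2
  isLink_symm _ _ := ⟨fun _ _ h => ⟨h.1.trans Sym2.eq_swap, circularCliqueAdj_comm.1 h.2⟩⟩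
  eq_or_eq_of_isLink_of_isLink := by
    rintro e x y v w ⟨h, -⟩ ⟨h', -⟩
    have h2 : s(x, y) = s(v, w) := h.symm.trans h'
    rw [Sym2.eq_iff] at h2
    tauto
  left_mem_of_isLink _ _ _ _ := Set.mem_univ _

/-- `(G, σ)` admits a circular `p/q`-coloring, for `p` even and `p ≥ 2q > 0`. -/
def CircularColorable {α β : Type*} (p q : ℕ) (G : Graph α β) (σ : β → ℤˣ) : Prop :=
  SPHom G σ (circularClique p q) Prod.snd

/-- `(G, σ)` is circular `p/q`-critical: it has no circular `p/q`-coloring, but each of its proper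
subgraphs has one. -/
def CircularCritical {α β : Type*} (p q : ℕ) (G : Graph α β) (σ : β → ℤˣ) : Prop :=
  ¬ CircularColorable p q G σ ∧ ∀ H : Graph α β, H < G → CircularColorable p q H σ

/-- The underlying multigraph of the digon: two vertices joined by two parallel edges, which are
named by their signs, so that its signature is the identity. -/
def digon : Graph (Fin 2) ℤˣ where
  vertexSet := Set.univ
  IsLink _ i j := i ≠ j
  isLink_symm _ _ := ⟨fun _ _ h => h.symm⟩
  eq_or_eq_of_isLink_of_isLink := by
    intro e x y v w h h'
    omega
  left_mem_of_isLink _ _ _ _ := Set.mem_univ _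

/-- The complete graph `K_4`, as a multigraph whose edges are the pairs of distinct vertices. -/
def completeFour : Graph (Fin 4) (Sym2 (Fin 4)) where
  vertexSet := Set.univ
  IsLink e i j := e = s(i, j) ∧ i ≠ j
  isLink_symm _ _ := ⟨fun _ _ h => ⟨h.1.trans Sym2.eq_swap, h.2.symm⟩⟩
  eq_or_eq_of_isLink_of_isLink := by
    rintro e x y v w ⟨h, -⟩ ⟨h', -⟩
    have h2 : s(x, y) = s(v, w) := h.symm.trans h'
    rw [Sym2.eq_iff] at h2
    tauto
  left_mem_of_isLink _ _ _ _ := Set.mem_univ _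

end SignedGraph

/-!
The colours are the elements of `ZMod 10`; a positive edge asks that the colours of its ends differ
by at most two on the circle, a negative edge asks the same after a rotation by `5`. The theorem
follows from an extension statement that is strong enough for induction.

In the *constraint graphs* `CGraph` there are, besides signed edges of weight `2`, weaker
constraints of weight `1`, each of which forbids one difference of two colours. Such a constraint
is what remains of a path of length two. For a set `S` of free vertices next to a precoloured set
`P`, the potential of `F ⊆ S` is `3 |F|` minus the weight of the constraints that meet `F` and lie
in `F ∪ P`. `CGraph.extends_of_pot_nonneg`: if no nonempty subset of `S` has negative potential
and `S` contains no negative `K_4`, every precolouring of `P` extends to `S`. This is proved by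
induction on `|S|`, through the properties of a minimal counterexample (`CGraph.Extremal`).

* Colouring a proper nonempty subset first and adding it to `P` shows that its potential is positive
  (`Extremal.two_le_pot`). So after a deletion, constraints can be added. For instance, a vertex
  with just two edges and one or two forbidden differences may be replaced by an edge between its
  neighbours, unless it lies in a negative triangle or stands for an edge of a negative `K_4`
  (`Extremal.blocked`).
* A vertex with constraints of total weight `d` has charge `d - 6`. Only vertices with two edges and
  one forbidden difference have negative charge. Each of them can receive charge `1` from its
  neighbours, and some charge is then left over (`Extremal.exists_gift_lt`). But the total charge is
  at most zero, so there are no such vertices and all charges vanish (`Extremal.tight`). The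
  vertices with two edges and two forbidden differences are then excluded, and all vertices are
  cubic (`Extremal.cubic`).
* In a cubic minimal counterexample there are no triangles and no negative four-cycles. A vertex and
  its three neighbours are deleted, and the ends of each of the three paths of length two that go
  through a neighbour and avoid the vertex are joined by an edge. In a colouring of the result, each
  neighbour excludes at most three of the ten colours of the vertex, so one is left (`Extremal.eq_empty`).

A critical graph that is neither the digon nor `(K_4, -)` has no two parallel edges of different
signs and no negative `K_4`, because such a subgraph is not colourable. If its potential were
nonnegative, a vertex set of minimal potential would span a proper subgraph or be empty, and a
colouring of it would extend to the whole graph by the extension statement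
(`CircularCritical.pot_neg`).
-/

open scoped Graph

set_option linter.unusedSectionVars false

namespace SignedGraph

/-! ### Colours on the circle of length ten -/

/-- Two of the ten colours are joined by a positive edge iff their difference is `near`, that is,
one of `-2, -1, 0, 1, 2`. -/
def near (d : ZMod 10) : Prop := (d + 2).val ≤ 4

instance : DecidablePred near := fun d => by unfold near; infer_instance

/-- The rotation by which an edge of sign `s` differs from a positive edge: two colours `a`, `b`
satisfy an edge of sign `s ≠ 0` iff `a - b - shift s` is `near`. -/
def shift (s : SignType) : ZMod 10 := if s = -1 then 5 else 0

theorem near_neg {d : ZMod 10} : near (-d) ↔ near d := by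
  revert d; decide +kernel

theorem shift_neg (s : SignType) : -shift s = shift s := by
  revert s; decide

theorem near_neg_sub_shift {d : ZMod 10} {s : SignType} :
    near (-d - shift s) ↔ near (d - shift s) := by
  revert d s; decide +kernel

theorem shift_mul {a b : SignType} (h : a * b ≠ 0) : shift (a * b) = shift a + shift b := by
  revert a b; decide

theorem shift_add_self (a : SignType) : shift a + shift a = 0 := by
  revert a; decide

theorem shift_triple {a b c : SignType} (h : a * b * c = -1) :
    shift a + shift b + shift c = 5 := by
  revert a b c; decide

theorem shift_triple_one {a b c : SignType} (h : a * b * c = 1) :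
    shift a + shift b + shift c = 0 := by
  revert a b c; decide

theorem ten_eq_zero : (10 : ZMod 10) = 0 := rfl

theorem exists_shift_eq (a b c : SignType) : ∃ k, shift k = shift a + shift b + shift c := by
  revert a b c; decide

theorem exists_shift_eq_five (a b : SignType) : ∃ k, shift k = shift a + shift b + 5 := by
  revert a b; decide

/-! ### Constraint graphs, weights and potentials -/

/-- A constraint graph: a simple signed graph (`sg u v` is the sign of the edge `uv`, or `0`)
together with weaker constraints: every `k ∈ ne u v` forbids that the colours of `u` and `v`
differ by exactly `shift k`. Such a constraint stands for a path of length two between `u`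
and `v`. -/
structure CGraph (V : Type*) where
  /-- the sign of the edge between two vertices, `0` if there is none -/
  sg : V → V → SignType
  /-- the forbidden differences between two vertices -/
  ne : V → V → Finset SignType
  sg_symm : ∀ u v, sg u v = sg v u
  sg_self : ∀ u, sg u u = 0
  ne_symm : ∀ u v, ne u v = ne v u
  ne_self : ∀ u, ne u u = ∅

namespace CGraph

variable {V : Type*} [DecidableEq V] (G : CGraph V)

/-- The difference `d` of the colours of `u` and `v` satisfies all constraints between them. -/
def Compat (u v : V) (d : ZMod 10) : Prop :=
  (G.sg u v ≠ 0 → near (d - shift (G.sg u v))) ∧ ∀ k ∈ G.ne u v, d ≠ shift k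

/-- `f` satisfies all constraints with one end in `S` and the other end in `S ∪ P`. -/
def Ok (S P : Finset V) (f : V → ZMod 10) : Prop :=
  ∀ u ∈ S, ∀ v ∈ S ∪ P, G.Compat u v (f u - f v)

/-- The precolouring `g` of `P` extends to `S`. -/
def Extends (S P : Finset V) (g : V → ZMod 10) : Prop :=
  ∃ f, (∀ v ∈ P, f v = g v) ∧ G.Ok S P f

/-- The weight of the constraints between two vertices: `2` for an edge, `1` for every forbidden
difference. -/
def wt (u v : V) : ℤ := (if G.sg u v = 0 then 0 else 2) + (G.ne u v).card

/-- The total weight between two sets of vertices, over ordered pairs. -/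
def wts (A B : Finset V) : ℤ := ∑ u ∈ A, ∑ v ∈ B, G.wt u v

/-- Twice the potential `3 |F| - 2 e - d` of `F` relative to the precoloured set `P`, where `e`
counts the edges and `d` the forbidden differences that lie in `F ∪ P` but not in `P`. -/
def pot (P F : Finset V) : ℤ := 6 * F.card - G.wts F F - 2 * G.wts F P

/-- The triangle `a b c` is present and its sign is negative. -/
def Neg (a b c : V) : Prop := G.sg a b * G.sg b c * G.sg a c = -1

/-- No four vertices of `S` induce a complete graph all of whose triangles are negative, that is,
a switching of `(K_4, -)`. -/
def NegK4Free (S : Finset V) : Prop :=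
  ∀ a ∈ S, ∀ b ∈ S, ∀ c ∈ S, ∀ d ∈ S,
    ¬ (G.Neg a b c ∧ G.Neg a b d ∧ G.Neg a c d ∧ G.Neg b c d)

variable {G}

theorem Compat.symm {u v : V} {d : ZMod 10} (h : G.Compat u v d) : G.Compat v u (-d) := by
  refine ⟨fun h0 => ?_, fun k hk hd => ?_⟩
  · rw [G.sg_symm] at h0 ⊢
    exact near_neg_sub_shift.2 (h.1 h0)
  · rw [G.ne_symm] at hk
    apply h.2 k hk
    rw [← shift_neg, ← hd, neg_neg]

theorem compat_of_not {u v : V} {d : ZMod 10} (h : G.sg u v = 0) (h' : G.ne u v = ∅) :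
    G.Compat u v d := by
  refine ⟨fun h0 => (h0 h).elim, ?_⟩
  simp [h']

theorem compat_self {u : V} {d : ZMod 10} : G.Compat u u d :=
  compat_of_not (G.sg_self u) (G.ne_self u)

theorem compat_comm {u v : V} {f : V → ZMod 10} (h : G.Compat u v (f u - f v)) :
    G.Compat v u (f v - f u) := by
  simpa using h.symm

theorem wt_nonneg (u v : V) : 0 ≤ G.wt u v := by
  unfold wt; split_ifs <;> positivity

theorem wt_symm (u v : V) : G.wt u v = G.wt v u := by
  unfold wt; rw [G.sg_symm, G.ne_symm]

theorem wt_self (u : V) : G.wt u u = 0 := by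
  simp [wt, G.sg_self, G.ne_self]

theorem two_le_wt {u v : V} (h : G.sg u v ≠ 0) : 2 ≤ G.wt u v := by
  unfold wt; rw [if_neg h]; simp

theorem wts_nonneg (A B : Finset V) : 0 ≤ G.wts A B :=
  Finset.sum_nonneg fun _ _ => Finset.sum_nonneg fun _ _ => wt_nonneg _ _

theorem wts_comm (A B : Finset V) : G.wts A B = G.wts B A := by
  unfold wts
  rw [Finset.sum_comm]
  simp_rw [wt_symm]

theorem wts_union_left {A B C : Finset V} (h : Disjoint A B) :
    G.wts (A ∪ B) C = G.wts A C + G.wts B C := Finset.sum_union h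

theorem wts_union_right {A B C : Finset V} (h : Disjoint A B) :
    G.wts C (A ∪ B) = G.wts C A + G.wts C B := by
  rw [wts_comm, wts_union_left h, wts_comm A, wts_comm B]

theorem wts_mono_right {A B C : Finset V} (h : B ⊆ C) : G.wts A B ≤ G.wts A C :=
  Finset.sum_le_sum fun _ _ =>
    Finset.sum_le_sum_of_subset_of_nonneg h fun _ _ _ => wt_nonneg _ _

theorem wts_mono_left {A B C : Finset V} (h : A ⊆ B) : G.wts A C ≤ G.wts B C := by
  rw [wts_comm A, wts_comm B]; exact wts_mono_right h

theorem wts_singleton_singleton (u v : V) : G.wts {u} {v} = G.wt u v := by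
  simp [wts]

theorem wts_singleton (u : V) (A : Finset V) : G.wts {u} A = ∑ v ∈ A, G.wt u v := by
  simp [wts]

theorem wts_insert_right {u v : V} {A : Finset V} (h : v ∉ A) :
    G.wts {u} (insert v A) = G.wt u v + G.wts {u} A := by
  simp [wts, Finset.sum_insert h]

theorem wt_le_wts {u v : V} {A : Finset V} (h : v ∈ A) : G.wt u v ≤ G.wts {u} A := by
  rw [wts_singleton]
  exact Finset.single_le_sum (f := G.wt u) (fun _ _ => wt_nonneg _ _) h

theorem four_le_wts {u x y : V} {A : Finset V} (hxy : x ≠ y) (hx : x ∈ A) (hy : y ∈ A)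
    (hux : G.sg u x ≠ 0) (huy : G.sg u y ≠ 0) : 4 ≤ G.wts {u} A := by
  have h : ({x, y} : Finset V) ⊆ A := by
    intro z hz; simp at hz; rcases hz with rfl | rfl <;> assumption
  have h1 := wts_mono_right (G := G) (A := {u}) h
  have h2 : G.wts {u} {x, y} = G.wt u x + G.wt u y := by
    rw [wts_singleton, Finset.sum_pair hxy]
  have := two_le_wt hux
  have := two_le_wt huy
  linarith

/-- The weights over ordered pairs within one set add up to an even number. -/
theorem even_wts_self (F : Finset V) : Even (G.wts F F) := by
  induction F using Finset.induction_on with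
  | empty => simp [wts]
  | insert u F hu ih =>
    have hd : Disjoint {u} F := by simpa using hu
    rw [Finset.insert_eq, wts_union_left hd, wts_union_right hd, wts_union_right hd,
      wts_singleton_singleton, wt_self, wts_comm F {u}]
    have : 0 + G.wts {u} F + (G.wts {u} F + G.wts F F) = 2 * G.wts {u} F + G.wts F F := by ring
    rw [this]
    exact (even_two_mul _).add ih

theorem even_pot (P F : Finset V) : Even (G.pot P F) := by
  unfold pot
  refine (Even.sub ?_ (even_wts_self F)).sub (even_two_mul _)
  exact ⟨3 * F.card, by ring⟩

/-- Colouring `H` and adding it to the precoloured set subtracts the potential of `H`. -/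
theorem pot_union {P H F : Finset V} (hd : Disjoint H F) (hP : Disjoint P H) :
    G.pot P (H ∪ F) = G.pot P H + G.pot (P ∪ H) F := by
  unfold pot
  rw [Finset.card_union_of_disjoint hd, wts_union_left hd, wts_union_left hd,
    wts_union_right hd, wts_union_right hd, wts_union_right hP, wts_comm F H]
  push_cast; ring

theorem pot_insert {P F : Finset V} {u : V} (hu : u ∉ F) (hd : Disjoint F P) :
    G.pot P (insert u F) = G.pot P F + 6 - 2 * G.wts {u} (F ∪ P) := by
  have h1 : Disjoint {u} F := by simpa using hu
  rw [wts_union_right hd]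
  unfold pot
  rw [Finset.card_insert_of_notMem hu, Finset.insert_eq, wts_union_left h1, wts_union_left h1,
    wts_union_right h1, wts_union_right h1, wts_singleton_singleton, wt_self, wts_comm F {u}]
  push_cast; ring

theorem pot_empty (P : Finset V) : G.pot P ∅ = 0 := by simp [pot, wts]

theorem pot_singleton (P : Finset V) (u : V) : G.pot P {u} = 6 - 2 * G.wts {u} P := by
  simp [pot, wts_singleton_singleton, wt_self]

theorem Neg.swap12 {a b c : V} (h : G.Neg a b c) : G.Neg b a c := by
  unfold Neg at *; rw [← h, G.sg_symm b a]; ac_rfl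

theorem Neg.swap23 {a b c : V} (h : G.Neg a b c) : G.Neg a c b := by
  unfold Neg at *; rw [← h, G.sg_symm c b]; ac_rfl

theorem Neg.ne_zero12 {a b c : V} (h : G.Neg a b c) : G.sg a b ≠ 0 := by
  intro h0; simp [Neg, h0] at h

theorem Neg.ne_zero23 {a b c : V} (h : G.Neg a b c) : G.sg b c ≠ 0 := by
  rw [G.sg_symm]
  exact h.swap12.swap23.swap12.ne_zero12

theorem Neg.ne_zero13 {a b c : V} (h : G.Neg a b c) : G.sg a c ≠ 0 := h.swap23.ne_zero12

theorem ne_of_sg {u v : V} (h : G.sg u v ≠ 0) : u ≠ v := by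
  rintro rfl; exact h (G.sg_self u)

theorem NegK4Free.mono {S T : Finset V} (h : G.NegK4Free T) (hST : S ⊆ T) : G.NegK4Free S :=
  fun a ha b hb c hc d hd => h a (hST ha) b (hST hb) c (hST hc) d (hST hd)

theorem Ok.mono {S T P : Finset V} {f : V → ZMod 10} (h : G.Ok T P f) (hST : S ⊆ T) :
    G.Ok S P f :=
  fun u hu v hv => h u (hST hu) v (Finset.union_subset_union_left hST hv)

theorem Ok.near {S P : Finset V} {f : V → ZMod 10} (h : G.Ok S P f) {u v : V} (hu : u ∈ S)
    (hv : v ∈ S ∪ P) (h0 : G.sg u v ≠ 0) : near (f u - f v - shift (G.sg u v)) :=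
  (h u hu v hv).1 h0

/-- Fewer constraints are easier to satisfy. -/
theorem Ok.of_le {G' : CGraph V} {S P : Finset V} {f : V → ZMod 10} (h : G'.Ok S P f)
    (hs : ∀ u v, G.sg u v ≠ 0 → G'.sg u v = G.sg u v) (hn : ∀ u v, G.ne u v ⊆ G'.ne u v) :
    G.Ok S P f := fun u hu v hv =>
  ⟨fun h0 => by rw [← hs u v h0]; exact (h u hu v hv).1 (by rwa [hs u v h0]),
    fun k hk => (h u hu v hv).2 k (hn u v hk)⟩

/-- Recolouring a set `T` by `h` gives a colouring if the constraints at `T` are satisfied. -/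
theorem Ok.extend {S T P : Finset V} {f h : V → ZMod 10} (hf : G.Ok S P f) (hS : Disjoint T S)
    (hP : Disjoint T P) (h1 : ∀ u ∈ T, ∀ v ∈ S ∪ P, G.Compat u v (h u - f v))
    (h2 : ∀ u ∈ T, ∀ v ∈ T, G.Compat u v (h u - h v)) :
    G.Ok (T ∪ S) P (fun v => if v ∈ T then h v else f v) := by
  have key : ∀ v, v ∈ S ∪ P → v ∉ T := by
    intro v hv hT
    rcases Finset.mem_union.1 hv with hv | hv
    · exact Finset.disjoint_left.1 hS hT hv
    · exact Finset.disjoint_left.1 hP hT hv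
  intro u hu v hv
  rw [Finset.union_assoc] at hv
  rcases Finset.mem_union.1 hu with hu | hu <;> rcases Finset.mem_union.1 hv with hv | hv
  · simpa [hu, hv] using h2 u hu v hv
  · simpa [hu, key v hv] using h1 u hu v hv
  · have hu' := Finset.mem_union_left P hu
    simpa [hv, key u hu'] using (h1 v hv u hu').symm
  · have hu' := Finset.mem_union_left P hu
    simpa [key u hu', key v hv] using hf u hu v hv

/-! ### Adding a constraint -/

/-- `1` on the two ordered pairs formed by `x` and `y`, `0` elsewhere. -/
def bump (x y u v : V) : ℤ := (if u = x ∧ v = y then 1 else 0) + (if u = y ∧ v = x then 1 else 0)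

theorem sum_bump (x y : V) (A B : Finset V) :
    ∑ u ∈ A, ∑ v ∈ B, bump x y u v =
      (if x ∈ A then 1 else 0) * (if y ∈ B then 1 else 0) +
        (if y ∈ A then 1 else 0) * (if x ∈ B then 1 else 0) := by
  have key : ∀ a b : V, ∑ u ∈ A, ∑ v ∈ B, (if u = a ∧ v = b then (1 : ℤ) else 0) =
      (if a ∈ A then 1 else 0) * (if b ∈ B then 1 else 0) := by
    intro a b
    simp only [ite_and]
    have : ∀ u, ∑ v ∈ B, (if u = a then (if v = b then (1 : ℤ) else 0) else 0) =
        if u = a then (if b ∈ B then 1 else 0) else 0 := by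
      intro u; split_ifs <;> simp_all
    simp only [this]
    rw [Finset.sum_ite_eq']
    split_ifs <;> simp
  simp only [bump, Finset.sum_add_distrib, key]

/-- A constraint of weight at most `c` between `x` and `y` lowers the doubled potential of a set by
at most `2 c`, and does so only if the set sees both `x` and `y`. -/
theorem pot_le_of_bump {G' : CGraph V} {x y : V} {c : ℤ} (hc : 0 ≤ c)
    (h : ∀ u v, G'.wt u v ≤ G.wt u v + c * bump x y u v) {P F : Finset V} (hd : Disjoint F P) :
    G.pot P F ≤ G'.pot P F + 2 * c ∧
      ((x ∉ F ∪ P ∨ y ∉ F ∪ P) → G.pot P F ≤ G'.pot P F) := by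
  have hs : ∀ A B, G'.wts A B ≤ G.wts A B + c * ((if x ∈ A then 1 else 0) *
      (if y ∈ B then 1 else 0) + (if y ∈ A then 1 else 0) * (if x ∈ B then 1 else 0)) := by
    intro A B
    rw [← sum_bump, Finset.mul_sum]
    unfold wts
    rw [← Finset.sum_add_distrib]
    refine Finset.sum_le_sum fun u _ => ?_
    rw [Finset.mul_sum, ← Finset.sum_add_distrib]
    exact Finset.sum_le_sum fun v _ => h u v
  have h1 := hs F F
  have h2 := hs F P
  have hx : x ∈ F → x ∉ P := fun h h' => Finset.disjoint_left.1 hd h h'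
  have hy : y ∈ F → y ∉ P := fun h h' => Finset.disjoint_left.1 hd h h'
  unfold pot
  simp only [Finset.mem_union]
  by_cases a1 : x ∈ F <;> by_cases a2 : y ∈ F <;> by_cases a3 : x ∈ P <;>
    by_cases a4 : y ∈ P <;> simp [a1, a2, a3, a4] at h1 h2 hx hy ⊢ <;> (try constructor) <;>
    linarith

/-- Insert an edge of sign `a` between `x` and `y`. -/
def addEdge (G : CGraph V) (x y : V) (hxy : x ≠ y) (a : SignType) : CGraph V where
  sg u v := if (u = x ∧ v = y) ∨ (u = y ∧ v = x) then a else G.sg u v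
  ne := G.ne
  sg_symm u v := by
    rw [G.sg_symm u v]
    congr 1
    simp only [eq_iff_iff]
    tauto
  sg_self u := by
    rw [if_neg, G.sg_self]
    rintro (⟨rfl, h⟩ | ⟨rfl, h⟩)
    · exact hxy h
    · exact hxy h.symm
  ne_symm := G.ne_symm
  ne_self := G.ne_self

/-- Insert a forbidden difference between `x` and `y`. -/
def addNe (G : CGraph V) (x y : V) (hxy : x ≠ y) (k : SignType) : CGraph V where
  sg := G.sg
  ne u v := if (u = x ∧ v = y) ∨ (u = y ∧ v = x) then insert k (G.ne u v) else G.ne u v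
  sg_symm := G.sg_symm
  sg_self := G.sg_self
  ne_symm u v := by
    rw [G.ne_symm u v]
    congr 1
    simp only [eq_iff_iff]
    tauto
  ne_self u := by
    rw [if_neg, G.ne_self]
    rintro (⟨rfl, h⟩ | ⟨rfl, h⟩)
    · exact hxy h
    · exact hxy h.symm

theorem bump_eq {x y : V} (hxy : x ≠ y) (u v : V) :
    bump x y u v = if (u = x ∧ v = y) ∨ (u = y ∧ v = x) then 1 else 0 := by
  unfold bump
  by_cases h1 : u = x ∧ v = y
  · simp [h1, hxy]
  · simp [h1]

theorem pot_addEdge {x y : V} (hxy : x ≠ y) (a : SignType) {P F : Finset V}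
    (hd : Disjoint F P) :
    G.pot P F ≤ (G.addEdge x y hxy a).pot P F + 4 ∧
      ((x ∉ F ∪ P ∨ y ∉ F ∪ P) → G.pot P F ≤ (G.addEdge x y hxy a).pot P F) := by
  refine pot_le_of_bump (c := 2) (by norm_num) (fun u v => ?_) hd
  rw [bump_eq hxy]
  simp only [wt, addEdge]
  split_ifs <;> simp <;> linarith

theorem pot_addNe {x y : V} (hxy : x ≠ y) (k : SignType) {P F : Finset V}
    (hd : Disjoint F P) :
    G.pot P F ≤ (G.addNe x y hxy k).pot P F + 2 ∧
      ((x ∉ F ∪ P ∨ y ∉ F ∪ P) → G.pot P F ≤ (G.addNe x y hxy k).pot P F) := by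
  refine pot_le_of_bump (c := 1) (by norm_num) (fun u v => ?_) hd
  rw [bump_eq hxy]
  have h : (((insert k (G.ne u v)).card : ℕ) : ℤ) ≤ (G.ne u v).card + 1 := by
    exact_mod_cast Finset.card_insert_le k (G.ne u v)
  simp only [wt, addNe]
  by_cases h1 : (u = x ∧ v = y) ∨ (u = y ∧ v = x)
  · rw [if_pos h1, if_pos h1, add_assoc]
    exact add_le_add le_rfl (by linarith)
  · rw [if_neg h1, if_neg h1, add_assoc]
    exact add_le_add le_rfl (by linarith)

theorem addEdge_sg_self {x y : V} (hxy : x ≠ y) (a : SignType) :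
    (G.addEdge x y hxy a).sg x y = a := by simp [addEdge]

theorem Ok.of_addEdge {x y : V} {hxy : x ≠ y} {a : SignType} {S P : Finset V} {f : V → ZMod 10}
    (h : (G.addEdge x y hxy a).Ok S P f) (h0 : G.sg x y = 0 ∨ G.sg x y = a) : G.Ok S P f := by
  refine h.of_le (fun u v huv => ?_) (fun u v => subset_rfl)
  simp only [addEdge]
  split_ifs with h1
  · rcases h1 with ⟨rfl, rfl⟩ | ⟨rfl, rfl⟩
    · exact (h0.resolve_left huv).symm
    · rw [G.sg_symm] at huv ⊢; exact (h0.resolve_left huv).symm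
  · rfl

theorem Ok.of_addNe {x y : V} {hxy : x ≠ y} {k : SignType} {S P : Finset V} {f : V → ZMod 10}
    (h : (G.addNe x y hxy k).Ok S P f) : G.Ok S P f := by
  refine h.of_le (fun u v huv => rfl) (fun u v => ?_)
  simp only [addNe]
  split_ifs
  · exact Finset.subset_insert _ _
  · exact subset_rfl

theorem Ok.ne_of_addNe {x y : V} {hxy : x ≠ y} {k : SignType} {S P : Finset V} {f : V → ZMod 10}
    (h : (G.addNe x y hxy k).Ok S P f) (hx : x ∈ S) (hy : y ∈ S ∪ P) : f x - f y ≠ shift k :=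
  (h x hx y hy).2 k (by simp [addNe])

/-- If the insertion of an edge `x y` creates a negative `K_4`, then `x` and `y` lie in a negative
`K_4` with the virtual edge `x y`. -/
theorem exists_of_not_negK4Free_addEdge {x y : V} {hxy : x ≠ y} {a : SignType} {S : Finset V}
    (hS : G.NegK4Free S) (h : ¬ (G.addEdge x y hxy a).NegK4Free S) :
    x ∈ S ∧ y ∈ S ∧ ∃ z ∈ S, ∃ t ∈ S, G.Neg x z t ∧ G.Neg y z t ∧
      G.sg x z * G.sg z y * a = -1 ∧ G.sg x t * G.sg t y * a = -1 := by
  set G' := G.addEdge x y hxy a with hG'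
  have key : ∀ c d, c ∈ S → d ∈ S → x ∈ S → y ∈ S → G'.Neg x y c → G'.Neg x y d → G'.Neg x c d →
      G'.Neg y c d → ∃ z ∈ S, ∃ t ∈ S, G.Neg x z t ∧ G.Neg y z t ∧
      G.sg x z * G.sg z y * a = -1 ∧ G.sg x t * G.sg t y * a = -1 := by
    intro c d hc hd _ _ h1 h2 h3 h4
    have cx := (ne_of_sg h1.ne_zero13).symm
    have cy := (ne_of_sg h1.ne_zero23).symm
    have dx := (ne_of_sg h2.ne_zero13).symm
    have dy := (ne_of_sg h2.ne_zero23).symm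
    refine ⟨c, hc, d, hd, ?_, ?_, ?_, ?_⟩
    · simpa [Neg, hG', addEdge, cx, cy, dx, dy] using h3
    · simpa [Neg, hG', addEdge, cx, cy, dx, dy] using h4
    · simp only [Neg, hG', addEdge, cx, cy, hxy] at h1
      simp at h1
      rw [← h1, G.sg_symm y c]; ac_rfl
    · simp only [Neg, hG', addEdge, dx, dy, hxy] at h2
      simp at h2
      rw [← h2, G.sg_symm y d]; ac_rfl
  have old : ∀ u v, ¬ ((u = x ∧ v = y) ∨ (u = y ∧ v = x)) → G'.sg u v = G.sg u v := by
    intro u v huv; simp only [hG', addEdge]; rw [if_neg huv]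
  simp only [NegK4Free, not_forall, not_not] at h
  obtain ⟨p, hp, q, hq, r, hr, s, hs, h1, h2, h3, h4⟩ := h
  have main : ∀ p q r s, p ∈ S → q ∈ S → r ∈ S → s ∈ S → G'.Neg p q r → G'.Neg p q s →
      G'.Neg p r s → G'.Neg q r s → ((p = x ∧ q = y) ∨ (p = y ∧ q = x)) →
      x ∈ S ∧ y ∈ S ∧ ∃ z ∈ S, ∃ t ∈ S, G.Neg x z t ∧ G.Neg y z t ∧
      G.sg x z * G.sg z y * a = -1 ∧ G.sg x t * G.sg t y * a = -1 := by
    rintro p q r s hp hq hr hs h1 h2 h3 h4 (⟨rfl, rfl⟩ | ⟨rfl, rfl⟩)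
    · exact ⟨hp, hq, key r s hr hs hp hq h1 h2 h3 h4⟩
    · exact ⟨hq, hp, key r s hr hs hq hp h1.swap12 h2.swap12 h4 h3⟩
  by_cases e1 : (p = x ∧ q = y) ∨ (p = y ∧ q = x)
  · exact main p q r s hp hq hr hs h1 h2 h3 h4 e1
  by_cases e2 : (p = x ∧ r = y) ∨ (p = y ∧ r = x)
  · exact main p r q s hp hr hq hs h1.swap23 h3 h2 h4.swap12 e2
  by_cases e3 : (p = x ∧ s = y) ∨ (p = y ∧ s = x)
  · exact main p s q r hp hs hq hr h2.swap23 h3.swap23 h1 h4.swap23.swap12 e3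
  by_cases e4 : (q = x ∧ r = y) ∨ (q = y ∧ r = x)
  · exact main q r p s hq hr hp hs h1.swap12.swap23 h4 h2.swap12 h3.swap12 e4
  by_cases e5 : (q = x ∧ s = y) ∨ (q = y ∧ s = x)
  · exact main q s p r hq hs hp hr h2.swap12.swap23 h4.swap23 h1.swap12 h3.swap23.swap12 e5
  by_cases e6 : (r = x ∧ s = y) ∨ (r = y ∧ s = x)
  · exact main r s p q hr hs hp hq h3.swap12.swap23 h4.swap12.swap23
      h1.swap23.swap12 h2.swap23.swap12 e6
  exact (hS p hp q hq r hr s hs (by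
    simp only [Neg, old _ _ e1, old _ _ e2, old _ _ e3, old _ _ e4, old _ _ e5, old _ _ e6] at *
    exact ⟨h1, h2, h3, h4⟩)).elim

theorem NegK4Free.addNe {x y : V} {hxy : x ≠ y} {k : SignType} {S : Finset V}
    (hS : G.NegK4Free S) : (G.addNe x y hxy k).NegK4Free S := hS

/-! ### Degrees and extension of colourings -/

/-- The vertices of `X` joined to `u` by an edge. -/
def nbrs (G : CGraph V) (X : Finset V) (u : V) : Finset V := X.filter fun v => G.sg u v ≠ 0

/-- The number of forbidden differences between `u` and the vertices of `X`. -/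
def nes (G : CGraph V) (X : Finset V) (u : V) : ℕ := ∑ v ∈ X, (G.ne u v).card

/-- The colours that the forbidden differences with the vertices of `Y` exclude at `u`. -/
def forb (G : CGraph V) (Y : Finset V) (f : V → ZMod 10) (u : V) : Finset (ZMod 10) :=
  Y.biUnion fun v => (G.ne u v).image fun k => f v + shift k

theorem mem_nbrs {X : Finset V} {u v : V} : v ∈ G.nbrs X u ↔ v ∈ X ∧ G.sg u v ≠ 0 := by
  simp [nbrs]

theorem wts_eq_card (X : Finset V) (u : V) :
    G.wts {u} X = 2 * (G.nbrs X u).card + G.nes X u := by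
  rw [wts_singleton]
  simp only [wt, Finset.sum_add_distrib, nes, nbrs, Finset.card_filter]
  push_cast
  rw [Finset.mul_sum]
  congr 1
  refine Finset.sum_congr rfl fun v _ => ?_
  split_ifs <;> simp_all

theorem nes_mono {X Y : Finset V} (h : X ⊆ Y) (u : V) : G.nes X u ≤ G.nes Y u :=
  Finset.sum_le_sum_of_subset h

theorem card_ne_le_nes {X : Finset V} {u v : V} (h : v ∈ X) : (G.ne u v).card ≤ G.nes X u :=
  Finset.single_le_sum (f := fun v => (G.ne u v).card) (fun _ _ => Nat.zero_le _) h

theorem card_forb_le (Y : Finset V) (f : V → ZMod 10) (u : V) :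
    (G.forb Y f u).card ≤ G.nes Y u :=
  Finset.card_biUnion_le.trans (Finset.sum_le_sum fun _ _ => Finset.card_image_le)

theorem compat_of_notMem_forb {Y : Finset V} {f : V → ZMod 10} {u v : V} {c : ZMod 10}
    (hv : v ∈ Y) (hc : c ∉ G.forb Y f u)
    (h : G.sg u v ≠ 0 → near (c - f v - shift (G.sg u v))) : G.Compat u v (c - f v) := by
  refine ⟨h, fun k hk hd => hc ?_⟩
  rw [forb, Finset.mem_biUnion]
  exact ⟨v, hv, Finset.mem_image.2 ⟨k, hk, by rw [← hd]; ring⟩⟩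

theorem ne_eq_empty_of_nes {X : Finset V} {u v : V} (h : v ∈ X) (h0 : G.nes X u = 0) :
    G.ne u v = ∅ := by
  have := card_ne_le_nes (G := G) (u := u) h
  rw [h0] at this
  simpa using this

/-- Colour one more vertex. -/
theorem Ok.insert {S P : Finset V} {f : V → ZMod 10} (hf : G.Ok S P f) {u : V} (hS : u ∉ S)
    (hP : u ∉ P) {c : ZMod 10} (h : ∀ v ∈ S ∪ P, G.Compat u v (c - f v)) :
    G.Ok (insert u S) P (Function.update f u c) := by
  have := hf.extend (T := {u}) (h := fun _ => c) (by simpa using hS) (by simpa using hP)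
    (by simpa using h) (by simp [compat_self])
  rw [Finset.insert_eq]
  convert this using 1
  ext v
  by_cases hv : v = u
  · simp [hv]
  · simp [hv]

theorem card_near (a : ZMod 10) : (Finset.univ.filter fun c => near (c - a)).card = 5 := by
  revert a; decide +kernel

theorem card_near_near {a b : ZMod 10} (h : near (a - b)) :
    3 ≤ (Finset.univ.filter fun c => near (c - a) ∧ near (c - b)).card := by
  revert a b; decide +kernel

theorem exists_near_near {a b : ZMod 10} (h : a - b ≠ 5) : ∃ c, near (c - a) ∧ near (c - b) := by
  revert a b; decide +kernel

theorem exists_notMem_of_card {A B : Finset (ZMod 10)} (h : B.card < A.card) : ∃ c ∈ A, c ∉ B :=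
  Finset.exists_mem_notMem_of_card_lt_card h

/-! ### Minimal counterexamples -/

/-- A precoloured constraint graph `G` on `S ∪ P` whose free part `S` has nonnegative potentials and
no negative `K_4`, to which the precolouring does not extend, although precolourings extend in
all such situations with fewer free vertices. -/
structure Extremal (G : CGraph V) (S P : Finset V) (g : V → ZMod 10) : Prop where
  disj : Disjoint S P
  pot_nonneg : ∀ F ⊆ S, F.Nonempty → 0 ≤ G.pot P F
  k4 : G.NegK4Free S
  not_extends : ¬ G.Extends S P g
  ih : ∀ (G' : CGraph V) (S' P' : Finset V) (g' : V → ZMod 10), S'.card < S.card →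
    Disjoint S' P' → (∀ F ⊆ S', F.Nonempty → 0 ≤ G'.pot P' F) → G'.NegK4Free S' →
    G'.Extends S' P' g'

namespace Extremal

variable {S P : Finset V} {g : V → ZMod 10}

/-- After the deletion of some vertices a changed constraint graph can be coloured as long as it
keeps nonnegative potentials and has no negative `K_4`. -/
theorem extends_of_ssubset (h : Extremal G S P g) {G' : CGraph V} {S' : Finset V} (hS : S' ⊂ S)
    (hp : ∀ F ⊆ S', F.Nonempty → 0 ≤ G'.pot P F) (hk : G'.NegK4Free S') : G'.Extends S' P g :=
  h.ih G' S' P g (Finset.card_lt_card hS) (h.disj.mono_left hS.subset) hp hk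

theorem sub_extends (h : Extremal G S P g) {S' : Finset V} (hS : S' ⊂ S) : G.Extends S' P g :=
  h.extends_of_ssubset hS (fun F hF => h.pot_nonneg F (hF.trans hS.subset))
    (h.k4.mono hS.subset)

/-- The potential of a proper subset exceeds that of `S`: colour the subset and let it join the
precoloured set; by minimality the rest has a subset of negative relative potential. -/
theorem pot_add_two_le (h : Extremal G S P g) :
    ∀ (n : ℕ) (F : Finset V), (S \ F).card = n → F ⊂ S → F.Nonempty →
      G.pot P S + 2 ≤ G.pot P F := by
  intro n
  induction n using Nat.strong_induction_on with
  | _ n IH =>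
    rintro F rfl hFS hF
    obtain ⟨f, hfg, hf⟩ := h.sub_extends hFS
    have hFP : Disjoint F P := h.disj.mono_left hFS.subset
    have hcard : (S \ F).card < S.card := by
      apply Finset.card_lt_card
      refine ⟨Finset.sdiff_subset, fun hs => ?_⟩
      obtain ⟨v, hv⟩ := hF
      exact (Finset.mem_sdiff.1 (hs (hFS.subset hv))).2 hv
    have hdis : Disjoint (S \ F) (P ∪ F) := by
      rw [Finset.disjoint_union_right]
      exact ⟨h.disj.mono_left Finset.sdiff_subset, Finset.sdiff_disjoint⟩
    have hno : ¬ G.Extends (S \ F) (P ∪ F) f := by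
      rintro ⟨f', hf'f, hf'⟩
      refine h.not_extends ⟨f', fun v hv => ?_, ?_⟩
      · rw [hf'f v (Finset.mem_union_left _ hv), hfg v hv]
      · have e : (S \ F) ∪ (P ∪ F) = S ∪ P := by
          rw [Finset.union_comm P, ← Finset.union_assoc, Finset.sdiff_union_of_subset hFS.subset]
        have hs : S ∪ P = (S \ F) ∪ (F ∪ P) := by rw [← e, Finset.union_comm P]
        intro u hu v hv
        by_cases huF : u ∈ F
        · rw [hs] at hv
          rcases Finset.mem_union.1 hv with hv | hv
          · exact compat_comm (hf' v hv u (by simp [huF]))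
          · rw [hf'f u (by simp [huF]), hf'f v (by rwa [Finset.union_comm])]
            exact hf u huF v hv
        · exact hf' u (by simp [hu, huF]) v (by rwa [e])
    have hex : ∃ T ⊆ S \ F, T.Nonempty ∧ G.pot (P ∪ F) T < 0 := by
      by_contra hcon
      push Not at hcon
      exact hno (h.ih G _ _ f hcard hdis hcon (h.k4.mono Finset.sdiff_subset))
    obtain ⟨T, hT, hTn, hTp⟩ := hex
    have hFT : Disjoint F T := Finset.disjoint_sdiff.mono_right hT
    have e1 := pot_union (G := G) hFT hFP.symm
    have e2 : G.pot (P ∪ F) T ≤ -2 := by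
      obtain ⟨r, hr⟩ := even_pot (G := G) (P ∪ F) T
      omega
    have hsub : F ∪ T ⊆ S := Finset.union_subset hFS.subset (hT.trans Finset.sdiff_subset)
    by_cases heq : F ∪ T = S
    · rw [heq] at e1; linarith
    · have := IH _ (by
        apply Finset.card_lt_card
        refine ⟨Finset.sdiff_subset_sdiff subset_rfl Finset.subset_union_left, fun hs => ?_⟩
        obtain ⟨v, hv⟩ := hTn
        have := hs (hT hv)
        simp [hv] at this) (F ∪ T) rfl (hsub.ssubset_of_ne heq)
          (hF.mono Finset.subset_union_left)
      linarith

theorem two_le_pot (h : Extremal G S P g) {F : Finset V} (hF : F ⊂ S) (hn : F.Nonempty) :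
    2 ≤ G.pot P F := by
  have h1 := h.pot_add_two_le _ F rfl hF hn
  have h2 := h.pot_nonneg S subset_rfl (hn.mono hF.subset)
  linarith

theorem notMem_P (h : Extremal G S P g) {u : V} (hu : u ∈ S) : u ∉ P :=
  Finset.disjoint_left.1 h.disj hu

theorem erase_ssubset (_ : Extremal G S P g) {u : V} (hu : u ∈ S) : S.erase u ⊂ S :=
  Finset.erase_ssubset hu

/-- In a colouring of `S - u` no colour of `u` satisfies all constraints at `u`. -/
theorem no_color (h : Extremal G S P g) {u : V} (hu : u ∈ S) {f : V → ZMod 10}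
    (hfg : ∀ v ∈ P, f v = g v) (hf : G.Ok (S.erase u) P f) (c : ZMod 10)
    (hc : ∀ v ∈ S.erase u ∪ P, G.sg u v ≠ 0 → near (c - f v - shift (G.sg u v))) :
    c ∈ G.forb (S.erase u ∪ P) f u := by
  by_contra hcf
  have := hf.insert (u := u) (by simp) (h.notMem_P hu)
    (fun v hv => compat_of_notMem_forb hv hcf (hc v hv))
  rw [Finset.insert_erase hu] at this
  refine h.not_extends ⟨_, fun v hv => ?_, this⟩
  rw [Function.update_of_ne, hfg v hv]
  rintro rfl
  exact h.notMem_P hu hv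

theorem nes_erase_le (u : V) : G.nes (S.erase u ∪ P) u ≤ G.nes (S ∪ P) u :=
  nes_mono (Finset.union_subset_union_left (Finset.erase_subset _ _)) u

theorem forb_card_le (f : V → ZMod 10) (u : V) :
    (G.forb (S.erase u ∪ P) f u).card ≤ G.nes (S ∪ P) u :=
  (card_forb_le _ _ _).trans (nes_erase_le u)

theorem mem_erase_union {u v : V} (hv : v ∈ S ∪ P) (hne : v ≠ u) : v ∈ S.erase u ∪ P := by
  rcases Finset.mem_union.1 hv with hv | hv
  · exact Finset.mem_union_left _ (Finset.mem_erase.2 ⟨hne, hv⟩)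
  · exact Finset.mem_union_right _ hv

theorem erase_union_subset {u v : V} (hv : v ∈ S.erase u ∪ P) : v ∈ S ∪ P :=
  Finset.union_subset_union_left (Finset.erase_subset _ _) hv

theorem ten_le_nes (h : Extremal G S P g) {u : V} (hu : u ∈ S)
    (h0 : (G.nbrs (S ∪ P) u).card = 0) : 10 ≤ G.nes (S ∪ P) u := by
  obtain ⟨f, hfg, hf⟩ := h.sub_extends (h.erase_ssubset hu)
  by_contra hlt
  obtain ⟨c, -, hc⟩ := exists_notMem_of_card (A := Finset.univ)
    (B := G.forb (S.erase u ∪ P) f u) (by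
      have := forb_card_le (G := G) (S := S) (P := P) f u
      simp; omega)
  refine hc (h.no_color hu hfg hf c fun v hv hs => ?_)
  have : v ∈ G.nbrs (S ∪ P) u := mem_nbrs.2 ⟨erase_union_subset hv, hs⟩
  rw [Finset.card_eq_zero.1 h0] at this
  simp at this

theorem five_le_nes (h : Extremal G S P g) {u : V} (hu : u ∈ S)
    (h1 : (G.nbrs (S ∪ P) u).card = 1) : 5 ≤ G.nes (S ∪ P) u := by
  obtain ⟨f, hfg, hf⟩ := h.sub_extends (h.erase_ssubset hu)
  obtain ⟨x, hx⟩ := Finset.card_eq_one.1 h1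
  by_contra hlt
  obtain ⟨c, hc1, hc⟩ := exists_notMem_of_card
    (A := Finset.univ.filter fun c => near (c - (f x + shift (G.sg u x))))
    (B := G.forb (S.erase u ∪ P) f u) (by
      have := forb_card_le (G := G) (S := S) (P := P) f u
      rw [card_near]; omega)
  refine hc (h.no_color hu hfg hf c fun v hv hs => ?_)
  have : v ∈ G.nbrs (S ∪ P) u := mem_nbrs.2 ⟨erase_union_subset hv, hs⟩
  rw [hx, Finset.mem_singleton] at this
  subst this
  rw [Finset.mem_filter] at hc1
  rw [sub_sub]; exact hc1.2

/-- With two edges at `u`, colours close to both shifted neighbours satisfy the edges. -/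
theorem no_color_two (h : Extremal G S P g) {u x y : V} (hu : u ∈ S)
    (hn : G.nbrs (S ∪ P) u = {x, y}) {f : V → ZMod 10}
    (hfg : ∀ v ∈ P, f v = g v) (hf : G.Ok (S.erase u) P f) (c : ZMod 10)
    (hx : near (c - (f x + shift (G.sg u x)))) (hy : near (c - (f y + shift (G.sg u y)))) :
    c ∈ G.forb (S.erase u ∪ P) f u := by
  refine h.no_color hu hfg hf c fun v hv hs => ?_
  have : v ∈ G.nbrs (S ∪ P) u := mem_nbrs.2 ⟨erase_union_subset hv, hs⟩
  rw [hn, Finset.mem_insert, Finset.mem_singleton] at this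
  rw [sub_sub]
  rcases this with rfl | rfl <;> assumption

/-- A vertex with two edges carries a forbidden difference: otherwise it can be replaced by a
forbidden difference between its neighbours. -/
theorem one_le_nes (h : Extremal G S P g) {u : V} (hu : u ∈ S)
    (h2 : (G.nbrs (S ∪ P) u).card = 2) : 1 ≤ G.nes (S ∪ P) u := by
  obtain ⟨x, y, hxy, hn⟩ := Finset.card_eq_two.1 h2
  by_contra hlt
  have h0 : G.nes (S ∪ P) u = 0 := by omega
  obtain ⟨k, hk⟩ := exists_shift_eq_five (G.sg u x) (G.sg u y)
  have hx : x ∈ G.nbrs (S ∪ P) u := by simp [hn]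
  have hy : y ∈ G.nbrs (S ∪ P) u := by simp [hn]
  rw [mem_nbrs] at hx hy
  have hx' := mem_erase_union hx.1 (ne_of_sg hx.2).symm
  have hy' := mem_erase_union hy.1 (ne_of_sg hy.2).symm
  obtain ⟨f, hfg, hf⟩ := h.extends_of_ssubset (G' := G.addNe x y hxy k) (h.erase_ssubset hu)
    (fun F hF hFn => by
      have hFS := hF.trans_ssubset (h.erase_ssubset hu)
      have := (pot_addNe (G := G) hxy k (h.disj.mono_left hFS.subset)).1
      have := h.two_le_pot hFS hFn
      linarith) (h.k4.mono (h.erase_ssubset hu).subset).addNe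
  have hne : (f x + shift (G.sg u x)) - (f y + shift (G.sg u y)) ≠ 5 := by
    have hnoP : ¬ (x ∈ P ∧ y ∈ P) := by
      rintro ⟨hxP, hyP⟩
      have h1 := h.pot_nonneg {u} (by simpa using hu) (by simp)
      have := four_le_wts (G := G) hxy hxP hyP hx.2 hy.2
      rw [pot_singleton] at h1
      linarith
    have key : f x - f y ≠ shift k := by
      by_cases hxS : x ∈ S
      · exact hf.ne_of_addNe (Finset.mem_erase.2 ⟨(ne_of_sg hx.2).symm, hxS⟩) hy'
      · have hxP : x ∈ P := (Finset.mem_union.1 hx.1).resolve_left hxS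
        have hyS : y ∈ S := (Finset.mem_union.1 hy.1).resolve_right fun hyP => hnoP ⟨hxP, hyP⟩
        intro he
        refine (hf y (Finset.mem_erase.2 ⟨(ne_of_sg hy.2).symm, hyS⟩) x hx').2 k
          (by simp [addNe]) ?_
        rw [← shift_neg, ← he, neg_sub]
    intro he
    apply key
    rw [hk, ← he, ← shift_neg (G.sg u y)]
    have := shift_add_self (G.sg u x)
    linear_combination -this
  obtain ⟨c, hc1, hc2⟩ := exists_near_near hne
  have := h.no_color_two hu hn hfg hf.of_addNe c hc1 hc2
  have hcard := forb_card_le (G := G) (S := S) (P := P) f u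
  rw [h0, Nat.le_zero, Finset.card_eq_zero] at hcard
  rw [hcard] at this
  simp at this

/-- The potential bound that leaves room for a new edge between two neighbours of a deleted
vertex which carries a forbidden difference. -/
theorem four_le_pot (h : Extremal G S P g) {u x y : V} (hu : u ∈ S) (hxy : x ≠ y)
    (hx : G.sg u x ≠ 0) (hy : G.sg u y ≠ 0) (hD : 5 ≤ G.wts {u} (S ∪ P)) {F : Finset V}
    (hF : F ⊆ S.erase u) (hxF : x ∈ F ∪ P) (hyF : y ∈ F ∪ P) :
    4 ≤ G.pot P F := by
  have huF : u ∉ F := fun hm => (Finset.mem_erase.1 (hF hm)).1 rfl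
  have hFS := hF.trans (Finset.erase_subset u S)
  have e := pot_insert (G := G) huF (h.disj.mono_left hFS)
  have h4 := four_le_wts (G := G) hxy hxF hyF hx hy
  have hsub : insert u F ⊆ S := Finset.insert_subset hu hFS
  by_cases heq : insert u F = S
  · have h0 := h.pot_nonneg S subset_rfl ⟨u, hu⟩
    rw [heq] at e
    have : G.wts {u} (S ∪ P) = G.wts {u} (F ∪ P) := by
      rw [← heq, Finset.insert_union, wts_insert_right, wt_self, zero_add]
      simp [huF, h.notMem_P hu]
    linarith
  · have := h.two_le_pot (hsub.ssubset_of_ne heq) ⟨u, by simp⟩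
    linarith

end Extremal

/-- The vertices `x`, `y`, `z`, `t` form a negative `K_4` in which the path `x u y` stands for the
edge `x y`. -/
def NegK4Via (G : CGraph V) (u x y z t : V) : Prop :=
  G.Neg x z t ∧ G.Neg y z t ∧ G.sg x z * G.sg z y * (G.sg u x * G.sg u y) = -1 ∧
    G.sg x t * G.sg t y * (G.sg u x * G.sg u y) = -1

namespace Extremal

variable {S P : Finset V} {g : V → ZMod 10}

theorem neg_left_mem (h : Extremal G S P g) {u x y : V} (hu : u ∈ S)
    (hn : G.nbrs (S ∪ P) u = {x, y}) (h1 : 1 ≤ G.nes (S ∪ P) u) (hN : G.Neg u x y) :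
    x ∈ S := by
  have hxy : x ≠ y := ne_of_sg hN.ne_zero23
  have hx : x ∈ G.nbrs (S ∪ P) u := by simp [hn]
  have hy : y ∈ G.nbrs (S ∪ P) u := by simp [hn]
  have hD : G.wts {u} (S ∪ P) = 4 + G.nes (S ∪ P) u := by
    rw [wts_eq_card, hn, Finset.card_pair hxy]; norm_num
  rw [mem_nbrs] at hx hy
  by_contra hxS
  have hxP : x ∈ P := (Finset.mem_union.1 hx.1).resolve_left hxS
  have hu0 := h.pot_nonneg {u} (by simpa using hu) (by simp)
  rw [pot_singleton] at hu0
  by_cases hyP : y ∈ P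
  · have := four_le_wts (G := G) hxy hxP hyP hx.2 hy.2
    linarith
  have hyS : y ∈ S := (Finset.mem_union.1 hy.1).resolve_right hyP
  have huy : y ∉ ({u} : Finset V) := by simpa using (ne_of_sg hy.2).symm
  have e := pot_insert (G := G) (P := P) huy (by simpa using h.notMem_P hu)
  have h4 : 4 ≤ G.wts {y} ({u} ∪ P) :=
    four_le_wts (ne_of_sg hx.2) (by simp) (by simp [hxP]) (by rw [G.sg_symm]; exact hy.2)
      (by rw [G.sg_symm]; exact hN.ne_zero23)
  have h2 : 2 ≤ G.wts {u} P := (two_le_wt hx.2).trans (wt_le_wts hxP)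
  rw [pot_singleton] at e
  by_cases heq : insert y {u} = S
  · have h0 := h.pot_nonneg S subset_rfl ⟨u, hu⟩
    rw [heq] at e
    -- then all constraints at `u` lie in `{u, y} ∪ P`
    have h5 : 5 ≤ G.wt u y + G.wts {u} P := by
      have : G.wts {u} (S ∪ P) = G.wt u y + G.wts {u} P := by
        rw [← heq, Finset.insert_union, wts_insert_right
          (by rw [Finset.mem_union]; exact not_or.2 ⟨huy, hyP⟩),
          ← Finset.insert_eq, wts_insert_right (h.notMem_P hu), wt_self, zero_add]
      linarith [(Nat.cast_le (α := ℤ)).2 h1]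
    have h6 : G.wt u y + 2 ≤ G.wts {y} ({u} ∪ P) := by
      rw [← Finset.insert_eq, wts_insert_right (h.notMem_P hu), wt_symm]
      have := (two_le_wt (G := G) (u := y) (v := x)
        (by rw [G.sg_symm]; exact hN.ne_zero23)).trans (wt_le_wts hxP)
      linarith
    linarith
  · have := h.two_le_pot ((Finset.insert_subset hyS (by simpa using hu)).ssubset_of_ne heq)
      ⟨u, by simp⟩
    linarith

/-- A vertex with two edges and at most two forbidden differences is blocked: an edge of the
suitable sign between its neighbours would leave it three colours, so this edge must be
impossible. Either it is present with the other sign, or it would create a negative `K_4`. -/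
theorem blocked (h : Extremal G S P g) {u x y : V} (hu : u ∈ S) (hxy : x ≠ y)
    (hn : G.nbrs (S ∪ P) u = {x, y}) (h1 : 1 ≤ G.nes (S ∪ P) u) (h2 : G.nes (S ∪ P) u ≤ 2) :
    x ∈ S ∧ y ∈ S ∧ (G.Neg u x y ∨ ∃ z ∈ S, ∃ t ∈ S, z ≠ u ∧ t ≠ u ∧ G.NegK4Via u x y z t) := by
  have hx : x ∈ G.nbrs (S ∪ P) u := by simp [hn]
  have hy : y ∈ G.nbrs (S ∪ P) u := by simp [hn]
  have hD : G.wts {u} (S ∪ P) = 4 + G.nes (S ∪ P) u := by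
    rw [wts_eq_card, hn, Finset.card_pair hxy]; norm_num
  rw [mem_nbrs] at hx hy
  by_cases hN : G.Neg u x y
  · exact ⟨h.neg_left_mem hu hn h1 hN, h.neg_left_mem hu (hn.trans (Finset.pair_comm _ _)) h1
      hN.swap23, Or.inl hN⟩
  have h0 : G.sg x y = 0 ∨ G.sg x y = G.sg u x * G.sg u y := by
    have a1 := hx.2
    have a2 := hy.2
    unfold Neg at hN
    revert a1 a2 hN
    generalize G.sg u x = a; generalize G.sg u y = b; generalize G.sg x y = c
    revert a b c; decide
  set G' := G.addEdge x y hxy (G.sg u x * G.sg u y) with hG'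
  by_cases hk : G'.NegK4Free (S.erase u)
  · exfalso
    obtain ⟨f, hfg, hf⟩ := h.extends_of_ssubset (G' := G') (h.erase_ssubset hu)
      (fun F hF hFn => by
        have hFS := hF.trans_ssubset (h.erase_ssubset hu)
        have hp := pot_addEdge (G := G) hxy (G.sg u x * G.sg u y) (h.disj.mono_left hFS.subset)
        have := h.two_le_pot hFS hFn
        by_cases hm : x ∉ F ∪ P ∨ y ∉ F ∪ P
        · linarith [hp.2 hm]
        · push Not at hm
          have := h.four_le_pot hu hxy hx.2 hy.2 (by
            rw [hD]; linarith [(Nat.cast_le (α := ℤ)).2 h1]) hF hm.1 hm.2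
          linarith [hp.1]) hk
    have hnoP : ¬ (x ∈ P ∧ y ∈ P) := by
      rintro ⟨hxP, hyP⟩
      have h1 := h.pot_nonneg {u} (by simpa using hu) (by simp)
      have := four_le_wts (G := G) hxy hxP hyP hx.2 hy.2
      rw [pot_singleton] at h1
      linarith
    have hx' := mem_erase_union hx.1 (ne_of_sg hx.2).symm
    have hy' := mem_erase_union hy.1 (ne_of_sg hy.2).symm
    have hab : G.sg u x * G.sg u y ≠ 0 := mul_ne_zero hx.2 hy.2
    have key : near (f x - f y - shift (G.sg u x * G.sg u y)) := by
      have e := addEdge_sg_self (G := G) hxy (G.sg u x * G.sg u y)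
      by_cases hxS : x ∈ S
      · have := hf.near (Finset.mem_erase.2 ⟨(ne_of_sg hx.2).symm, hxS⟩) hy'
          (by rw [e]; exact hab)
        rwa [e] at this
      · have hxP : x ∈ P := (Finset.mem_union.1 hx.1).resolve_left hxS
        have hyS : y ∈ S := (Finset.mem_union.1 hy.1).resolve_right fun hyP => hnoP ⟨hxP, hyP⟩
        rw [CGraph.sg_symm] at e
        have := hf.near (Finset.mem_erase.2 ⟨(ne_of_sg hy.2).symm, hyS⟩) hx'
          (by rw [e]; exact hab)
        rw [e, ← near_neg_sub_shift, neg_sub] at this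
        exact this
    have hnear : near ((f x + shift (G.sg u x)) - (f y + shift (G.sg u y))) := by
      rw [shift_mul hab] at key
      convert key using 1
      linear_combination shift_add_self (G.sg u x)
    obtain ⟨c, hc1, hc⟩ := exists_notMem_of_card
      (B := G.forb (S.erase u ∪ P) f u) (lt_of_lt_of_le (by
        have := forb_card_le (G := G) (S := S) (P := P) f u
        omega) (card_near_near hnear))
    rw [Finset.mem_filter] at hc1
    exact hc (h.no_color_two hu hn hfg (hf.of_addEdge h0) c hc1.2.1 hc1.2.2)
  · obtain ⟨hxS, hyS, z, hz, t, ht, k1, k2, k3, k4⟩ := exists_of_not_negK4Free_addEdge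
      (h.k4.mono (h.erase_ssubset hu).subset) hk
    rw [Finset.mem_erase] at hxS hyS hz ht
    exact ⟨hxS.2, hyS.2, Or.inr ⟨z, hz.2, t, ht.2, hz.1, ht.1, k1, k2, k3, k4⟩⟩

end Extremal
/-! ### Negative triangles at light vertices -/

theorem exists_add_notMem {A B : Finset (ZMod 10)} (t : ZMod 10) (h : B.card < A.card) :
    ∃ p ∈ A, t + p ∉ B := by
  obtain ⟨p, hp, hpB⟩ := exists_notMem_of_card (A := A) (B := B.image (· - t))
    (Finset.card_image_le.trans_lt h)
  exact ⟨p, hp, fun hm => hpB (Finset.mem_image.2 ⟨t + p, hm, by ring⟩)⟩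

theorem exists_subset_singleton {B : Finset (ZMod 10)} (h : B.card ≤ 1) : ∃ a, B ⊆ {a} := by
  obtain ⟨a, ha⟩ := Finset.card_le_one_iff_subset_singleton.1 h
  exact ⟨a, ha⟩

theorem exists_subset_pair {B : Finset (ZMod 10)} (h : B.card ≤ 2) : ∃ a b, B ⊆ {a, b} := by
  by_cases h1 : B.card ≤ 1
  · obtain ⟨a, ha⟩ := exists_subset_singleton h1
    exact ⟨a, a, by simpa using ha⟩
  · obtain ⟨a, b, -, rfl⟩ := Finset.card_eq_two.1 (by omega : B.card = 2)
    exact ⟨a, b, subset_rfl⟩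

theorem two_le_card_far {r : ZMod 10} (h : r = 2 ∨ r = -2) :
    2 ≤ (Finset.univ.filter fun p => near p ∧ near (p - r - 5)).card := by
  rcases h with rfl | rfl <;> decide +kernel

theorem exists_extreme {r e : ZMod 10} (h : near r) (he : near (r - e)) :
    ∃ r', (r' = 2 ∨ r' = -2) ∧ near (r' - e) := by
  revert r e; decide +kernel

theorem exists_far_pair (f₁ f₂ g : ZMod 10) : ∃ r p, near r ∧ near p ∧ near (p - r - 5) ∧
    r ≠ f₁ ∧ r ≠ f₂ ∧ p ≠ g := by
  revert f₁ f₂ g; decide +kernel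

theorem near_of_extreme {r : ZMod 10} (h : r = 2 ∨ r = -2) : near r := by
  rcases h with rfl | rfl <;> decide

theorem sub_ne_of_far {p r : ZMod 10} (hp : near p) (hr : near r) (h : near (p - r - 5)) :
    p - r ≠ 0 ∧ p - r ≠ 5 := by
  revert p r; decide +kernel

theorem shift_eq_or (a b c : SignType) :
    shift a + shift b + shift c = 0 ∨ shift a + shift b + shift c = 5 := by
  revert a b c; decide

/-- In coordinates relative to the third vertex of a negative triangle, the constraints between the
two other vertices say that their coordinates are far apart. -/
theorem Neg.near_iff {u x y : V} (h : G.Neg u x y) (t p r : ZMod 10) :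
    near (t + shift (G.sg u y) + p - (t + shift (G.sg x y) + r) - shift (G.sg u x)) ↔
      near (p - r - 5) := by
  have h5 := shift_triple h
  have e : t + shift (G.sg u y) + p - (t + shift (G.sg x y) + r) - shift (G.sg u x) =
      p - r - 5 := by
    linear_combination (-1 : ZMod 10) * h5 + shift_add_self (G.sg u y)
  rw [e]

theorem Neg.compat {u x y : V} (h : G.Neg u x y) (t : ZMod 10) {p r : ZMod 10} (hp : near p)
    (hr : near r) (hpr : near (p - r - 5)) :
    G.Compat u x (t + shift (G.sg u y) + p - (t + shift (G.sg x y) + r)) := by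
  refine ⟨fun _ => (h.near_iff t p r).2 hpr, fun k _ hd => ?_⟩
  have h1 := sub_ne_of_far hp hr hpr
  have e : p - r = shift k + shift (G.sg u y) + shift (G.sg x y) := by
    linear_combination hd - shift_add_self (G.sg u y)
  rcases shift_eq_or k (G.sg u y) (G.sg x y) with h0 | h0 <;> rw [h0] at e <;> tauto

namespace Extremal

variable {S P : Finset V} {g : V → ZMod 10}

theorem union_subset_left {S' : Finset V} (hS : S' ⊆ S) {v : V} (hv : v ∈ S' ∪ P) :
    v ∈ S ∪ P :=
  Finset.union_subset_union_left hS hv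

theorem mem_pair_of_sg {X : Finset V} {u x y v : V} (hn : G.nbrs X u = {x, y})
    (hv : v ∈ X) (h : G.sg u v ≠ 0) : v = x ∨ v = y := by
  have : v ∈ G.nbrs X u := mem_nbrs.2 ⟨hv, h⟩
  simpa [hn] using this

theorem forb_card_le_of_subset {S' : Finset V} (hS : S' ⊆ S) (f : V → ZMod 10) (u : V) :
    (G.forb (S' ∪ P) f u).card ≤ G.nes (S ∪ P) u :=
  (card_forb_le _ _ _).trans (nes_mono (Finset.union_subset_union_left hS) u)

/-- If `u x y` is a negative triangle and `u` is light, that is, has no further edges and at most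
one forbidden difference, then a colouring in which `x` is at an extreme position relative to `y`
leaves two colours for `u` as far as the triangle is concerned, and hence extends to `u`. -/
theorem extend_light (h : Extremal G S P g) {S' : Finset V} (hS : S' ⊆ S) {u x y : V}
    (hu : u ∈ S) (huS : u ∉ S') (hx : x ∈ S' ∪ P) (hy : y ∈ S' ∪ P)
    (hn : G.nbrs (S ∪ P) u = {x, y}) (h1 : G.nes (S ∪ P) u ≤ 1) (hN : G.Neg u x y)
    {f : V → ZMod 10} (hf : G.Ok S' P f)
    (hr : f x - f y - shift (G.sg x y) = 2 ∨ f x - f y - shift (G.sg x y) = -2) :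
    ∃ c, G.Ok (insert u S') P (Function.update f u c) := by
  obtain ⟨p, hp, hpB⟩ := exists_add_notMem (B := G.forb (S' ∪ P) f u)
    (f y + shift (G.sg u y)) (lt_of_lt_of_le (lt_of_le_of_lt
      ((forb_card_le_of_subset hS f u).trans h1) one_lt_two) (two_le_card_far hr))
  rw [Finset.mem_filter] at hp
  refine ⟨_, hf.insert huS (h.notMem_P hu) (c := f y + shift (G.sg u y) + p)
    (fun v hv => compat_of_notMem_forb hv hpB fun hs => ?_)⟩
  rcases mem_pair_of_sg hn (union_subset_left hS hv) hs with rfl | rfl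
  · have := (hN.near_iff (f y) p (f v - f y - shift (G.sg v y))).2 hp.2.2
    convert this using 2
    ring
  · convert hp.2.1 using 1
    ring

theorem not_extends_of_eq (h : Extremal G S P g) {S' : Finset V} (hS : S' = S)
    {f f' : V → ZMod 10} (hfg : ∀ v ∈ P, f v = g v) (hf : ∀ v ∈ P, f' v = f v)
    (hok : G.Ok S' P f') : False := by
  subst hS
  exact h.not_extends ⟨f', fun v hv => (hf v hv).trans (hfg v hv), hok⟩

theorem update_P (h : Extremal G S P g) {u : V} (hu : u ∈ S) (f : V → ZMod 10) (c : ZMod 10) :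
    ∀ v ∈ P, Function.update f u c v = f v := by
  intro v hv
  rw [Function.update_of_ne]
  rintro rfl
  exact h.notMem_P hu hv

/-- A neighbour of a light vertex in a negative triangle cannot have only two edges and at most two
forbidden differences. -/
theorem three_le_nes_of_neg (h : Extremal G S P g) {u x y : V} (hu : u ∈ S) (hx : x ∈ S)
    (hn : G.nbrs (S ∪ P) u = {x, y}) (h1 : G.nes (S ∪ P) u ≤ 1) (hN : G.Neg u x y)
    (hx2 : (G.nbrs (S ∪ P) x).card = 2) : 3 ≤ G.nes (S ∪ P) x := by
  by_contra hlt
  have hux := ne_of_sg hN.ne_zero12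
  have huy := ne_of_sg hN.ne_zero13
  have hxy := ne_of_sg hN.ne_zero23
  have hyX : y ∈ S ∪ P := (mem_nbrs.1 (by simp [hn] : y ∈ G.nbrs (S ∪ P) u)).1
  have hnx : G.nbrs (S ∪ P) x = {u, y} := by
    symm
    apply Finset.eq_of_subset_of_card_le
    · intro v hv
      simp only [Finset.mem_insert, Finset.mem_singleton] at hv
      rcases hv with rfl | rfl
      · exact mem_nbrs.2 ⟨Finset.mem_union_left _ hu, by rw [G.sg_symm]; exact hN.ne_zero12⟩
      · exact mem_nbrs.2 ⟨hyX, hN.ne_zero23⟩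
    · rw [hx2, Finset.card_pair huy]
  set T : Finset V := {u, x} with hT
  have hTS : T ⊆ S := by
    intro v hv; simp only [hT, Finset.mem_insert, Finset.mem_singleton] at hv
    rcases hv with rfl | rfl <;> assumption
  have hsub : S \ T ⊆ S := Finset.sdiff_subset
  have hss : S \ T ⊂ S := Finset.sdiff_ssubset hTS ⟨u, by simp [hT]⟩
  obtain ⟨f, hfg, hf⟩ := h.sub_extends hss
  obtain ⟨a, ha⟩ := exists_subset_singleton
    ((forb_card_le_of_subset (G := G) (P := P) hsub f u).trans h1)
  obtain ⟨b, b', hb⟩ := exists_subset_pair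
    ((forb_card_le_of_subset (G := G) (P := P) hsub f x).trans (by omega))
  obtain ⟨r, p, hr, hp, hpr, hr1, hr2, hp1⟩ := exists_far_pair
    (b - (f y + shift (G.sg x y))) (b' - (f y + shift (G.sg x y)))
    (a - (f y + shift (G.sg u y)))
  have hdP : Disjoint T P := h.disj.mono_left hTS
  have hTmem : ∀ v ∈ S \ T ∪ P, v ≠ u ∧ v ≠ x := by
    intro v hv
    rcases Finset.mem_union.1 hv with hv | hv
    · simpa [hT] using (Finset.mem_sdiff.1 hv).2
    · exact ⟨fun e => h.notMem_P hu (e ▸ hv), fun e => h.notMem_P hx (e ▸ hv)⟩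
  have hok := hf.extend (T := T) (h := fun v => if v = u then f y + shift (G.sg u y) + p else
    f y + shift (G.sg x y) + r) Finset.disjoint_sdiff hdP (by
      intro v hv w hw
      simp only [hT, Finset.mem_insert, Finset.mem_singleton] at hv
      rcases hv with rfl | rfl
      · rw [if_pos rfl]
        refine compat_of_notMem_forb hw (fun hm => hp1 ?_) fun hs => ?_
        · rw [← Finset.mem_singleton.1 (ha hm)]; ring
        · rcases mem_pair_of_sg hn (union_subset_left hsub hw) hs with rfl | rfl
          · exact absurd rfl (hTmem _ hw).2
          · convert hp using 1; ring
      · rw [if_neg (Ne.symm hux)]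
        refine compat_of_notMem_forb hw (fun hm => ?_) fun hs => ?_
        · have := hb hm
          simp only [Finset.mem_insert, Finset.mem_singleton] at this
          rcases this with e | e
          · apply hr1; rw [← e]; ring
          · apply hr2; rw [← e]; ring
        · rcases mem_pair_of_sg hnx (union_subset_left hsub hw) hs with rfl | rfl
          · exact absurd rfl (hTmem _ hw).1
          · convert hr using 1; ring) (by
      have key := hN.compat (f y) hp hr hpr
      intro v hv w hw
      simp only [hT, Finset.mem_insert, Finset.mem_singleton] at hv hw
      rcases hv with rfl | rfl <;> rcases hw with rfl | rfl
      · exact compat_self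
      · rw [if_pos rfl, if_neg (Ne.symm hux)]; exact key
      · rw [if_pos rfl, if_neg (Ne.symm hux)]
        simpa using key.symm
      · exact compat_self)
  refine h.not_extends_of_eq (Finset.union_sdiff_of_subset hTS) hfg (fun v hv => ?_) hok
  rw [if_neg (Finset.disjoint_right.1 hdP hv)]

/-- A neighbour of a light vertex in a negative triangle cannot be cubic: it could be recoloured to
an extreme position. -/
theorem one_le_nes_of_neg (h : Extremal G S P g) {u x y : V} (hu : u ∈ S) (hx : x ∈ S)
    (hn : G.nbrs (S ∪ P) u = {x, y}) (h1 : G.nes (S ∪ P) u ≤ 1) (hN : G.Neg u x y)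
    (hx3 : (G.nbrs (S ∪ P) x).card = 3) : 1 ≤ G.nes (S ∪ P) x := by
  by_contra hlt
  have h0 : G.nes (S ∪ P) x = 0 := by omega
  have hux := ne_of_sg hN.ne_zero12
  have huy := ne_of_sg hN.ne_zero13
  have hxy := ne_of_sg hN.ne_zero23
  have hyX : y ∈ S ∪ P := (mem_nbrs.1 (by simp [hn] : y ∈ G.nbrs (S ∪ P) u)).1
  obtain ⟨w, hw⟩ : ∃ w, G.nbrs (S ∪ P) x = {u, y, w} := by
    have hsub : ({u, y} : Finset V) ⊆ G.nbrs (S ∪ P) x := by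
      intro v hv
      simp only [Finset.mem_insert, Finset.mem_singleton] at hv
      rcases hv with rfl | rfl
      · exact mem_nbrs.2 ⟨Finset.mem_union_left _ hu, by rw [G.sg_symm]; exact hN.ne_zero12⟩
      · exact mem_nbrs.2 ⟨hyX, hN.ne_zero23⟩
    have hc := Finset.card_sdiff_add_card_eq_card hsub
    rw [hx3, Finset.card_pair huy] at hc
    obtain ⟨w, hw⟩ := Finset.card_eq_one.1 (by omega : (G.nbrs (S ∪ P) x \ {u, y}).card = 1)
    refine ⟨w, ?_⟩
    rw [← Finset.sdiff_union_of_subset hsub, hw]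
    ext v; simp; tauto
  have hwm : w ∈ G.nbrs (S ∪ P) x := by simp [hw]
  rw [mem_nbrs] at hwm
  have hwx := ne_of_sg hwm.2
  by_cases hwu : w = u
  · -- three neighbours are distinct
    subst hwu
    have := hx3
    rw [hw] at this
    have : ({w, y, w} : Finset V).card ≤ 2 := by
      have : ({w, y, w} : Finset V) = {w, y} := by ext v; simp; tauto
      rw [this]; exact Finset.card_le_two
    omega
  obtain ⟨f, hfg, hf⟩ := h.sub_extends (h.erase_ssubset hu)
  have hxS : x ∈ S.erase u := Finset.mem_erase.2 ⟨hux.symm, hx⟩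
  have hy' := mem_erase_union hyX huy.symm
  have hw' := mem_erase_union hwm.1 hwu
  have a1 := hf.near hxS hy' hN.ne_zero23
  have a2 := hf.near hxS hw' hwm.2
  set e := f w + shift (G.sg x w) - (f y + shift (G.sg x y)) with he
  obtain ⟨r, hr, hre⟩ := exists_extreme (r := f x - f y - shift (G.sg x y)) (e := e) a1 (by
    rw [he]; convert a2 using 1; ring)
  have hr0 := near_of_extreme hr
  have hok := (hf.mono (Finset.erase_subset x _)).insert (u := x) (by simp) (h.notMem_P hx)
    (c := f y + shift (G.sg x y) + r) (by
      intro v hv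
      have hvX : v ∈ S ∪ P := union_subset_left
        ((Finset.erase_subset _ _).trans (Finset.erase_subset _ _)) hv
      refine ⟨fun hs => ?_, fun k hk => ?_⟩
      · have : v ∈ G.nbrs (S ∪ P) x := mem_nbrs.2 ⟨hvX, hs⟩
        rw [hw] at this
        simp only [Finset.mem_insert, Finset.mem_singleton] at this
        rcases this with rfl | rfl | rfl
        · exfalso
          rcases Finset.mem_union.1 hv with hv | hv
          · simp at hv
          · exact h.notMem_P hu hv
        · convert hr0 using 1; ring
        · convert hre using 1; rw [he]; ring
      · rw [ne_eq_empty_of_nes hvX h0] at hk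
        simp at hk)
  rw [Finset.insert_erase hxS] at hok
  obtain ⟨c, hc⟩ := h.extend_light (h.erase_ssubset hu).subset hu (by simp)
    (Finset.mem_union_left _ hxS) hy' hn h1 hN hok (by
      rw [Function.update_self, Function.update_of_ne hxy.symm]
      convert hr using 2 <;> ring)
  refine h.not_extends_of_eq (Finset.insert_erase hu) hfg (fun v hv => ?_) hc
  rw [h.update_P hu _ _ v hv, h.update_P hx _ _ v hv]

/-- A vertex with three edges and at most one forbidden difference is not adjacent to two light
vertices in negative triangles over the same edge. -/
theorem not_two_light (h : Extremal G S P g) {u u' x y : V} (hu : u ∈ S) (hu' : u' ∈ S)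
    (huu : u ≠ u') (hx : x ∈ S)
    (hn : G.nbrs (S ∪ P) u = {x, y}) (h1 : G.nes (S ∪ P) u ≤ 1) (hN : G.Neg u x y)
    (hn' : G.nbrs (S ∪ P) u' = {x, y}) (h1' : G.nes (S ∪ P) u' ≤ 1) (hN' : G.Neg u' x y)
    (hx3 : (G.nbrs (S ∪ P) x).card = 3) : 2 ≤ G.nes (S ∪ P) x := by
  by_contra hlt
  have hux := ne_of_sg hN.ne_zero12
  have huy := ne_of_sg hN.ne_zero13
  have hux' := ne_of_sg hN'.ne_zero12
  have huy' := ne_of_sg hN'.ne_zero13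
  have hxy := ne_of_sg hN.ne_zero23
  have hyX : y ∈ S ∪ P := (mem_nbrs.1 (by simp [hn] : y ∈ G.nbrs (S ∪ P) u)).1
  have hnx : G.nbrs (S ∪ P) x = {u, u', y} := by
    symm
    apply Finset.eq_of_subset_of_card_le
    · intro v hv
      simp only [Finset.mem_insert, Finset.mem_singleton] at hv
      rcases hv with rfl | rfl | rfl
      · exact mem_nbrs.2 ⟨Finset.mem_union_left _ hu, by rw [G.sg_symm]; exact hN.ne_zero12⟩
      · exact mem_nbrs.2 ⟨Finset.mem_union_left _ hu', by rw [G.sg_symm]; exact hN'.ne_zero12⟩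
      · exact mem_nbrs.2 ⟨hyX, hN.ne_zero23⟩
    · rw [hx3, Finset.card_eq_three.2 ⟨u, u', y, huu, huy, huy', rfl⟩]
  set S₁ := ((S.erase u).erase u').erase x with hS₁
  have hsub₁ : S₁ ⊆ S := (Finset.erase_subset _ _).trans
    ((Finset.erase_subset _ _).trans (Finset.erase_subset _ _))
  have hss : S₁ ⊂ S := lt_of_le_of_lt ((Finset.erase_subset _ _).trans (Finset.erase_subset _ _))
    (h.erase_ssubset hu)
  obtain ⟨f, hfg, hf⟩ := h.sub_extends hss
  have hy₁ : y ∈ S₁ ∪ P := by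
    rcases Finset.mem_union.1 hyX with hm | hm
    · simp [hS₁, hxy.symm, huy.symm, huy'.symm, hm]
    · exact Finset.mem_union_right _ hm
  obtain ⟨r, hr, hrB⟩ := exists_add_notMem (A := {2, -2}) (B := G.forb (S₁ ∪ P) f x)
    (f y + shift (G.sg x y)) (lt_of_le_of_lt (forb_card_le_of_subset hsub₁ f x) (by
      have : ({2, -2} : Finset (ZMod 10)).card = 2 := by decide
      omega))
  simp only [Finset.mem_insert, Finset.mem_singleton] at hr
  have hnot : u ∉ S₁ ∪ P ∧ u' ∉ S₁ ∪ P := by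
    simp [hS₁, h.notMem_P hu, h.notMem_P hu']
  have hok := hf.insert (u := x) (by simp [hS₁]) (h.notMem_P hx)
    (c := f y + shift (G.sg x y) + r) (by
      intro v hv
      refine compat_of_notMem_forb hv hrB fun hs => ?_
      have : v ∈ G.nbrs (S ∪ P) x := mem_nbrs.2 ⟨union_subset_left hsub₁ hv, hs⟩
      rw [hnx] at this
      simp only [Finset.mem_insert, Finset.mem_singleton] at this
      rcases this with rfl | rfl | rfl
      · exact absurd hv hnot.1
      · exact absurd hv hnot.2
      · convert near_of_extreme hr using 1; ring)
  set S₂ := insert x S₁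
  have hsub₂ : S₂ ⊆ S := Finset.insert_subset hx hsub₁
  have hx₂ : x ∈ S₂ ∪ P := by simp [S₂]
  have hy₂ : y ∈ S₂ ∪ P := Finset.union_subset_union_left (Finset.subset_insert _ _) hy₁
  obtain ⟨c, hc⟩ := h.extend_light hsub₂ hu (by simp [S₂, hS₁, hux]) hx₂ hy₂ hn h1 hN hok (by
    rw [Function.update_self, Function.update_of_ne hxy.symm]
    convert hr using 2 <;> ring)
  have hsub₃ : insert u S₂ ⊆ S := Finset.insert_subset hu hsub₂
  obtain ⟨c', hc'⟩ := h.extend_light hsub₃ hu' (by simp [S₂, hS₁, hux', huu.symm])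
    (Finset.union_subset_union_left (Finset.subset_insert _ _) hx₂)
    (Finset.union_subset_union_left (Finset.subset_insert _ _) hy₂) hn' h1' hN' hc (by
    rw [Function.update_of_ne hux.symm, Function.update_of_ne huy.symm,
      Function.update_self, Function.update_of_ne hxy.symm]
    convert hr using 2 <;> ring)
  refine h.not_extends_of_eq ?_ hfg (fun v hv => ?_) hc'
  · ext v
    simp only [S₂, hS₁, Finset.mem_insert, Finset.mem_erase]
    constructor
    · rintro (rfl | rfl | rfl | hv)
      exacts [hu', hu, hx, hv.2.2.2]
    · tauto
  · rw [h.update_P hu' _ _ v hv, h.update_P hu _ _ v hv, h.update_P hx _ _ v hv]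

end Extremal
/-! ### Negative `K_4` with a subdivided edge at a light vertex -/

/-- In a negative `K_4` minus the edge `x y`, with all coordinates relative to one of the two other
vertices, different coordinates of `x` and `y` may be exchanged, and this changes the colour of a
common neighbour `u` that replaces the missing edge. -/
theorem exists_toggle {t x y : ZMod 10} (ht : near t) (hx : near x) (hy : near y)
    (hxt : near (x - t - 5)) (hyt : near (y - t - 5)) (hxy : x ≠ y) :
    ∃ a b, near (a - x) ∧ near (a - y - 5) ∧ near (b - y) ∧ near (b - x - 5) ∧ a ≠ b ∧
      a - x ≠ 0 ∧ a - x ≠ 5 ∧ b - y ≠ 0 ∧ b - y ≠ 5 := by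
  revert t x y; decide +kernel

theorem ne_unique {X : Finset V} {u v v' : V} {k k' : SignType} (h : G.nes X u ≤ 1)
    (hv : v ∈ X) (hv' : v' ∈ X) (hk : k ∈ G.ne u v) (hk' : k' ∈ G.ne u v') : v = v' ∧ k = k' := by
  have hvv : v = v' := by
    by_contra hne
    have hsub : ({v, v'} : Finset V) ⊆ X := by
      intro w hw; simp only [Finset.mem_insert, Finset.mem_singleton] at hw
      rcases hw with rfl | rfl <;> assumption
    have h1 := nes_mono (G := G) hsub u
    have h2 : G.nes {v, v'} u = (G.ne u v).card + (G.ne u v').card := Finset.sum_pair hne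
    have h3 := Finset.card_pos.2 ⟨k, hk⟩
    have h4 := Finset.card_pos.2 ⟨k', hk'⟩
    omega
  subst hvv
  exact ⟨rfl, Finset.card_le_one.1 ((card_ne_le_nes hv).trans h) _ hk _ hk'⟩

namespace NegK4Via

theorem symm {u x y z t : V} (h : G.NegK4Via u x y z t) : G.NegK4Via u y x z t := by
  refine ⟨h.2.1, h.1, ?_, ?_⟩
  · rw [← h.2.2.1, G.sg_symm y z, G.sg_symm z x]; ac_rfl
  · rw [← h.2.2.2, G.sg_symm y t, G.sg_symm t x]; ac_rfl

/-- In coordinates relative to `z`, the two edges at `u` say that `u` is close to `x` and to the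
opposite of `y`. -/
theorem sub_eq {u x y z t : V} (h : G.NegK4Via u x y z t) (s b c : ZMod 10) :
    s + shift (G.sg x z) + shift (G.sg u x) + b - (s + shift (G.sg y z) + c) -
      shift (G.sg u y) = b - c - 5 := by
  have h5 := shift_triple h.2.2.1
  have hne : G.sg u x * G.sg u y ≠ 0 := by
    intro h0; have := h.2.2.1; rw [h0, mul_zero] at this; exact absurd this (by decide)
  rw [shift_mul hne, G.sg_symm z y] at h5
  linear_combination h5 - shift_add_self (G.sg y z) - shift_add_self (G.sg u y) + ten_eq_zero

end NegK4Via

theorem Neg.sub_eq {x z t : V} (h : G.Neg x z t) (s c τ : ZMod 10) :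
    s + shift (G.sg x z) + c - (s + shift (G.sg t z) + τ) - shift (G.sg x t) = c - τ - 5 := by
  have h5 := shift_triple h
  rw [G.sg_symm z t] at h5
  linear_combination (-1 : ZMod 10) * h5 + shift_add_self (G.sg x z)

namespace Extremal

variable {S P : Finset V} {g : V → ZMod 10}

theorem nbrs_eq_three {X : Finset V} {x a b c : V} (h3 : (G.nbrs X x).card = 3) (ha : a ∈ X)
    (hb : b ∈ X) (hc : c ∈ X) (hab : a ≠ b) (hac : a ≠ c) (hbc : b ≠ c) (sa : G.sg x a ≠ 0)
    (sb : G.sg x b ≠ 0) (sc : G.sg x c ≠ 0) : G.nbrs X x = {a, b, c} := by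
  symm
  apply Finset.eq_of_subset_of_card_le
  · intro v hv
    simp only [Finset.mem_insert, Finset.mem_singleton] at hv
    rcases hv with rfl | rfl | rfl
    · exact mem_nbrs.2 ⟨ha, sa⟩
    · exact mem_nbrs.2 ⟨hb, sb⟩
    · exact mem_nbrs.2 ⟨hc, sc⟩
  · rw [h3, Finset.card_eq_three.2 ⟨a, b, c, hab, hac, hbc, rfl⟩]

/-- If a light vertex `u` stands for an edge `x y` of a negative `K_4`, then `x` and `y` cannot both
have just three edges and at most one forbidden difference altogether: delete `u` and force the
colours of `x` and `y` to be exchangeable; exchanging them toggles the colour left for `u`. -/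
theorem not_light_of_negK4Via (h : Extremal G S P g) {u x y z t : V} (hu : u ∈ S) (hx : x ∈ S)
    (hy : y ∈ S) (hz : z ∈ S) (ht : t ∈ S) (hzu : z ≠ u) (htu : t ≠ u) (hxy : x ≠ y)
    (hn : G.nbrs (S ∪ P) u = {x, y}) (hu1 : G.nes (S ∪ P) u = 1) (hK : G.NegK4Via u x y z t)
    (hx3 : (G.nbrs (S ∪ P) x).card = 3) (hy3 : (G.nbrs (S ∪ P) y).card = 3)
    (hxn : G.nes (S ∪ P) x ≤ 1) (hyn : G.nes (S ∪ P) y = 0) : False := by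
  have hSX : ∀ {v}, v ∈ S → v ∈ S ∪ P := fun hv => Finset.mem_union_left _ hv
  have sux : G.sg u x ≠ 0 := (mem_nbrs.1 (by simp [hn] : x ∈ G.nbrs (S ∪ P) u)).2
  have suy : G.sg u y ≠ 0 := (mem_nbrs.1 (by simp [hn] : y ∈ G.nbrs (S ∪ P) u)).2
  have sxu : G.sg x u ≠ 0 := by rwa [G.sg_symm]
  have syu : G.sg y u ≠ 0 := by rwa [G.sg_symm]
  have hux := ne_of_sg sux
  have huy := ne_of_sg suy
  have hxz := ne_of_sg hK.1.ne_zero12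
  have hxt := ne_of_sg hK.1.ne_zero13
  have hyz := ne_of_sg hK.2.1.ne_zero12
  have hyt := ne_of_sg hK.2.1.ne_zero13
  have hzt := ne_of_sg hK.1.ne_zero23
  have hnx := nbrs_eq_three hx3 (hSX hu) (hSX hz) (hSX ht) hzu.symm htu.symm hzt sxu
    hK.1.ne_zero12 hK.1.ne_zero13
  have hny := nbrs_eq_three hy3 (hSX hu) (hSX hz) (hSX ht) hzu.symm htu.symm hzt syu
    hK.2.1.ne_zero12 hK.2.1.ne_zero13
  have hxE : x ∈ S.erase u := Finset.mem_erase.2 ⟨hux.symm, hx⟩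
  have hyE : y ∈ S.erase u := Finset.mem_erase.2 ⟨huy.symm, hy⟩
  have hzE : z ∈ S.erase u := Finset.mem_erase.2 ⟨hzu, hz⟩
  have htE : t ∈ S.erase u := Finset.mem_erase.2 ⟨htu, ht⟩
  have hsE : S.erase u ⊂ S := h.erase_ssubset hu
  have hney : ∀ v ∈ S ∪ P, G.ne y v = ∅ := fun v hv => ne_eq_empty_of_nes hv hyn
  obtain ⟨k₀, hk₀⟩ := exists_shift_eq_five (G.sg u x) (G.sg u y)
  have hD : 5 ≤ G.wts {u} (S ∪ P) := by
    rw [wts_eq_card, hn, Finset.card_pair hxy, hu1]; norm_num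
  have hpot1 : ∀ F ⊆ S.erase u, F.Nonempty →
      2 ≤ (G.addNe x y hxy k₀).pot P F := by
    intro F hF hFn
    have hFS := hF.trans_ssubset hsE
    have hp := pot_addNe (G := G) hxy k₀ (h.disj.mono_left hFS.subset)
    by_cases hm : x ∉ F ∪ P ∨ y ∉ F ∪ P
    · linarith [hp.2 hm, h.two_le_pot hFS hFn]
    · push Not at hm
      linarith [hp.1, h.four_le_pot hu hxy sux suy hD hF hm.1 hm.2]
  -- a colouring of `S - u` in which the colours of `x` and `y` differ and may be exchanged
  obtain ⟨f, hfg, hf, hfxy, hsw⟩ : ∃ f, (∀ v ∈ P, f v = g v) ∧ G.Ok (S.erase u) P f ∧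
      f x - f y ≠ shift k₀ ∧ ∀ r ∈ S.erase u ∪ P, ∀ k ∈ G.ne x r,
        f y - f r ≠ shift k + shift (G.sg x z) + shift (G.sg y z) := by
    by_cases hex : ∃ r ∈ S.erase u ∪ P, ∃ k, k ∈ G.ne x r
    · obtain ⟨r, hr, k, hk⟩ := hex
      have hyr : y ≠ r := by
        rintro rfl
        rw [G.ne_symm, hney x (hSX hx)] at hk
        simp at hk
      obtain ⟨k', hk'⟩ := exists_shift_eq k (G.sg x z) (G.sg y z)
      obtain ⟨f, hfg, hf⟩ := h.extends_of_ssubset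
        (G' := (G.addNe x y hxy k₀).addNe y r hyr k') hsE (fun F hF hFn => by
          have hp := (pot_addNe (G := G.addNe x y hxy k₀) hyr k'
            (h.disj.mono_left (hF.trans hsE.subset))).1
          linarith [hpot1 F hF hFn]) (h.k4.mono hsE.subset).addNe.addNe
      refine ⟨f, hfg, hf.of_addNe.of_addNe, hf.of_addNe.ne_of_addNe hxE
        (Finset.mem_union_left _ hyE), fun r' hr' k₁ hk₁ => ?_⟩
      obtain ⟨rfl, rfl⟩ := ne_unique hxn (erase_union_subset hr') (erase_union_subset hr) hk₁ hk
      rw [← hk']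
      exact hf.ne_of_addNe hyE hr
    · obtain ⟨f, hfg, hf⟩ := h.extends_of_ssubset
        (G' := G.addNe x y hxy k₀) hsE (fun F hF hFn => by
          linarith [hpot1 F hF hFn]) (h.k4.mono hsE.subset).addNe
      exact ⟨f, hfg, hf.of_addNe, hf.ne_of_addNe hxE (Finset.mem_union_left _ hyE),
        fun r hr k hk => (hex ⟨r, hr, k, hk⟩).elim⟩
  -- coordinates relative to `z`
  obtain ⟨cx, hcx⟩ : ∃ c, f x = f z + shift (G.sg x z) + c :=
    ⟨f x - f z - shift (G.sg x z), by ring⟩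
  obtain ⟨cy, hcy⟩ : ∃ c, f y = f z + shift (G.sg y z) + c :=
    ⟨f y - f z - shift (G.sg y z), by ring⟩
  obtain ⟨ct, hct⟩ : ∃ c, f t = f z + shift (G.sg t z) + c :=
    ⟨f t - f z - shift (G.sg t z), by ring⟩
  have nx : near cx := by
    have := hf.near hxE (Finset.mem_union_left P hzE) hK.1.ne_zero12
    rw [hcx] at this; convert this using 1; ring
  have ny : near cy := by
    have := hf.near hyE (Finset.mem_union_left P hzE) hK.2.1.ne_zero12
    rw [hcy] at this; convert this using 1; ring
  have nt : near ct := by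
    have := hf.near htE (Finset.mem_union_left P hzE) hK.1.swap12.swap23.swap12.ne_zero12
    rw [hct] at this; convert this using 1; ring
  have nxt : near (cx - ct - 5) := by
    have := hf.near hxE (Finset.mem_union_left P htE) hK.1.ne_zero13
    rwa [hcx, hct, hK.1.sub_eq] at this
  have nyt : near (cy - ct - 5) := by
    have := hf.near hyE (Finset.mem_union_left P htE) hK.2.1.ne_zero13
    rwa [hcy, hct, hK.2.1.sub_eq] at this
  have cxy : cx ≠ cy := by
    intro he
    apply hfxy
    have e := hK.sub_eq (f z) cx cx
    rw [hk₀, hcx, hcy, he]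
    rw [he] at e
    linear_combination e - ten_eq_zero - shift_add_self (G.sg u x)
  obtain ⟨a, b, ax, ay, bY, bx, hab, a0, a5, b0, b5⟩ := exists_toggle nt nx ny nxt nyt cxy
  -- the colour of `u` before the exchange is forbidden by some `v ≠ x, y`
  have hT : ∀ {v : V}, v ∈ G.nbrs (S ∪ P) u → v = x ∨ v = y := by
    intro v hv; simpa [hn] using hv
  have auto : ∀ (d : ZMod 10) (k : SignType), d ≠ 0 → d ≠ 5 → d + shift (G.sg u x) ≠ shift k := by
    intro d k h0 h5 he
    have : d = shift k + shift (G.sg u x) + shift 0 := by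
      rw [show shift 0 = 0 from rfl]
      linear_combination he - shift_add_self (G.sg u x)
    rcases shift_eq_or k (G.sg u x) 0 with e | e <;> rw [e] at this <;> tauto
  have step1 := h.no_color_two hu hn hfg hf (f z + shift (G.sg x z) + shift (G.sg u x) + a)
    (by rw [hcx]; convert ax using 1; ring)
    (by rw [← sub_sub, hcy, hK.sub_eq]; exact ay)
  rw [forb, Finset.mem_biUnion] at step1
  obtain ⟨v, hv, hvk⟩ := step1
  obtain ⟨k, hk, hvk⟩ := Finset.mem_image.1 hvk
  have hvy : v ≠ y := by
    rintro rfl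
    rw [G.ne_symm, hney u (hSX hu)] at hk; simp at hk
  have hvx : v ≠ x := by
    rintro rfl
    refine auto (a - cx) k a0 a5 ?_
    rw [hcx] at hvk
    linear_combination -hvk
  -- exchange the colours
  set T : Finset V := {x, y} with hTdef
  have hTE : T ⊆ S.erase u := by
    intro w hw; simp only [hTdef, Finset.mem_insert, Finset.mem_singleton] at hw
    rcases hw with rfl | rfl <;> assumption
  have hsub : S.erase u \ T ⊆ S.erase u := Finset.sdiff_subset
  have hdP : Disjoint T P := h.disj.mono_left (hTE.trans (Finset.erase_subset _ _))
  have hwT : ∀ w ∈ S.erase u \ T ∪ P, w ∈ S.erase u ∪ P ∧ w ≠ x ∧ w ≠ y ∧ w ≠ u := by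
    intro w hw
    refine ⟨Finset.union_subset_union_left hsub hw, ?_, ?_, ?_⟩ <;> rintro rfl
    · simp [hTdef, h.notMem_P hx] at hw
    · simp [hTdef, h.notMem_P hy] at hw
    · simp [h.notMem_P hu] at hw
  have hok := (hf.mono hsub).extend (T := T) (h := fun v => if v = x then
    f z + shift (G.sg x z) + cy else f z + shift (G.sg y z) + cx) Finset.disjoint_sdiff hdP (by
      intro w hw v hv
      obtain ⟨hvE, hvx, hvy, hvu⟩ := hwT v hv
      have hvX := erase_union_subset hvE
      simp only [hTdef, Finset.mem_insert, Finset.mem_singleton] at hw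
      rcases hw with rfl | rfl
      · rw [if_pos rfl]
        refine ⟨fun hs => ?_, fun k hk hd => hsw v hvE k hk ?_⟩
        · have : v ∈ G.nbrs (S ∪ P) w := mem_nbrs.2 ⟨hvX, hs⟩
          rw [hnx] at this
          simp only [Finset.mem_insert, Finset.mem_singleton] at this
          rcases this with e | e | e
          · exact absurd e hvu
          · rw [e]; convert ny using 1; ring
          · rw [e, hct, hK.1.sub_eq]; exact nyt
        · rw [hcy, ← hd]
          linear_combination shift_add_self (G.sg y z) - shift_add_self (G.sg w z) -
            shift_add_self (G.sg y z)
      · rw [if_neg hxy.symm]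
        refine ⟨fun hs => ?_, fun k hk => ?_⟩
        · have : v ∈ G.nbrs (S ∪ P) w := mem_nbrs.2 ⟨hvX, hs⟩
          rw [hny] at this
          simp only [Finset.mem_insert, Finset.mem_singleton] at this
          rcases this with e | e | e
          · exact absurd e hvu
          · rw [e]; convert nx using 1; ring
          · rw [e, hct, hK.2.1.sub_eq]; exact nxt
        · rw [hney v hvX] at hk; simp at hk) (by
      have sxy : G.sg x y = 0 := by
        by_contra hs
        have : y ∈ G.nbrs (S ∪ P) x := mem_nbrs.2 ⟨hSX hy, hs⟩
        rw [hnx] at this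
        simp only [Finset.mem_insert, Finset.mem_singleton] at this
        rcases this with e | e | e
        exacts [huy e.symm, hyz e, hyt e]
      have nyx := hney x (hSX hx)
      intro w hw v hv
      simp only [hTdef, Finset.mem_insert, Finset.mem_singleton] at hw hv
      rcases hw with rfl | rfl <;> rcases hv with rfl | rfl
      · exact compat_self
      · exact compat_of_not sxy (by rw [G.ne_symm]; exact nyx)
      · exact compat_of_not (by rw [G.sg_symm]; exact sxy) nyx
      · exact compat_self)
  rw [Finset.union_sdiff_of_subset hTE] at hok
  have hxT : x ∈ T := by simp [hTdef]
  have hyT : y ∈ T := by simp [hTdef]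
  have step2 := h.no_color_two hu hn (fun v hv => by
      rw [if_neg (Finset.disjoint_right.1 hdP hv)]; exact hfg v hv) hok
    (f z + shift (G.sg x z) + shift (G.sg u x) + b)
    (by rw [if_pos hxT, if_pos rfl]; convert bY using 1; ring)
    (by rw [if_pos hyT, if_neg hxy.symm, ← sub_sub, hK.sub_eq]; exact bx)
  rw [forb, Finset.mem_biUnion] at step2
  obtain ⟨v', hv', hvk'⟩ := step2
  obtain ⟨k', hk', hvk'⟩ := Finset.mem_image.1 hvk'
  obtain ⟨rfl, rfl⟩ := ne_unique hu1.le (erase_union_subset hv) (erase_union_subset hv') hk hk'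
  have hvT : v ∉ T := by simp [hTdef, hvx, hvy]
  rw [if_neg hvT, hvk] at hvk'
  exact hab (add_left_cancel hvk')

end Extremal
/-! ### Discharging -/

/-- The charge of a vertex: the weight of the constraints at it minus `6`. The charges in `S` add up
to minus the potential of `S`, minus the weight between `S` and the precoloured vertices. -/
def charge (G : CGraph V) (X : Finset V) (u : V) : ℤ := 2 * (G.nbrs X u).card + G.nes X u - 6

/-- The vertices of `S` with negative charge in a minimal counterexample: those with two edges and
one forbidden difference. -/
def light (G : CGraph V) (S X : Finset V) : Finset V :=
  S.filter fun u => (G.nbrs X u).card = 2 ∧ G.nes X u = 1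

/-- Half of `gift u x` is sent by `x` to the light vertex `u`: a neighbour of positive charge sends
`1` if the other neighbour of `u` has no charge to send, and `1 / 2` otherwise. -/
def gift (G : CGraph V) (X : Finset V) (u x : V) : ℤ :=
  if x ∈ G.nbrs X u ∧ 1 ≤ G.charge X x then
    (if ∃ y ∈ G.nbrs X u, G.charge X y ≤ 0 then 2 else 1) else 0

namespace Extremal

variable {S P : Finset V} {g : V → ZMod 10}

theorem mem_nbrs_comm {X : Finset V} {u v : V} (hu : u ∈ X) (h : v ∈ G.nbrs X u) :
    u ∈ G.nbrs X v :=
  mem_nbrs.2 ⟨hu, by rw [G.sg_symm]; exact (mem_nbrs.1 h).2⟩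

theorem sum_charge (h : Extremal G S P g) :
    ∑ u ∈ S, G.charge (S ∪ P) u = -G.pot P S - G.wts S P := by
  have e : ∀ u, G.charge (S ∪ P) u = ∑ v ∈ S ∪ P, G.wt u v - 6 := by
    intro u
    rw [charge, ← wts_singleton, wts_eq_card]
  simp only [e, Finset.sum_sub_distrib, Finset.sum_const]
  have : ∑ u ∈ S, ∑ v ∈ S ∪ P, G.wt u v = G.wts S (S ∪ P) := rfl
  rw [this, wts_union_right h.disj, pot]
  simp; ring

theorem mem_light {u : V} : u ∈ G.light S (S ∪ P) ↔
    u ∈ S ∧ (G.nbrs (S ∪ P) u).card = 2 ∧ G.nes (S ∪ P) u = 1 := by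
  simp [light]

theorem charge_of_light {u : V} (hu : u ∈ G.light S (S ∪ P)) : G.charge (S ∪ P) u = -1 := by
  rw [mem_light] at hu
  rw [charge, hu.2.1, hu.2.2]; norm_num

theorem charge_cases (h : Extremal G S P g) {u : V} (hu : u ∈ S) (hul : u ∉ G.light S (S ∪ P)) :
    0 ≤ G.charge (S ∪ P) u ∧ (G.charge (S ∪ P) u = 0 →
      ((G.nbrs (S ∪ P) u).card = 2 ∧ G.nes (S ∪ P) u = 2) ∨
      ((G.nbrs (S ∪ P) u).card = 3 ∧ G.nes (S ∪ P) u = 0)) := by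
  have a0 := h.ten_le_nes hu
  have a1 := h.five_le_nes hu
  have a2 := h.one_le_nes hu
  have a3 : ¬ ((G.nbrs (S ∪ P) u).card = 2 ∧ G.nes (S ∪ P) u = 1) := fun hc =>
    hul (mem_light.2 ⟨hu, hc⟩)
  unfold charge
  omega

theorem three_le_card_of_negK4Via {u x y z t : V} (hu : u ∈ S) (hz : z ∈ S)
    (ht : t ∈ S) (hzu : z ≠ u) (htu : t ≠ u) (hK : G.NegK4Via u x y z t) (sux : G.sg u x ≠ 0) :
    3 ≤ (G.nbrs (S ∪ P) x).card := by
  have hSX : ∀ {v}, v ∈ S → v ∈ S ∪ P := fun hv => Finset.mem_union_left _ hv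
  have hsub : ({u, z, t} : Finset V) ⊆ G.nbrs (S ∪ P) x := by
    intro v hv
    simp only [Finset.mem_insert, Finset.mem_singleton] at hv
    rcases hv with rfl | rfl | rfl
    · exact mem_nbrs.2 ⟨hSX hu, by rwa [G.sg_symm]⟩
    · exact mem_nbrs.2 ⟨hSX hz, hK.1.ne_zero12⟩
    · exact mem_nbrs.2 ⟨hSX ht, hK.1.ne_zero13⟩
  have := Finset.card_le_card hsub
  rwa [Finset.card_eq_three.2 ⟨u, z, t, hzu.symm, htu.symm, ne_of_sg hK.1.ne_zero23, rfl⟩] at this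

theorem one_le_charge_of_neg (h : Extremal G S P g) {u x y : V} (hu : u ∈ S) (hx : x ∈ S)
    (hn : G.nbrs (S ∪ P) u = {x, y}) (h1 : G.nes (S ∪ P) u ≤ 1) (hN : G.Neg u x y) :
    1 ≤ G.charge (S ∪ P) x := by
  have hyX : y ∈ S ∪ P := (mem_nbrs.1 (by simp [hn] : y ∈ G.nbrs (S ∪ P) u)).1
  have hsub : ({u, y} : Finset V) ⊆ G.nbrs (S ∪ P) x := by
    intro v hv
    simp only [Finset.mem_insert, Finset.mem_singleton] at hv
    rcases hv with rfl | rfl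
    · exact mem_nbrs.2 ⟨Finset.mem_union_left _ hu, by rw [G.sg_symm]; exact hN.ne_zero12⟩
    · exact mem_nbrs.2 ⟨hyX, hN.ne_zero23⟩
  have hc := Finset.card_le_card hsub
  rw [Finset.card_pair (ne_of_sg hN.ne_zero13)] at hc
  have a2 := h.three_le_nes_of_neg hu hx hn h1 hN
  have a3 := h.one_le_nes_of_neg hu hx hn h1 hN
  unfold charge
  omega

/-- The two ways in which a light vertex `u` can be blocked, seen from its neighbour `x`. In both
cases its neighbours can send it charge `1`. -/
theorem light_cases (h : Extremal G S P g) {u x : V} (hu : u ∈ G.light S (S ∪ P))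
    (hx : x ∈ G.nbrs (S ∪ P) u) :
    ∃ y, x ≠ y ∧ G.nbrs (S ∪ P) u = {x, y} ∧ x ∈ S ∧ y ∈ S ∧
      2 ≤ G.charge (S ∪ P) x + G.charge (S ∪ P) y ∧
      ((G.Neg u x y ∧ 1 ≤ G.charge (S ∪ P) x ∧ 1 ≤ G.charge (S ∪ P) y) ∨
        (3 ≤ (G.nbrs (S ∪ P) x).card ∧ 3 ≤ (G.nbrs (S ∪ P) y).card ∧
          ∃ z ∈ S, ∃ t ∈ S, 3 ≤ (G.nbrs (S ∪ P) z).card ∧ 3 ≤ (G.nbrs (S ∪ P) t).card ∧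
            G.NegK4Via u x y z t)) := by
  have hul := hu
  rw [mem_light] at hu
  obtain ⟨huS, hu2, hu1⟩ := hu
  obtain ⟨y, hxy, hn⟩ : ∃ y, x ≠ y ∧ G.nbrs (S ∪ P) u = {x, y} := by
    obtain ⟨a, b, hab, hn⟩ := Finset.card_eq_two.1 hu2
    rw [hn] at hx
    simp only [Finset.mem_insert, Finset.mem_singleton] at hx
    rcases hx with rfl | rfl
    · exact ⟨b, hab, hn⟩
    · exact ⟨a, hab.symm, hn.trans (Finset.pair_comm _ _)⟩
  have hn' : G.nbrs (S ∪ P) u = {y, x} := hn.trans (Finset.pair_comm _ _)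
  have sux : G.sg u x ≠ 0 := (mem_nbrs.1 hx).2
  have suy : G.sg u y ≠ 0 := (mem_nbrs.1 (by simp [hn] : y ∈ G.nbrs (S ∪ P) u)).2
  obtain ⟨hxS, hyS, hc⟩ := h.blocked huS hxy hn hu1.ge (by omega)
  refine ⟨y, hxy, hn, hxS, hyS, ?_⟩
  rcases hc with hN | ⟨z, hz, t, ht, hzu, htu, hK⟩
  · have c1 := h.one_le_charge_of_neg huS hxS hn hu1.le hN
    have c2 := h.one_le_charge_of_neg huS hyS hn' hu1.le hN.swap23
    exact ⟨by linarith, Or.inl ⟨hN, c1, c2⟩⟩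
  · have c1 := three_le_card_of_negK4Via (P := P) huS hz ht hzu htu hK sux
    have c2 := three_le_card_of_negK4Via (P := P) huS hz ht hzu htu hK.symm suy
    have hSX : ∀ {v}, v ∈ S → v ∈ S ∪ P := fun hv => Finset.mem_union_left _ hv
    have c3 : ∀ {z t : V}, G.NegK4Via u x y z t → t ∈ S → 3 ≤ (G.nbrs (S ∪ P) z).card := by
      intro z t hK ht
      have hsub : ({x, y, t} : Finset V) ⊆ G.nbrs (S ∪ P) z := by
        intro v hv
        simp only [Finset.mem_insert, Finset.mem_singleton] at hv
        rcases hv with rfl | rfl | rfl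
        · exact mem_nbrs.2 ⟨hSX hxS, hK.1.swap12.ne_zero12⟩
        · exact mem_nbrs.2 ⟨hSX hyS, hK.2.1.swap12.ne_zero12⟩
        · exact mem_nbrs.2 ⟨hSX ht, hK.1.ne_zero23⟩
      have := Finset.card_le_card hsub
      rwa [Finset.card_eq_three.2 ⟨x, y, t, hxy, ne_of_sg hK.1.ne_zero13,
        ne_of_sg hK.2.1.ne_zero13, rfl⟩] at this
    refine ⟨?_, Or.inr ⟨c1, c2, z, hz, t, ht, c3 hK ht,
      c3 ⟨hK.1.swap23, hK.2.1.swap23, hK.2.2.2, hK.2.2.1⟩ hz, hK⟩⟩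
    by_contra hlt
    unfold charge at hlt
    by_cases h0 : G.nes (S ∪ P) y = 0
    · exact h.not_light_of_negK4Via huS hxS hyS hz ht hzu htu hxy hn hu1 hK (by omega) (by omega)
        (by omega) h0
    · exact h.not_light_of_negK4Via huS hyS hxS hz ht hzu htu hxy.symm hn' hu1 hK.symm (by omega)
        (by omega) (by omega) (by omega)

theorem notMem_light_of_card {x : V} (hx : 3 ≤ (G.nbrs (S ∪ P) x).card) :
    x ∉ G.light S (S ∪ P) := by
  rw [mem_light]; omega

theorem notMem_light_of_charge {x : V} (hx : 0 ≤ G.charge (S ∪ P) x) :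
    x ∉ G.light S (S ∪ P) := by
  intro hl
  rw [charge_of_light hl] at hx
  norm_num at hx

theorem two_le_sum_gift (h : Extremal G S P g) {u : V} (hu : u ∈ G.light S (S ∪ P)) :
    2 ≤ ∑ x ∈ S, G.gift (S ∪ P) u x := by
  have hu2 := (mem_light.1 hu).2.1
  obtain ⟨x, hx⟩ : (G.nbrs (S ∪ P) u).Nonempty := Finset.card_pos.1 (by omega)
  obtain ⟨y, hxy, hn, hxS, hyS, hq, -⟩ := h.light_cases hu hx
  have hsub : ({x, y} : Finset V) ⊆ S := by
    intro v hv; simp only [Finset.mem_insert, Finset.mem_singleton] at hv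
    rcases hv with rfl | rfl <;> assumption
  have hnn : ∀ v ∈ S, v ∉ ({x, y} : Finset V) → 0 ≤ G.gift (S ∪ P) u v := by
    intro v _ _
    unfold gift; split_ifs <;> norm_num
  refine le_trans ?_ (Finset.sum_le_sum_of_subset_of_nonneg hsub hnn)
  rw [Finset.sum_pair hxy]
  have hex : (∃ w ∈ G.nbrs (S ∪ P) u, G.charge (S ∪ P) w ≤ 0) ↔
      G.charge (S ∪ P) x ≤ 0 ∨ G.charge (S ∪ P) y ≤ 0 := by
    rw [hn]; simp
  have hxm : x ∈ G.nbrs (S ∪ P) u := hx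
  have hym : y ∈ G.nbrs (S ∪ P) u := by simp [hn]
  simp only [gift, hex, hxm, hym, true_and]
  split_ifs <;> omega

/-- The light neighbours of `x`. -/
def lightNbrs (G : CGraph V) (S X : Finset V) (x : V) : Finset V :=
  (G.nbrs X x).filter (· ∈ G.light S X)

theorem card_lightNbrs_add_le {T : Finset V} {x : V} (hT : T ⊆ G.nbrs (S ∪ P) x)
    (hTl : ∀ v ∈ T, v ∉ G.light S (S ∪ P)) :
    (lightNbrs G S (S ∪ P) x).card + T.card ≤ (G.nbrs (S ∪ P) x).card := by
  rw [← Finset.card_union_of_disjoint]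
  · exact Finset.card_le_card (Finset.union_subset (Finset.filter_subset _ _) hT)
  · rw [Finset.disjoint_left]
    intro v hv hvT
    exact hTl v hvT (Finset.mem_filter.1 hv).2

theorem gift_le_two (u x : V) : G.gift (S ∪ P) u x ≤ 2 := by
  unfold gift; split_ifs <;> norm_num

theorem gift_eq_zero_of_notMem {u x : V} (hu : u ∈ S) (h : u ∉ G.nbrs (S ∪ P) x) :
    G.gift (S ∪ P) u x = 0 := by
  unfold gift
  rw [if_neg]
  rintro ⟨hx, -⟩
  exact h (mem_nbrs_comm (Finset.mem_union_left _ hu) hx)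

theorem sum_gift_eq (x : V) : ∑ u ∈ G.light S (S ∪ P), G.gift (S ∪ P) u x =
    ∑ u ∈ lightNbrs G S (S ∪ P) x, G.gift (S ∪ P) u x := by
  symm
  apply Finset.sum_subset
  · intro u hu; exact (Finset.mem_filter.1 hu).2
  · intro u hu hun
    refine gift_eq_zero_of_notMem (mem_light.1 hu).1 fun hm => hun ?_
    exact Finset.mem_filter.2 ⟨hm, hu⟩

theorem sum_gift_le (x : V) :
    ∑ u ∈ G.light S (S ∪ P), G.gift (S ∪ P) u x ≤ 2 * (lightNbrs G S (S ∪ P) x).card := by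
  rw [sum_gift_eq]
  refine (Finset.sum_le_card_nsmul _ _ 2 fun u _ => gift_le_two u x).trans ?_
  simp [mul_comm]

/-- A vertex that is not light sends at most its charge. If it sends all of a positive charge, then
either it has three edges, two of them to light vertices, and charge `1`, or it has four edges,
two of them to light vertices to each of which it sends `1`. -/
theorem gift_bound (h : Extremal G S P g) {x : V} (hx : x ∈ S) (hxl : x ∉ G.light S (S ∪ P)) :
    ∑ u ∈ G.light S (S ∪ P), G.gift (S ∪ P) u x ≤ 2 * G.charge (S ∪ P) x ∧
    (1 ≤ G.charge (S ∪ P) x →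
      ∑ u ∈ G.light S (S ∪ P), G.gift (S ∪ P) u x = 2 * G.charge (S ∪ P) x →
      ((G.nbrs (S ∪ P) x).card = 3 ∧ (lightNbrs G S (S ∪ P) x).card = 2 ∧
        G.nes (S ∪ P) x = 1) ∨
      ((G.nbrs (S ∪ P) x).card = 4 ∧ (lightNbrs G S (S ∪ P) x).card = 2 ∧
        ∀ u ∈ lightNbrs G S (S ∪ P) x, ∃ y ∈ G.nbrs (S ∪ P) u, G.charge (S ∪ P) y ≤ 0)) := by
  have hq0 := (h.charge_cases hx hxl).1
  by_cases hq : 1 ≤ G.charge (S ∪ P) x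
  swap
  · have : ∑ u ∈ G.light S (S ∪ P), G.gift (S ∪ P) u x = 0 :=
      Finset.sum_eq_zero fun u _ => by
        unfold gift; rw [if_neg]; exact fun hc => hq hc.2
    exact ⟨by linarith, fun h' => (hq h').elim⟩
  have hcq : G.charge (S ∪ P) x = 2 * (G.nbrs (S ∪ P) x).card + G.nes (S ∪ P) x - 6 := rfl
  by_cases hex : ∃ u ∈ lightNbrs G S (S ∪ P) x, ∃ y ∈ G.nbrs (S ∪ P) u, G.charge (S ∪ P) y ≤ 0
  · obtain ⟨u, hu, y, hy, hqy⟩ := hex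
    rw [lightNbrs, Finset.mem_filter] at hu
    have hxu := mem_nbrs_comm (Finset.mem_union_left _ hx) hu.1
    obtain ⟨y', hxy, hn, -, -, hq2, hc⟩ := h.light_cases hu.2 hxu
    have hyy : y = y' := by
      rw [hn] at hy
      simp only [Finset.mem_insert, Finset.mem_singleton] at hy
      rcases hy with rfl | rfl
      · omega
      · rfl
    subst hyy
    rcases hc with ⟨-, -, hc⟩ | ⟨-, -, z, hz, t, ht, hz3, ht3, hK⟩
    · omega
    have hcard := card_lightNbrs_add_le (G := G) (S := S) (P := P) (T := {z, t}) (x := x) (by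
        intro v hv
        simp only [Finset.mem_insert, Finset.mem_singleton] at hv
        rcases hv with rfl | rfl
        · exact mem_nbrs.2 ⟨Finset.mem_union_left _ hz, hK.1.ne_zero12⟩
        · exact mem_nbrs.2 ⟨Finset.mem_union_left _ ht, hK.1.ne_zero13⟩) (by
        intro v hv
        simp only [Finset.mem_insert, Finset.mem_singleton] at hv
        rcases hv with rfl | rfl <;> exact notMem_light_of_card (by assumption))
    rw [Finset.card_pair (ne_of_sg hK.1.ne_zero23)] at hcard
    have hsum := sum_gift_le (G := G) (S := S) (P := P) x
    have hpos : 1 ≤ (lightNbrs G S (S ∪ P) x).card :=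
      Finset.card_pos.2 ⟨u, Finset.mem_filter.2 hu⟩
    refine ⟨by omega, fun _ heq => Or.inr ?_⟩
    have h4 : (G.nbrs (S ∪ P) x).card = 4 := by omega
    have h2 : (lightNbrs G S (S ∪ P) x).card = 2 := by omega
    refine ⟨h4, h2, fun v hv => ?_⟩
    by_contra hno
    have hlt : ∑ u ∈ lightNbrs G S (S ∪ P) x, G.gift (S ∪ P) u x <
        ∑ _u ∈ lightNbrs G S (S ∪ P) x, (2 : ℤ) :=
      Finset.sum_lt_sum (fun u _ => gift_le_two u x) ⟨v, hv, by
        unfold gift; rw [if_neg hno]; split_ifs <;> norm_num⟩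
    rw [← sum_gift_eq, Finset.sum_const, h2] at hlt
    norm_num at hlt
    omega
  · have hsum : ∑ u ∈ G.light S (S ∪ P), G.gift (S ∪ P) u x ≤
        (lightNbrs G S (S ∪ P) x).card := by
      rw [sum_gift_eq]
      refine (Finset.sum_le_card_nsmul _ _ 1 fun u hu => ?_).trans (by simp)
      unfold gift
      rw [if_neg (fun hc => hex ⟨u, hu, hc⟩)]
      split_ifs <;> norm_num
    have hcard : (lightNbrs G S (S ∪ P) x).card = 0 ∨
        (lightNbrs G S (S ∪ P) x).card + 1 ≤ (G.nbrs (S ∪ P) x).card := by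
      by_cases h0 : (lightNbrs G S (S ∪ P) x).card = 0
      · exact Or.inl h0
      right
      obtain ⟨u, hu⟩ := Finset.card_pos.1 (Nat.pos_of_ne_zero h0)
      rw [lightNbrs, Finset.mem_filter] at hu
      have hxu := mem_nbrs_comm (Finset.mem_union_left _ hx) hu.1
      obtain ⟨y, hxy, hn, hxS, hyS, hq2, hc⟩ := h.light_cases hu.2 hxu
      obtain ⟨w, hw, hwl⟩ : ∃ w ∈ G.nbrs (S ∪ P) x, w ∉ G.light S (S ∪ P) := by
        rcases hc with ⟨hN, -, hc⟩ | ⟨-, -, z, hz, t, ht, hz3, ht3, hK⟩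
        · exact ⟨y, mem_nbrs.2 ⟨Finset.mem_union_left _ hyS, hN.ne_zero23⟩,
            notMem_light_of_charge (by linarith)⟩
        · exact ⟨z, mem_nbrs.2 ⟨Finset.mem_union_left _ hz, hK.1.ne_zero12⟩,
            notMem_light_of_card hz3⟩
      have := card_lightNbrs_add_le (G := G) (S := S) (P := P) (T := {w}) (x := x)
        (by simpa using hw) (by simpa using hwl)
      simpa using this
    have hn2 : (G.nbrs (S ∪ P) x).card = 0 ∨ (G.nbrs (S ∪ P) x).card = 1 ∨
      2 ≤ (G.nbrs (S ∪ P) x).card := by omega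
    refine ⟨?_, fun _ heq => Or.inl ?_⟩
    · omega
    · omega

/-- Some vertex keeps a part of its positive charge if there is a light vertex. -/
theorem exists_gift_lt (h : Extremal G S P g) {u : V} (hu : u ∈ G.light S (S ∪ P)) :
    ∃ x ∈ S, x ∉ G.light S (S ∪ P) ∧
      ∑ u ∈ G.light S (S ∪ P), G.gift (S ∪ P) u x < 2 * G.charge (S ∪ P) x := by
  by_contra hcon
  push Not at hcon
  have tight : ∀ x ∈ S, x ∉ G.light S (S ∪ P) →
      ∑ u ∈ G.light S (S ∪ P), G.gift (S ∪ P) u x = 2 * G.charge (S ∪ P) x :=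
    fun x hx hxl => le_antisymm (h.gift_bound hx hxl).1 (hcon x hx hxl)
  have hSX : ∀ {v}, v ∈ S → v ∈ S ∪ P := fun hv => Finset.mem_union_left _ hv
  obtain ⟨x, hxu, hqx⟩ : ∃ x ∈ G.nbrs (S ∪ P) u, 1 ≤ G.charge (S ∪ P) x := by
    have hu2 := (mem_light.1 hu).2.1
    obtain ⟨x, hx⟩ : (G.nbrs (S ∪ P) u).Nonempty := Finset.card_pos.1 (by omega)
    obtain ⟨y, hxy, hn, hxS, hyS, hq, -⟩ := h.light_cases hu hx
    by_cases hqx : 1 ≤ G.charge (S ∪ P) x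
    · exact ⟨x, hx, hqx⟩
    · exact ⟨y, by simp [hn], by omega⟩
  have hxS : x ∈ S := by
    obtain ⟨y, hxy, hn, hxS, -⟩ := h.light_cases hu hxu
    exact hxS
  have hxl : x ∉ G.light S (S ∪ P) := notMem_light_of_charge (by linarith)
  rcases (h.gift_bound hxS hxl).2 hqx (tight x hxS hxl) with ⟨h3, hl2, hn1⟩ | ⟨h4, hl2, hall⟩
  · -- three edges: both light neighbours form a negative triangle over the same edge
    obtain ⟨u₁, u₂, h12, hl⟩ := Finset.card_eq_two.1 hl2
    have key : ∀ v ∈ lightNbrs G S (S ∪ P) x, ∃ y, y ∈ G.nbrs (S ∪ P) x ∧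
        y ∉ G.light S (S ∪ P) ∧ G.nbrs (S ∪ P) v = {x, y} ∧ G.Neg v x y := by
      intro v hv
      rw [lightNbrs, Finset.mem_filter] at hv
      obtain ⟨y, hxy, hn, -, hyS, -, hc⟩ := h.light_cases hv.2
        (mem_nbrs_comm (hSX hxS) hv.1)
      rcases hc with ⟨hN, -, hc⟩ | ⟨-, -, z, hz, t, ht, hz3, ht3, hK⟩
      · exact ⟨y, mem_nbrs.2 ⟨hSX hyS, hN.ne_zero23⟩, notMem_light_of_charge (by linarith), hn, hN⟩
      · exfalso
        have hcard := card_lightNbrs_add_le (G := G) (S := S) (P := P) (T := {z, t}) (x := x) (by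
          intro v hv
          simp only [Finset.mem_insert, Finset.mem_singleton] at hv
          rcases hv with rfl | rfl
          · exact mem_nbrs.2 ⟨hSX hz, hK.1.ne_zero12⟩
          · exact mem_nbrs.2 ⟨hSX ht, hK.1.ne_zero13⟩) (by
          intro v hv
          simp only [Finset.mem_insert, Finset.mem_singleton] at hv
          rcases hv with rfl | rfl <;> exact notMem_light_of_card (by assumption))
        rw [Finset.card_pair (ne_of_sg hK.1.ne_zero23)] at hcard
        omega
    have m1 : u₁ ∈ lightNbrs G S (S ∪ P) x := by simp [hl]
    have m2 : u₂ ∈ lightNbrs G S (S ∪ P) x := by simp [hl]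
    obtain ⟨y₁, hy₁, hyl₁, hn₁, hN₁⟩ := key u₁ m1
    obtain ⟨y₂, hy₂, hyl₂, hn₂, hN₂⟩ := key u₂ m2
    have hyy : y₁ = y₂ := by
      by_contra hne
      have hcard := card_lightNbrs_add_le (G := G) (S := S) (P := P) (T := {y₁, y₂}) (x := x) (by
        intro v hv
        simp only [Finset.mem_insert, Finset.mem_singleton] at hv
        rcases hv with rfl | rfl <;> assumption) (by
        intro v hv
        simp only [Finset.mem_insert, Finset.mem_singleton] at hv
        rcases hv with rfl | rfl <;> assumption)
      rw [Finset.card_pair hne] at hcard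
      omega
    subst hyy
    have l1 := mem_light.1 (Finset.mem_filter.1 m1).2
    have l2 := mem_light.1 (Finset.mem_filter.1 m2).2
    have := h.not_two_light l1.1 l2.1 h12 hxS hn₁ l1.2.2.le hN₁ hn₂ l2.2.2.le hN₂ h3
    omega
  · -- four edges: a common neighbour of `x` and both partners keeps charge
    obtain ⟨u₁, u₂, h12, hl⟩ := Finset.card_eq_two.1 hl2
    have key : ∀ v ∈ lightNbrs G S (S ∪ P) x, ∃ y z t, v ∈ S ∧ y ∈ S ∧ z ∈ S ∧ t ∈ S ∧
        y ∉ G.light S (S ∪ P) ∧ G.charge (S ∪ P) y ≤ 0 ∧ G.nbrs (S ∪ P) v = {x, y} ∧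
        z ∉ G.light S (S ∪ P) ∧ t ∉ G.light S (S ∪ P) ∧ G.NegK4Via v x y z t := by
      intro v hv
      obtain ⟨y', hy', hqy⟩ := hall v hv
      rw [lightNbrs, Finset.mem_filter] at hv
      obtain ⟨y, hxy, hn, -, hyS, -, hc⟩ := h.light_cases hv.2
        (mem_nbrs_comm (hSX hxS) hv.1)
      have hyy : y' = y := by
        rw [hn] at hy'
        simp only [Finset.mem_insert, Finset.mem_singleton] at hy'
        rcases hy' with rfl | rfl
        · omega
        · rfl
      subst hyy
      rcases hc with ⟨hN, -, hc⟩ | ⟨-, hy3, z, hz, t, ht, hz3, ht3, hK⟩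
      · omega
      · exact ⟨y', z, t, (mem_light.1 hv.2).1, hyS, hz, ht, notMem_light_of_card hy3, hqy, hn,
          notMem_light_of_card hz3, notMem_light_of_card ht3, hK⟩
    have m1 : u₁ ∈ lightNbrs G S (S ∪ P) x := by simp [hl]
    have m2 : u₂ ∈ lightNbrs G S (S ∪ P) x := by simp [hl]
    obtain ⟨y₁, z₁, t₁, hu₁S, hyS₁, hzS₁, htS₁, hyl₁, hqy₁, hn₁, hzl₁, htl₁, hK₁⟩ := key u₁ m1
    obtain ⟨y₂, z₂, t₂, hu₂S, hyS₂, hzS₂, htS₂, hyl₂, hqy₂, hn₂, hzl₂, htl₂, hK₂⟩ := key u₂ m2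
    -- the two neighbours of `x` that are not light
    have hmem : ∀ v, v ∈ S → G.sg x v ≠ 0 → v ∉ G.light S (S ∪ P) → v = z₁ ∨ v = t₁ := by
      intro v hv hs hvl
      by_contra hne
      push Not at hne
      have hcard := card_lightNbrs_add_le (G := G) (S := S) (P := P) (T := {v, z₁, t₁}) (x := x) (by
        intro w hw
        simp only [Finset.mem_insert, Finset.mem_singleton] at hw
        rcases hw with rfl | rfl | rfl
        · exact mem_nbrs.2 ⟨hSX hv, hs⟩
        · exact mem_nbrs.2 ⟨hSX hzS₁, hK₁.1.ne_zero12⟩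
        · exact mem_nbrs.2 ⟨hSX htS₁, hK₁.1.ne_zero13⟩) (by
        intro w hw
        simp only [Finset.mem_insert, Finset.mem_singleton] at hw
        rcases hw with rfl | rfl | rfl <;> assumption)
      rw [Finset.card_eq_three.2 ⟨v, z₁, t₁, hne.1, hne.2, ne_of_sg hK₁.1.ne_zero23, rfl⟩] at hcard
      omega
    have hz₂ := hmem z₂ hzS₂ hK₂.1.ne_zero12 hzl₂
    have ht₂ := hmem t₂ htS₂ hK₂.1.ne_zero13 htl₂
    have hzt₂ := ne_of_sg hK₂.1.ne_zero23
    have hy₂z : G.sg y₂ z₁ ≠ 0 ∧ G.sg y₂ t₁ ≠ 0 := by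
      rcases hz₂ with e | e <;> rcases ht₂ with e' | e'
      · exact (hzt₂ (e.trans e'.symm)).elim
      · rw [← e, ← e']; exact ⟨hK₂.2.1.ne_zero12, hK₂.2.1.ne_zero13⟩
      · rw [← e, ← e']; exact ⟨hK₂.2.1.ne_zero13, hK₂.2.1.ne_zero12⟩
      · exact (hzt₂ (e.trans e'.symm)).elim
    have hzt₁ := ne_of_sg hK₁.1.ne_zero23
    have hyy : y₁ ≠ y₂ := by
      rintro rfl
      have hsub : ({u₁, u₂, z₁, t₁} : Finset V) ⊆ G.nbrs (S ∪ P) y₁ := by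
        intro w hw
        simp only [Finset.mem_insert, Finset.mem_singleton] at hw
        rcases hw with rfl | rfl | rfl | rfl
        · exact mem_nbrs_comm (hSX hu₁S) (by simp [hn₁])
        · exact mem_nbrs_comm (hSX hu₂S) (by simp [hn₂])
        · exact mem_nbrs.2 ⟨hSX hzS₁, hK₁.2.1.ne_zero12⟩
        · exact mem_nbrs.2 ⟨hSX htS₁, hK₁.2.1.ne_zero13⟩
      have l1 := (Finset.mem_filter.1 m1).2
      have l2 := (Finset.mem_filter.1 m2).2
      have hne : ∀ {a b}, a ∈ G.light S (S ∪ P) → b ∉ G.light S (S ∪ P) → a ≠ b := by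
        rintro a b ha hb rfl; exact hb ha
      have hc := Finset.card_le_card hsub
      rw [Finset.card_insert_of_notMem (by
        simp only [Finset.mem_insert, Finset.mem_singleton, not_or]
        exact ⟨h12, hne l1 hzl₁, hne l1 htl₁⟩), Finset.card_eq_three.2
          ⟨u₂, z₁, t₁, hne l2 hzl₁, hne l2 htl₁, hzt₁, rfl⟩] at hc
      unfold charge at hqy₁
      omega
    have hxy₁ : x ≠ y₁ := by rintro rfl; omega
    have hxy₂ : x ≠ y₂ := by rintro rfl; omega
    have hcard := card_lightNbrs_add_le (G := G) (S := S) (P := P) (T := {x, y₁, y₂, t₁})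
      (x := z₁) (by
        intro w hw
        simp only [Finset.mem_insert, Finset.mem_singleton] at hw
        rcases hw with rfl | rfl | rfl | rfl
        · exact mem_nbrs.2 ⟨hSX hxS, hK₁.1.swap12.ne_zero12⟩
        · exact mem_nbrs.2 ⟨hSX hyS₁, hK₁.2.1.swap12.ne_zero12⟩
        · exact mem_nbrs.2 ⟨hSX hyS₂, by rw [G.sg_symm]; exact hy₂z.1⟩
        · exact mem_nbrs.2 ⟨hSX htS₁, hK₁.1.ne_zero23⟩) (by
        intro w hw
        simp only [Finset.mem_insert, Finset.mem_singleton] at hw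
        rcases hw with rfl | rfl | rfl | rfl <;> assumption)
    rw [Finset.card_insert_of_notMem (by
        simp only [Finset.mem_insert, Finset.mem_singleton, not_or]
        exact ⟨hxy₁, hxy₂, ne_of_sg hK₁.1.ne_zero13⟩), Finset.card_eq_three.2
          ⟨y₁, y₂, t₁, hyy, ne_of_sg hK₁.2.1.ne_zero13, ne_of_sg hy₂z.2, rfl⟩] at hcard
    have hsum := sum_gift_le (G := G) (S := S) (P := P) z₁
    rw [tight z₁ hzS₁ hzl₁, charge] at hsum
    omega

theorem light_eq_empty (h : Extremal G S P g) : G.light S (S ∪ P) = ∅ := by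
  by_contra hne
  obtain ⟨u, hu⟩ := Finset.nonempty_iff_ne_empty.2 hne
  obtain ⟨x, hx, hxl, hlt⟩ := h.exists_gift_lt hu
  set L := G.light S (S ∪ P) with hL
  have hLS : L ⊆ S := Finset.filter_subset _ _
  have e1 : ∑ x ∈ S \ L, ∑ u ∈ L, G.gift (S ∪ P) u x < ∑ x ∈ S \ L, 2 * G.charge (S ∪ P) x :=
    Finset.sum_lt_sum (fun y hy => by
      rw [Finset.mem_sdiff] at hy
      exact (h.gift_bound hy.1 hy.2).1) ⟨x, Finset.mem_sdiff.2 ⟨hx, hxl⟩, hlt⟩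
  have e2 : ∑ x ∈ L, ∑ u ∈ L, G.gift (S ∪ P) u x = 0 :=
    Finset.sum_eq_zero fun y hy => Finset.sum_eq_zero fun v _ => by
      unfold gift
      rw [if_neg]
      rintro ⟨-, hq⟩
      rw [charge_of_light hy] at hq
      norm_num at hq
  have e3 : ∑ x ∈ L, 2 * G.charge (S ∪ P) x = -2 * L.card := by
    rw [Finset.sum_congr rfl fun y hy => by rw [charge_of_light hy]]
    simp; ring
  have e4 := Finset.sum_sdiff (f := fun x => ∑ u ∈ L, G.gift (S ∪ P) u x) hLS
  have e5 := Finset.sum_sdiff (f := fun x => 2 * G.charge (S ∪ P) x) hLS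
  have e6 : 2 * (L.card : ℤ) ≤ ∑ x ∈ S, ∑ u ∈ L, G.gift (S ∪ P) u x := by
    rw [Finset.sum_comm]
    refine le_trans ?_ (Finset.card_nsmul_le_sum L _ 2 fun v hv => h.two_le_sum_gift hv)
    simp [mul_comm]
  have e7 := h.sum_charge
  have e8 := h.pot_nonneg S subset_rfl ⟨x, hx⟩
  have e9 := wts_nonneg (G := G) S P
  have e10 : ∑ x ∈ S, 2 * G.charge (S ∪ P) x = 2 * (-G.pot P S - G.wts S P) := by
    rw [← Finset.mul_sum, e7]
  linarith

/-- In a minimal counterexample there are no constraints between the free and the precoloured part,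
and every vertex has either three edges, or two edges and two forbidden differences. -/
theorem tight (h : Extremal G S P g) : G.wts S P = 0 ∧ ∀ u ∈ S,
    ((G.nbrs (S ∪ P) u).card = 2 ∧ G.nes (S ∪ P) u = 2) ∨
      ((G.nbrs (S ∪ P) u).card = 3 ∧ G.nes (S ∪ P) u = 0) := by
  have hl := h.light_eq_empty
  have hq : ∀ u ∈ S, 0 ≤ G.charge (S ∪ P) u := fun u hu => (h.charge_cases hu (by simp [hl])).1
  have e7 := h.sum_charge
  have e9 := wts_nonneg (G := G) S P
  have e10 := Finset.sum_nonneg hq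
  rcases S.eq_empty_or_nonempty with rfl | hS
  · simp [wts]
  have e8 := h.pot_nonneg S subset_rfl hS
  refine ⟨by linarith, fun u hu => (h.charge_cases hu (by simp [hl])).2 ?_⟩
  exact (Finset.sum_eq_zero_iff_of_nonneg hq).1 (by linarith) u hu

end Extremal
/-! ### Vertices with two edges and two forbidden differences -/

section Colors

set_option synthInstance.maxHeartbeats 400000
set_option synthInstance.maxSize 2000

theorem exists_bad_pair_aux (f₂ g₁ g₂ : ZMod 10) : ∃ b₁ b₂ : ZMod 10, ∀ y, y ≠ b₁ → y ≠ b₂ →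
    ∃ x, near (x - y) ∧ x ≠ 0 ∧ x ≠ f₂ ∧ ∃ u, near (u - y) ∧ near (u - x - 5) ∧
      u ≠ g₁ ∧ u ≠ g₂ := by
  revert f₂ g₁ g₂; decide +kernel

theorem exists_common_far_aux (a g₁ g₂ : ZMod 10) : ∃ y, near y ∧ ∃ x, near (x - y) ∧
    near (x - a) ∧ ∃ u, near (u - y) ∧ near (u - x - 5) ∧ u ≠ g₁ ∧ u ≠ g₂ := by
  revert a g₁ g₂; decide +kernel

end Colors

/-- Two excluded colours at each of two vertices of a negative triangle rule out at most two colours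
of the third vertex. -/
theorem exists_bad_pair (f₁ f₂ g₁ g₂ : ZMod 10) : ∃ b₁ b₂ : ZMod 10, ∀ y, y ≠ b₁ → y ≠ b₂ →
    ∃ r p, near r ∧ near p ∧ near (p - r - 5) ∧ y + r ≠ f₁ ∧ y + r ≠ f₂ ∧ y + p ≠ g₁ ∧
      y + p ≠ g₂ := by
  obtain ⟨b₁, b₂, hb⟩ := exists_bad_pair_aux (f₂ - f₁) (g₁ - f₁) (g₂ - f₁)
  refine ⟨b₁ + f₁, b₂ + f₁, fun y h1 h2 => ?_⟩
  obtain ⟨x, h3, h4, h5, u, h6, h7, h8, h9⟩ := hb (y - f₁) (fun h => h1 (by rw [← h]; ring))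
    (fun h => h2 (by rw [← h]; ring))
  refine ⟨x - (y - f₁), u - (y - f₁), h3, h6, ?_, ?_, ?_, ?_, ?_⟩
  · convert h7 using 1; ring
  · intro h; apply h4; linear_combination h
  · intro h; apply h5; linear_combination h
  · intro h; apply h8; linear_combination h
  · intro h; apply h9; linear_combination h

/-- If two vertices of a negative triangle have one further neighbour each, at least three colours
remain for the third vertex. -/
theorem exists_common_far (a b g₁ g₂ : ZMod 10) : ∃ y r p, near r ∧ near p ∧ near (p - r - 5) ∧
    near (y - b) ∧ near (y + r - a) ∧ y + p ≠ g₁ ∧ y + p ≠ g₂ := by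
  obtain ⟨y, h1, x, h2, h3, u, h4, h5, h6, h7⟩ := exists_common_far_aux (a - b) (g₁ - b) (g₂ - b)
  refine ⟨y + b, x - y, u - y, h2, h4, ?_, ?_, ?_, ?_, ?_⟩
  · convert h5 using 1; ring
  · convert h1 using 1; ring
  · convert h3 using 1; ring
  · intro h; apply h6; linear_combination h
  · intro h; apply h7; linear_combination h

theorem ne_of_far {p r : ZMod 10} (hp : near p) (hr : near r) (h : near (p - r - 5)) :
    (p ≠ 0 ∧ p ≠ 5) ∧ r ≠ 0 ∧ r ≠ 5 := by
  revert p r; decide +kernel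

theorem compat_shift_add {u y : V} {p : ZMod 10} (hp : near p) (h : p ≠ 0 ∧ p ≠ 5) :
    G.Compat u y (shift (G.sg u y) + p) := by
  refine ⟨fun _ => by simpa using hp, fun k _ hd => ?_⟩
  have e : p = shift k + shift (G.sg u y) + shift 0 := by
    rw [show shift 0 = 0 from rfl]
    linear_combination hd - shift_add_self (G.sg u y)
  rcases shift_eq_or k (G.sg u y) 0 with h0 | h0 <;> rw [h0] at e <;> tauto

namespace Extremal

variable {S P : Finset V} {g : V → ZMod 10}

/-- A colouring of `S \ T` does not extend to `T`. -/
theorem no_extend (h : Extremal G S P g) {T : Finset V} (hT : T ⊆ S) {f : V → ZMod 10}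
    (hfg : ∀ v ∈ P, f v = g v) (hf : G.Ok (S \ T) P f) (c : V → ZMod 10)
    (h1 : ∀ u ∈ T, ∀ v ∈ S \ T ∪ P, G.Compat u v (c u - f v))
    (h2 : ∀ u ∈ T, ∀ v ∈ T, G.Compat u v (c u - c v)) : False := by
  have hdP : Disjoint T P := h.disj.mono_left hT
  have hok := hf.extend (T := T) (h := c) Finset.disjoint_sdiff hdP h1 h2
  refine h.not_extends_of_eq (Finset.union_sdiff_of_subset hT) hfg (fun v hv => ?_) hok
  rw [if_neg (Finset.disjoint_right.1 hdP hv)]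

theorem sg_P_eq_zero (h : Extremal G S P g) {u v : V} (hu : u ∈ S) (hv : v ∈ P) :
    G.sg u v = 0 := by
  by_contra h0
  have h1 := (two_le_wt h0).trans (wt_le_wts hv)
  have h2 : G.wts {u} P ≤ G.wts S P := wts_mono_left (by simpa using hu)
  rw [h.tight.1] at h2
  linarith

theorem mem_of_mem_nbrs (h : Extremal G S P g) {u v : V} (hu : u ∈ S)
    (hv : v ∈ G.nbrs (S ∪ P) u) : v ∈ S := by
  rw [mem_nbrs] at hv
  exact (Finset.mem_union.1 hv.1).resolve_right fun hP => hv.2 (h.sg_P_eq_zero hu hP)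

theorem exists_third {X : Finset V} {x a b : V} (h3 : (G.nbrs X x).card = 3) (ha : a ∈ G.nbrs X x)
    (hb : b ∈ G.nbrs X x) (hab : a ≠ b) :
    ∃ c, c ≠ a ∧ c ≠ b ∧ G.nbrs X x = {a, b, c} := by
  have hsub : ({a, b} : Finset V) ⊆ G.nbrs X x := by
    intro v hv
    simp only [Finset.mem_insert, Finset.mem_singleton] at hv
    rcases hv with rfl | rfl <;> assumption
  have hc := Finset.card_sdiff_add_card_eq_card hsub
  rw [h3, Finset.card_pair hab] at hc
  obtain ⟨c, hc⟩ := Finset.card_eq_one.1 (by omega : (G.nbrs X x \ {a, b}).card = 1)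
  have hcm : c ∈ G.nbrs X x \ {a, b} := by simp [hc]
  rw [Finset.mem_sdiff] at hcm
  simp only [Finset.mem_insert, Finset.mem_singleton, not_or] at hcm
  refine ⟨c, hcm.2.1, hcm.2.2, ?_⟩
  rw [← Finset.sdiff_union_of_subset hsub, hc]
  ext v; simp; tauto

/-- A colouring of the vertices outside a negative triangle `u x y` does not extend to the triangle.
The colours of `u` and `x` are written relative to the colour `Y` of `y`. -/
theorem neg_triangle_color (h : Extremal G S P g) {u x y : V} (hu : u ∈ S) (hx : x ∈ S)
    (hy : y ∈ S) (hN : G.Neg u x y) {f : V → ZMod 10} (hfg : ∀ v ∈ P, f v = g v)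
    (hf : G.Ok (S \ {u, x, y}) P f) (Y r p : ZMod 10) (hr : near r) (hp : near p)
    (hpr : near (p - r - 5))
    (hY : ∀ v ∈ S \ {u, x, y} ∪ P, G.Compat y v (Y - f v))
    (hX : ∀ v ∈ S \ {u, x, y} ∪ P, G.Compat x v (Y + shift (G.sg x y) + r - f v))
    (hU : ∀ v ∈ S \ {u, x, y} ∪ P, G.Compat u v (Y + shift (G.sg u y) + p - f v)) : False := by
  have hux := ne_of_sg hN.ne_zero12
  have huy := ne_of_sg hN.ne_zero13
  have hxy := ne_of_sg hN.ne_zero23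
  obtain ⟨np, nr⟩ := ne_of_far hp hr hpr
  have k1 := hN.compat Y hp hr hpr
  have k2 : G.Compat u y (Y + shift (G.sg u y) + p - Y) := by
    have := compat_shift_add (G := G) (u := u) (y := y) hp np
    convert this using 1; ring
  have k3 : G.Compat x y (Y + shift (G.sg x y) + r - Y) := by
    have := compat_shift_add (G := G) (u := x) (y := y) hr nr
    convert this using 1; ring
  set c : V → ZMod 10 := fun v => if v = u then Y + shift (G.sg u y) + p else
    if v = x then Y + shift (G.sg x y) + r else Y with hc
  have cu : c u = Y + shift (G.sg u y) + p := by simp [hc]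
  have cx : c x = Y + shift (G.sg x y) + r := by simp [hc, hux.symm]
  have cy : c y = Y := by simp [hc, huy.symm, hxy.symm]
  rw [← cu, ← cx] at k1
  rw [← cu] at k2
  rw [← cx] at k3
  rw [← cy] at k2
  rw [← cy] at k3
  refine h.no_extend (T := {u, x, y}) ?_ hfg hf c ?_ ?_
  · intro v hv
    simp only [Finset.mem_insert, Finset.mem_singleton] at hv
    rcases hv with rfl | rfl | rfl <;> assumption
  · intro v hv w hw
    simp only [Finset.mem_insert, Finset.mem_singleton] at hv
    rcases hv with rfl | rfl | rfl
    · rw [cu]; exact hU w hw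
    · rw [cx]; exact hX w hw
    · rw [cy]; exact hY w hw
  · intro v hv w hw
    simp only [Finset.mem_insert, Finset.mem_singleton] at hv hw
    rcases hv with rfl | rfl | rfl <;> rcases hw with rfl | rfl | rfl <;>
      first | exact compat_self | assumption | (apply compat_comm; assumption)

/-- Without edges from `u` into `Y`, every colour of `u` that no forbidden difference excludes
satisfies the constraints between `u` and `Y`. -/
theorem compat_of_disjoint_nbrs {Y : Finset V} {f : V → ZMod 10} {u : V} {c : ZMod 10}
    (hd : ∀ v ∈ Y, G.sg u v = 0) (hc : c ∉ G.forb Y f u) :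
    ∀ v ∈ Y, G.Compat u v (c - f v) :=
  fun v hv => compat_of_notMem_forb hv hc fun h0 => (h0 (hd v hv)).elim

theorem sg_eq_zero_of_nbrs {X Y T : Finset V} {u : V} (hn : G.nbrs X u ⊆ T) (hY : Y ⊆ X)
    (hYT : Disjoint T Y) : ∀ v ∈ Y, G.sg u v = 0 := by
  intro v hv
  by_contra h0
  exact Finset.disjoint_left.1 hYT (hn (mem_nbrs.2 ⟨hY hv, h0⟩)) hv

theorem disjoint_rest (h : Extremal G S P g) {T : Finset V} (hT : T ⊆ S) :
    Disjoint T (S \ T ∪ P) := by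
  rw [Finset.disjoint_union_right]
  exact ⟨Finset.disjoint_sdiff, h.disj.mono_left hT⟩

theorem rest_subset {T : Finset V} : S \ T ∪ P ⊆ S ∪ P :=
  Finset.union_subset_union_left Finset.sdiff_subset

theorem three_mem {u x y : V} (hu : u ∈ S) (hx : x ∈ S) (hy : y ∈ S) :
    ({u, x, y} : Finset V) ⊆ S := by
  intro v hv
  simp only [Finset.mem_insert, Finset.mem_singleton] at hv
  rcases hv with rfl | rfl | rfl <;> assumption

/-- No negative triangle contains two vertices with only two edges. -/
theorem not_neg_two_two (h : Extremal G S P g) {u x y : V} (hu : u ∈ S) (hx : x ∈ S) (hy : y ∈ S)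
    (hN : G.Neg u x y) (hu2 : (G.nbrs (S ∪ P) u).card = 2) (hun : G.nes (S ∪ P) u = 2)
    (hx2 : (G.nbrs (S ∪ P) x).card = 2) (hxn : G.nes (S ∪ P) x = 2) : False := by
  have hux := ne_of_sg hN.ne_zero12
  have huy := ne_of_sg hN.ne_zero13
  have hxy := ne_of_sg hN.ne_zero23
  have hSX : ∀ {v}, v ∈ S → v ∈ S ∪ P := fun hv => Finset.mem_union_left _ hv
  set T : Finset V := {u, x, y} with hTdef
  have hT : T ⊆ S := three_mem hu hx hy
  have hd := h.disjoint_rest hT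
  have hnu : G.nbrs (S ∪ P) u = {x, y} := by
    symm
    apply Finset.eq_of_subset_of_card_le
    · intro v hv
      simp only [Finset.mem_insert, Finset.mem_singleton] at hv
      rcases hv with rfl | rfl
      · exact mem_nbrs.2 ⟨hSX hx, hN.ne_zero12⟩
      · exact mem_nbrs.2 ⟨hSX hy, hN.ne_zero13⟩
    · rw [hu2, Finset.card_pair hxy]
  have hnx : G.nbrs (S ∪ P) x = {u, y} := by
    symm
    apply Finset.eq_of_subset_of_card_le
    · intro v hv
      simp only [Finset.mem_insert, Finset.mem_singleton] at hv
      rcases hv with rfl | rfl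
      · exact mem_nbrs.2 ⟨hSX hu, hN.swap12.ne_zero12⟩
      · exact mem_nbrs.2 ⟨hSX hy, hN.ne_zero23⟩
    · rw [hx2, Finset.card_pair huy]
  have zu := sg_eq_zero_of_nbrs (u := u) (T := T) (by rw [hnu, hTdef]; simp)
    (rest_subset (S := S) (P := P) (T := T)) hd
  have zx := sg_eq_zero_of_nbrs (u := x) (T := T) (by
      rw [hnx, hTdef]; intro v hv; simp at hv ⊢; tauto)
    (rest_subset (S := S) (P := P) (T := T)) hd
  obtain ⟨f, hfg, hf⟩ := h.sub_extends (Finset.sdiff_ssubset hT ⟨u, by simp [hTdef]⟩)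
  -- at least three colours remain for `y`
  obtain ⟨A, hA, hAc⟩ : ∃ A : Finset (ZMod 10), 3 ≤ A.card ∧
      ∀ c ∈ A, ∀ v ∈ S \ T ∪ P, G.Compat y v (c - f v) := by
    have uy : u ∈ G.nbrs (S ∪ P) y := mem_nbrs.2 ⟨hSX hu, hN.swap23.swap12.ne_zero12⟩
    have xy : x ∈ G.nbrs (S ∪ P) y := mem_nbrs.2 ⟨hSX hx, by rw [G.sg_symm]; exact hN.ne_zero23⟩
    rcases h.tight.2 y hy with ⟨hy2, hyn⟩ | ⟨hy3, hyn⟩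
    · have hny : G.nbrs (S ∪ P) y = {u, x} := by
        symm
        apply Finset.eq_of_subset_of_card_le
        · intro v hv
          simp only [Finset.mem_insert, Finset.mem_singleton] at hv
          rcases hv with rfl | rfl <;> assumption
        · rw [hy2, Finset.card_pair hux]
      have zy := sg_eq_zero_of_nbrs (u := y) (T := T) (by
          rw [hny, hTdef]; intro v hv; simp at hv ⊢; tauto)
        (rest_subset (S := S) (P := P) (T := T)) hd
      refine ⟨(G.forb (S \ T ∪ P) f y)ᶜ, ?_, fun c hc =>
        compat_of_disjoint_nbrs zy (Finset.mem_compl.1 hc)⟩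
      have := forb_card_le_of_subset (G := G) (P := P) (Finset.sdiff_subset (s := S) (t := T)) f y
      rw [Finset.card_compl, ZMod.card]
      omega
    · obtain ⟨w, hwu, hwx, hny⟩ := exists_third hy3 uy xy hux
      refine ⟨Finset.univ.filter fun c => near (c - (f w + shift (G.sg y w))),
        by rw [card_near]; norm_num, fun c hc v hv => ⟨fun h0 => ?_, ?_⟩⟩
      · have hvX := rest_subset hv
        have : v ∈ G.nbrs (S ∪ P) y := mem_nbrs.2 ⟨hvX, h0⟩
        rw [hny] at this
        simp only [Finset.mem_insert, Finset.mem_singleton] at this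
        have hvT := Finset.disjoint_right.1 hd hv
        rcases this with rfl | rfl | rfl
        · simp [hTdef] at hvT
        · simp [hTdef] at hvT
        · rw [sub_sub]; exact (Finset.mem_filter.1 hc).2
      · rw [ne_eq_empty_of_nes (rest_subset hv) hyn]; simp
  obtain ⟨g₁, g₂, hg⟩ := exists_subset_pair ((forb_card_le_of_subset (G := G) (P := P)
    (Finset.sdiff_subset (s := S) (t := T)) f u).trans hun.le)
  obtain ⟨f₁, f₂, hff⟩ := exists_subset_pair ((forb_card_le_of_subset (G := G) (P := P)
    (Finset.sdiff_subset (s := S) (t := T)) f x).trans hxn.le)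
  obtain ⟨b₁, b₂, hb⟩ := exists_bad_pair (f₁ - shift (G.sg x y)) (f₂ - shift (G.sg x y))
    (g₁ - shift (G.sg u y)) (g₂ - shift (G.sg u y))
  obtain ⟨Y, hY, hYb⟩ := exists_notMem_of_card (A := A) (B := {b₁, b₂})
    (lt_of_le_of_lt Finset.card_le_two (by omega))
  simp only [Finset.mem_insert, Finset.mem_singleton, not_or] at hYb
  obtain ⟨r, p, hr, hp, hpr, r1, r2, p1, p2⟩ := hb Y hYb.1 hYb.2
  refine h.neg_triangle_color hu hx hy hN hfg hf Y r p hr hp hpr (hAc Y hY)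
    (compat_of_disjoint_nbrs zx fun hm => ?_) (compat_of_disjoint_nbrs zu fun hm => ?_)
  · have := hff hm
    simp only [Finset.mem_insert, Finset.mem_singleton] at this
    rcases this with e | e
    · apply r1; linear_combination e
    · apply r2; linear_combination e
  · have := hg hm
    simp only [Finset.mem_insert, Finset.mem_singleton] at this
    rcases this with e | e
    · apply p1; linear_combination e
    · apply p2; linear_combination e

/-- A vertex with two edges does not form a negative triangle with two cubic vertices. -/
theorem not_neg_two_three (h : Extremal G S P g) {u x y : V} (hu : u ∈ S) (hx : x ∈ S) (hy : y ∈ S)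
    (hN : G.Neg u x y) (hu2 : (G.nbrs (S ∪ P) u).card = 2) (hun : G.nes (S ∪ P) u = 2)
    (hx3 : (G.nbrs (S ∪ P) x).card = 3) (hxn : G.nes (S ∪ P) x = 0)
    (hy3 : (G.nbrs (S ∪ P) y).card = 3) (hyn : G.nes (S ∪ P) y = 0) : False := by
  have hux := ne_of_sg hN.ne_zero12
  have huy := ne_of_sg hN.ne_zero13
  have hxy := ne_of_sg hN.ne_zero23
  have hSX : ∀ {v}, v ∈ S → v ∈ S ∪ P := fun hv => Finset.mem_union_left _ hv
  set T : Finset V := {u, x, y} with hTdef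
  have hT : T ⊆ S := three_mem hu hx hy
  have hd := h.disjoint_rest hT
  have hnu : G.nbrs (S ∪ P) u = {x, y} := by
    symm
    apply Finset.eq_of_subset_of_card_le
    · intro v hv
      simp only [Finset.mem_insert, Finset.mem_singleton] at hv
      rcases hv with rfl | rfl
      · exact mem_nbrs.2 ⟨hSX hx, hN.ne_zero12⟩
      · exact mem_nbrs.2 ⟨hSX hy, hN.ne_zero13⟩
    · rw [hu2, Finset.card_pair hxy]
  have zu := sg_eq_zero_of_nbrs (u := u) (T := T) (by rw [hnu, hTdef]; simp)
    (rest_subset (S := S) (P := P) (T := T)) hd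
  have hmx : u ∈ G.nbrs (S ∪ P) x := mem_nbrs.2 ⟨hSX hu, hN.swap12.ne_zero12⟩
  have hmx' : y ∈ G.nbrs (S ∪ P) x := mem_nbrs.2 ⟨hSX hy, hN.ne_zero23⟩
  have hmy : u ∈ G.nbrs (S ∪ P) y := mem_nbrs.2 ⟨hSX hu, hN.swap23.swap12.ne_zero12⟩
  have hmy' : x ∈ G.nbrs (S ∪ P) y := mem_nbrs.2 ⟨hSX hx, by rw [G.sg_symm]; exact hN.ne_zero23⟩
  obtain ⟨x', -, -, hnx⟩ := exists_third hx3 hmx hmx' huy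
  obtain ⟨y', -, -, hny⟩ := exists_third hy3 hmy hmy' hux
  obtain ⟨f, hfg, hf⟩ := h.sub_extends (Finset.sdiff_ssubset hT ⟨u, by simp [hTdef]⟩)
  obtain ⟨g₁, g₂, hg⟩ := exists_subset_pair ((forb_card_le_of_subset (G := G) (P := P)
    (Finset.sdiff_subset (s := S) (t := T)) f u).trans hun.le)
  obtain ⟨Y, r, p, hr, hp, hpr, hY, hX, p1, p2⟩ := exists_common_far
    (f x' + shift (G.sg x x') - shift (G.sg x y)) (f y' + shift (G.sg y y'))
    (g₁ - shift (G.sg u y)) (g₂ - shift (G.sg u y))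
  refine h.neg_triangle_color hu hx hy hN hfg hf Y r p hr hp hpr (fun v hv => ⟨fun h0 => ?_, ?_⟩)
    (fun v hv => ⟨fun h0 => ?_, ?_⟩) (compat_of_disjoint_nbrs zu fun hm => ?_)
  · have : v ∈ G.nbrs (S ∪ P) y := mem_nbrs.2 ⟨rest_subset hv, h0⟩
    rw [hny] at this
    simp only [Finset.mem_insert, Finset.mem_singleton] at this
    have hvT := Finset.disjoint_right.1 hd hv
    rcases this with rfl | rfl | rfl
    · simp [hTdef] at hvT
    · simp [hTdef] at hvT
    · rw [sub_sub]; exact hY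
  · rw [ne_eq_empty_of_nes (rest_subset hv) hyn]; simp
  · have : v ∈ G.nbrs (S ∪ P) x := mem_nbrs.2 ⟨rest_subset hv, h0⟩
    rw [hnx] at this
    simp only [Finset.mem_insert, Finset.mem_singleton] at this
    have hvT := Finset.disjoint_right.1 hd hv
    rcases this with rfl | rfl | rfl
    · simp [hTdef] at hvT
    · simp [hTdef] at hvT
    · convert hX using 1; ring
  · rw [ne_eq_empty_of_nes (rest_subset hv) hxn]; simp
  · have := hg hm
    simp only [Finset.mem_insert, Finset.mem_singleton] at this
    rcases this with e | e
    · apply p1; linear_combination e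
    · apply p2; linear_combination e

/-- A vertex `u` with two edges and two forbidden differences does not stand for an edge of a
negative `K_4`. Otherwise the four vertices of the `K_4` are cubic, and only the forbidden
differences at `u` leave the five vertices. These can be coloured last, whatever the colour of
`u`. -/
theorem not_negK4Via_two (h : Extremal G S P g) {u x y z t : V} (hu : u ∈ S) (hx : x ∈ S)
    (hy : y ∈ S) (hz : z ∈ S) (ht : t ∈ S) (hzu : z ≠ u) (htu : t ≠ u) (hxy : x ≠ y)
    (hn : G.nbrs (S ∪ P) u = {x, y}) (hun : G.nes (S ∪ P) u = 2) (hK : G.NegK4Via u x y z t) :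
    False := by
  have hSX : ∀ {v}, v ∈ S → v ∈ S ∪ P := fun hv => Finset.mem_union_left _ hv
  have sux : G.sg u x ≠ 0 := (mem_nbrs.1 (by simp [hn] : x ∈ G.nbrs (S ∪ P) u)).2
  have suy : G.sg u y ≠ 0 := (mem_nbrs.1 (by simp [hn] : y ∈ G.nbrs (S ∪ P) u)).2
  have sxu : G.sg x u ≠ 0 := by rwa [G.sg_symm]
  have syu : G.sg y u ≠ 0 := by rwa [G.sg_symm]
  have hux := ne_of_sg sux
  have huy := ne_of_sg suy
  have hxz := ne_of_sg hK.1.ne_zero12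
  have hxt := ne_of_sg hK.1.ne_zero13
  have hyz := ne_of_sg hK.2.1.ne_zero12
  have hyt := ne_of_sg hK.2.1.ne_zero13
  have hzt := ne_of_sg hK.1.ne_zero23
  have szx := hK.1.swap12.ne_zero12
  have szy := hK.2.1.swap12.ne_zero12
  have stx := hK.1.swap23.swap12.ne_zero12
  have sty := hK.2.1.swap23.swap12.ne_zero12
  have stz : G.sg t z ≠ 0 := by rw [G.sg_symm]; exact hK.1.ne_zero23
  have cubic : ∀ {v a b c : V}, v ∈ S → a ∈ S → b ∈ S → c ∈ S → a ≠ b → a ≠ c → b ≠ c →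
      G.sg v a ≠ 0 → G.sg v b ≠ 0 → G.sg v c ≠ 0 →
      G.nbrs (S ∪ P) v = {a, b, c} ∧ G.nes (S ∪ P) v = 0 := by
    intro v a b c hv ha hb hc hab hac hbc sa sb sc
    have hsub : ({a, b, c} : Finset V) ⊆ G.nbrs (S ∪ P) v := by
      intro w hw
      simp only [Finset.mem_insert, Finset.mem_singleton] at hw
      rcases hw with rfl | rfl | rfl
      · exact mem_nbrs.2 ⟨hSX ha, sa⟩
      · exact mem_nbrs.2 ⟨hSX hb, sb⟩
      · exact mem_nbrs.2 ⟨hSX hc, sc⟩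
    have h3 := Finset.card_le_card hsub
    have h3' : ({a, b, c} : Finset V).card = 3 :=
      Finset.card_eq_three.2 ⟨a, b, c, hab, hac, hbc, rfl⟩
    rcases h.tight.2 v hv with ⟨c2, -⟩ | ⟨c3, c0⟩
    · omega
    · exact ⟨(Finset.eq_of_subset_of_card_le hsub (by omega)).symm, c0⟩
  obtain ⟨nx, ex⟩ := cubic hx hu hz ht hzu.symm htu.symm hzt sxu hK.1.ne_zero12 hK.1.ne_zero13
  obtain ⟨ny, ey⟩ := cubic hy hu hz ht hzu.symm htu.symm hzt syu hK.2.1.ne_zero12 hK.2.1.ne_zero13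
  obtain ⟨nz, ez⟩ := cubic hz hx hy ht hxy hxt hyt szx szy hK.1.ne_zero23
  obtain ⟨nt, et⟩ := cubic ht hx hy hz hxy hxz hyz stx sty stz
  set T : Finset V := {u, x, y, z, t} with hTdef
  have hT : T ⊆ S := by
    intro v hv
    simp only [hTdef, Finset.mem_insert, Finset.mem_singleton] at hv
    rcases hv with rfl | rfl | rfl | rfl | rfl <;> assumption
  have hd := h.disjoint_rest hT
  obtain ⟨f, hfg, hf⟩ := h.sub_extends (Finset.sdiff_ssubset hT ⟨u, by simp [hTdef]⟩)
  obtain ⟨C, -, hC⟩ := exists_notMem_of_card (A := Finset.univ) (B := G.forb (S \ T ∪ P) f u) (by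
    have := forb_card_le_of_subset (G := G) (P := P) (Finset.sdiff_subset (s := S) (t := T)) f u
    rw [Finset.card_univ, ZMod.card]; omega)
  obtain ⟨s, hs⟩ : ∃ s, C = s + shift (G.sg x z) + shift (G.sg u x) + (-1) :=
    ⟨C - shift (G.sg x z) - shift (G.sg u x) + 1, by ring⟩
  set c : V → ZMod 10 := fun v => if v = u then C else if v = x then s + shift (G.sg x z) + 1 else
    if v = y then s + shift (G.sg y z) + 2 else if v = z then s else s + shift (G.sg t z) + (-2)
    with hc
  have cu : c u = C := by simp [hc]
  have cx : c x = s + shift (G.sg x z) + 1 := by simp [hc, hux.symm]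
  have cy : c y = s + shift (G.sg y z) + 2 := by simp [hc, huy.symm, hxy.symm]
  have cz : c z = s := by simp [hc, hzu, hxz.symm, hyz.symm]
  have ct : c t = s + shift (G.sg t z) + (-2) := by simp [hc, htu, hxt.symm, hyt.symm, hzt.symm]
  have ze : ∀ {v : V}, G.nbrs (S ∪ P) v ⊆ T → ∀ w ∈ S \ T ∪ P, G.sg v w = 0 := fun hv =>
    sg_eq_zero_of_nbrs hv (rest_subset (S := S) (P := P) (T := T)) hd
  have far : ∀ {v : V}, G.nbrs (S ∪ P) v ⊆ T → G.nes (S ∪ P) v = 0 → ∀ w ∈ S \ T ∪ P,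
      G.Compat v w (c v - f w) := fun hv he w hw =>
    compat_of_not (ze hv w hw) (ne_eq_empty_of_nes (rest_subset hw) he)
  refine h.no_extend hT hfg hf c ?_ ?_
  · intro v hv w hw
    simp only [hTdef, Finset.mem_insert, Finset.mem_singleton] at hv
    rcases hv with rfl | rfl | rfl | rfl | rfl
    · rw [cu]
      exact compat_of_disjoint_nbrs (ze (by rw [hn, hTdef]; intro a; simp; tauto)) hC w hw
    · exact far (by rw [nx, hTdef]; intro a; simp; tauto) ex w hw
    · exact far (by rw [ny, hTdef]; intro a; simp; tauto) ey w hw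
    · exact far (by rw [nz, hTdef]; intro a; simp; tauto) ez w hw
    · exact far (by rw [nt, hTdef]; intro a; simp; tauto) et w hw
  · have em : ∀ {a b : V}, G.nes (S ∪ P) a = 0 → b ∈ S → G.ne a b = ∅ := fun h0 hb =>
      ne_eq_empty_of_nes (hSX hb) h0
    have em' : ∀ {a b : V}, G.nes (S ∪ P) a = 0 → b ∈ S → G.ne b a = ∅ := fun h0 hb => by
      rw [G.ne_symm]; exact em h0 hb
    have mk : ∀ {a b : V}, near (c a - c b - shift (G.sg a b)) → G.ne a b = ∅ →
        G.Compat a b (c a - c b) := fun h1 h2 => ⟨fun _ => h1, by simp [h2]⟩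
    have p1 : G.Compat u x (c u - c x) := mk (by
      rw [cu, cx, hs]; convert (by decide : near (-2)) using 1; ring) (em' ex hu)
    have p2 : G.Compat u y (c u - c y) := mk (by
      rw [cu, cy, hs, hK.sub_eq]; decide) (em' ey hu)
    have p3 : G.Compat x z (c x - c z) := mk (by
      rw [cx, cz]; convert (by decide : near 1) using 1; ring) (em ex hz)
    have p4 : G.Compat y z (c y - c z) := mk (by
      rw [cy, cz]; convert (by decide : near 2) using 1; ring) (em ey hz)
    have p5 : G.Compat t z (c t - c z) := mk (by
      rw [ct, cz]; convert (by decide : near (-2)) using 1; ring) (em et hz)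
    have p6 : G.Compat x t (c x - c t) := mk (by
      rw [cx, ct, hK.1.sub_eq]; decide) (em ex ht)
    have p7 : G.Compat y t (c y - c t) := mk (by
      rw [cy, ct, hK.2.1.sub_eq]; decide) (em ey ht)
    have no : ∀ {a b : V}, b ∈ S → b ∉ G.nbrs (S ∪ P) a → G.sg a b = 0 := fun hb hn => by
      by_contra h0
      exact hn (mem_nbrs.2 ⟨hSX hb, h0⟩)
    have p8 : G.Compat z u (c z - c u) := compat_of_not (no hu (by
      rw [nz]; simp [hux, huy, htu.symm])) (em ez hu)
    have p9 : G.Compat t u (c t - c u) := compat_of_not (no hu (by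
      rw [nt]; simp [hux, huy, hzu.symm])) (em et hu)
    have p10 : G.Compat x y (c x - c y) := compat_of_not (no hy (by
      rw [nx]; simp [huy.symm, hyz, hyt])) (em ex hy)
    intro v hv w hw
    simp only [hTdef, Finset.mem_insert, Finset.mem_singleton] at hv hw
    rcases hv with rfl | rfl | rfl | rfl | rfl <;> rcases hw with rfl | rfl | rfl | rfl | rfl <;>
      first | exact compat_self | assumption | (apply compat_comm; assumption)

/-- All free vertices of a minimal counterexample are cubic. -/
theorem cubic (h : Extremal G S P g) {u : V} (hu : u ∈ S) :
    (G.nbrs (S ∪ P) u).card = 3 ∧ G.nes (S ∪ P) u = 0 := by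
  rcases h.tight.2 u hu with ⟨hu2, hun⟩ | h3
  swap
  · exact h3
  exfalso
  obtain ⟨x, y, hxy, hn⟩ := Finset.card_eq_two.1 hu2
  obtain ⟨hx, hy, hN | ⟨z, hz, t, ht, hzu, htu, hK⟩⟩ := h.blocked hu hxy hn (by omega) hun.le
  · rcases h.tight.2 x hx with ⟨hx2, hxn⟩ | ⟨hx3, hxn⟩
    · exact h.not_neg_two_two hu hx hy hN hu2 hun hx2 hxn
    · rcases h.tight.2 y hy with ⟨hy2, hyn⟩ | ⟨hy3, hyn⟩
      · exact h.not_neg_two_two hu hy hx hN.swap23 hu2 hun hy2 hyn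
      · exact h.not_neg_two_three hu hx hy hN hu2 hun hx3 hxn hy3 hyn
  · exact h.not_negK4Via_two hu hx hy hz ht hzu htu hxy hn hun hK

end Extremal
/-! ### Short cycles in cubic graphs -/

section Colors

set_option synthInstance.maxHeartbeats 400000
set_option synthInstance.maxSize 2000

theorem exists_near_triangle (b c : ZMod 10) : ∃ p, near p ∧ ∃ q, near (q - b) ∧ near (p - q) ∧
    ∃ r, near (r - c) ∧ near (p - r) ∧ near (q - r) := by
  revert b c; decide +kernel

theorem exists_two_triangles (c d : ZMod 10) : ∃ s q, near q ∧ ∃ r, near r ∧ near (q - r - 5) ∧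
    near (s + r - c) ∧ ∃ w, near w ∧ near (q - w - 5) ∧ near (s + w - d) := by
  revert c d; decide +kernel

theorem exists_negative_four_cycle (b c d : ZMod 10) : ∃ p, near p ∧ ∃ q, near (q - b) ∧
    near (p - q) ∧ ∃ r, near (r - c) ∧ near (q - r) ∧ ∃ t, near (t - d) ∧ near (r - t) ∧
      near (t - p - 5) := by
  revert b c d; decide +kernel

theorem exists_negative_triangle {b : ZMod 10} (h : near b) (c : ZMod 10) : ∃ p, near p ∧
    ∃ q, near (q - b) ∧ near (p - q) ∧ ∃ r, near (r - c) ∧ near (p - r) ∧ near (q - r - 5) := by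
  revert b c; decide +kernel

theorem exists_excluded_three_aux {d : ZMod 10} (h : near d) : ∃ b : ZMod 10, ∀ c, c ≠ b →
    c ≠ b + 1 → c ≠ b + 2 → ∃ w, near w ∧ near (w - d) ∧ near (c - w) := by
  revert d; decide +kernel

end Colors

/-- A vertex with two given neighbours whose colours are near each other excludes at most three
colours of a third neighbour. -/
theorem exists_excluded_three {a d : ZMod 10} (h : near (d - a)) (s : ZMod 10) :
    ∃ b : ZMod 10, ∀ c, c ≠ b → c ≠ b + 1 → c ≠ b + 2 →
      ∃ w, near (w - a) ∧ near (w - d) ∧ near (c - w - s) := by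
  obtain ⟨b, hb⟩ := exists_excluded_three_aux h
  refine ⟨b + a + s, fun c h1 h2 h3 => ?_⟩
  obtain ⟨w, h4, h5, h6⟩ := hb (c - a - s) (fun h => h1 (by linear_combination h))
    (fun h => h2 (by linear_combination h)) (fun h => h3 (by linear_combination h))
  refine ⟨w + a, ?_, ?_, ?_⟩
  · convert h4 using 1; ring
  · convert h5 using 1; ring
  · convert h6 using 1; ring

theorem shift_quad {a b c d : SignType} (h : a * b * c * d = -1) :
    shift a + shift b + shift c + shift d = 5 := by
  revert a b c d; decide

theorem sign_triangle {a b c : SignType} (ha : a ≠ 0) (hb : b ≠ 0) (hc : c ≠ 0) :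
    a * b * c = 1 ∨ a * b * c = -1 := by
  revert a b c; decide

/-- A chord splits a negative four-cycle into two triangles, one of which is positive. -/
theorem sign_chord {a b c d e : SignType} (h : a * b * c * d = -1) (he : e ≠ 0) :
    a * b * e = 1 ∨ c * d * e = 1 := by
  revert a b c d e; decide

namespace Extremal

variable {S P : Finset V} {g : V → ZMod 10}

theorem mem_of_sg (h : Extremal G S P g) {u v : V} (hu : u ∈ S) (hv : v ∈ S ∪ P)
    (h0 : G.sg u v ≠ 0) : v ∈ S :=
  h.mem_of_mem_nbrs hu (mem_nbrs.2 ⟨hv, h0⟩)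

/-- The third neighbour of a vertex. -/
theorem third (h : Extremal G S P g) {x a b : V} (hx : x ∈ S) (ha : a ∈ S) (hb : b ∈ S)
    (hxa : G.sg x a ≠ 0) (hxb : G.sg x b ≠ 0) (hab : a ≠ b) :
    ∃ c ∈ S, c ≠ a ∧ c ≠ b ∧ G.sg x c ≠ 0 ∧ ∀ v ∈ S, G.sg x v ≠ 0 → v = a ∨ v = b ∨ v = c := by
  obtain ⟨c, hca, hcb, hn⟩ := exists_third (h.cubic hx).1
    (mem_nbrs.2 ⟨Finset.mem_union_left _ ha, hxa⟩) (mem_nbrs.2 ⟨Finset.mem_union_left _ hb, hxb⟩)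
    hab
  have hc : c ∈ G.nbrs (S ∪ P) x := by simp [hn]
  refine ⟨c, h.mem_of_mem_nbrs hx hc, hca, hcb, (mem_nbrs.1 hc).2, fun v hv h0 => ?_⟩
  have : v ∈ G.nbrs (S ∪ P) x := mem_nbrs.2 ⟨Finset.mem_union_left _ hv, h0⟩
  simpa [hn] using this

/-- For cubic vertices only the edges inside `S` matter when a set is coloured last. -/
theorem no_extend_cubic (h : Extremal G S P g) {T : Finset V} (hT : T ⊆ S) {f : V → ZMod 10}
    (hfg : ∀ v ∈ P, f v = g v) (hf : G.Ok (S \ T) P f) (c : V → ZMod 10)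
    (h1 : ∀ u ∈ T, ∀ v ∈ S, v ∉ T → G.sg u v ≠ 0 → near (c u - f v - shift (G.sg u v)))
    (h2 : ∀ u ∈ T, ∀ v ∈ T, G.sg u v ≠ 0 → near (c u - c v - shift (G.sg u v))) : False := by
  have he : ∀ u ∈ T, ∀ v ∈ S ∪ P, G.ne u v = ∅ := fun u hu v hv =>
    ne_eq_empty_of_nes hv (h.cubic (hT hu)).2
  refine h.no_extend hT hfg hf c (fun u hu v hv => ⟨fun h0 => ?_, ?_⟩)
    fun u hu v hv => ⟨h2 u hu v hv, ?_⟩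
  · have hvS := h.mem_of_sg (hT hu) (rest_subset hv) h0
    exact h1 u hu v hvS (Finset.disjoint_right.1 (h.disjoint_rest hT) hv) h0
  · simp [he u hu v (rest_subset hv)]
  · simp [he u hu v (Finset.mem_union_left _ (hT hv))]

theorem near_symm {u v : V} {c : V → ZMod 10} (h : near (c u - c v - shift (G.sg u v))) :
    near (c v - c u - shift (G.sg v u)) := by
  rw [G.sg_symm v u, ← near_neg_sub_shift]
  convert h using 1; ring

/-- A positive triangle can be coloured last. -/
theorem not_positive_triangle (h : Extremal G S P g) {a b c : V} (ha : a ∈ S) (hb : b ∈ S)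
    (hc : c ∈ S) (hN : G.sg a b * G.sg b c * G.sg a c = 1) : False := by
  have sab : G.sg a b ≠ 0 := by intro h0; simp [h0] at hN
  have sbc : G.sg b c ≠ 0 := by intro h0; simp [h0] at hN
  have sac : G.sg a c ≠ 0 := by intro h0; simp [h0] at hN
  have sba : G.sg b a ≠ 0 := by rwa [G.sg_symm]
  have scb : G.sg c b ≠ 0 := by rwa [G.sg_symm]
  have sca : G.sg c a ≠ 0 := by rwa [G.sg_symm]
  have hab := ne_of_sg sab
  have hac := ne_of_sg sac
  have hbc := ne_of_sg sbc
  obtain ⟨a', -, -, -, -, ta⟩ := h.third ha hb hc sab sac hbc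
  obtain ⟨b', -, -, -, -, tb⟩ := h.third hb ha hc sba sbc hac
  obtain ⟨c', -, -, -, -, tc⟩ := h.third hc ha hb sca scb hab
  set T : Finset V := {a, b, c} with hTdef
  have hT : T ⊆ S := by
    intro v hv
    simp only [hTdef, Finset.mem_insert, Finset.mem_singleton] at hv
    rcases hv with rfl | rfl | rfl <;> assumption
  obtain ⟨f, hfg, hf⟩ := h.sub_extends (Finset.sdiff_ssubset hT ⟨a, by simp [hTdef]⟩)
  obtain ⟨p, p1, q, q1, q2, r, r1, r2, r3⟩ := exists_near_triangle
    (f b' + shift (G.sg b b') + shift (G.sg a b) - (f a' + shift (G.sg a a')))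
    (f c' + shift (G.sg c c') + shift (G.sg a c) - (f a' + shift (G.sg a a')))
  set A := f a' + shift (G.sg a a') with hA
  set col : V → ZMod 10 := fun v => if v = a then A + p else if v = b then
    A + q - shift (G.sg a b) else A + r - shift (G.sg a c) with hcol
  have ea : col a = A + p := by simp [hcol]
  have eb : col b = A + q - shift (G.sg a b) := by simp [hcol, hab.symm]
  have ec : col c = A + r - shift (G.sg a c) := by simp [hcol, hac.symm, hbc.symm]
  have nab : near (col a - col b - shift (G.sg a b)) := by
    rw [ea, eb]; convert q2 using 1; ring
  have nac : near (col a - col c - shift (G.sg a c)) := by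
    rw [ea, ec]; convert r2 using 1; ring
  have nbc : near (col b - col c - shift (G.sg b c)) := by
    rw [eb, ec]; convert r3 using 1
    linear_combination shift_add_self (G.sg a c) - shift_triple_one hN
  refine h.no_extend_cubic hT hfg hf col ?_ ?_
  · intro u hu v hv hvT h0
    simp only [hTdef, Finset.mem_insert, Finset.mem_singleton, not_or] at hu hvT
    rcases hu with rfl | rfl | rfl
    · obtain rfl := ((ta v hv h0).resolve_left hvT.2.1).resolve_left hvT.2.2
      rw [ea]; convert p1 using 1; rw [hA]; ring
    · obtain rfl := ((tb v hv h0).resolve_left hvT.1).resolve_left hvT.2.2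
      rw [eb]; convert q1 using 1; ring
    · obtain rfl := ((tc v hv h0).resolve_left hvT.1).resolve_left hvT.2.1
      rw [ec]; convert r1 using 1; ring
  · intro u hu v hv h0
    simp only [hTdef, Finset.mem_insert, Finset.mem_singleton] at hu hv
    rcases hu with rfl | rfl | rfl <;> rcases hv with rfl | rfl | rfl <;>
      first | exact absurd (G.sg_self _) h0 | assumption | (apply near_symm; assumption)

theorem sg_eq_zero_of_not_neg (h : Extremal G S P g) {a b c : V} (ha : a ∈ S) (hb : b ∈ S)
    (hc : c ∈ S) (hab : G.sg a b ≠ 0) (hac : G.sg a c ≠ 0) (hN : ¬ G.Neg a b c) :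
    G.sg b c = 0 := by
  by_contra hbc
  rcases sign_triangle hab hbc hac with h1 | h1
  · exact h.not_positive_triangle ha hb hc h1
  · exact hN h1

/-- Two negative triangles with a common edge can be coloured last. The two other vertices are not
adjacent, since there is neither a positive triangle nor a negative `K_4`. -/
theorem not_two_negative_triangles (h : Extremal G S P g) {a b c d : V} (ha : a ∈ S) (hb : b ∈ S)
    (hc : c ∈ S) (hd : d ∈ S) (hcd : c ≠ d) (h1 : G.Neg a b c) (h2 : G.Neg a b d) : False := by
  have scd : G.sg c d = 0 := by
    by_contra h0
    have n1 : G.Neg a c d := by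
      by_contra hn
      exact h0 (h.sg_eq_zero_of_not_neg ha hc hd h1.ne_zero13 h2.ne_zero13 hn)
    have n2 : G.Neg b c d := by
      by_contra hn
      exact h0 (h.sg_eq_zero_of_not_neg hb hc hd h1.ne_zero23 h2.ne_zero23 hn)
    exact h.k4 a ha b hb c hc d hd ⟨h1, h2, n1, n2⟩
  have sab := h1.ne_zero12
  have sba := h1.swap12.ne_zero12
  have hab := ne_of_sg sab
  have hac := ne_of_sg h1.ne_zero13
  have hbc := ne_of_sg h1.ne_zero23
  have had := ne_of_sg h2.ne_zero13
  have hbd := ne_of_sg h2.ne_zero23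
  have sca := h1.swap23.swap12.ne_zero12
  have scb := h1.swap12.swap23.swap12.ne_zero12
  have sda := h2.swap23.swap12.ne_zero12
  have sdb := h2.swap12.swap23.swap12.ne_zero12
  obtain ⟨a', -, na1, na2, -, ta⟩ := h.third ha hb hc sab h1.ne_zero13 hbc
  obtain ⟨b', -, nb1, nb2, -, tb⟩ := h.third hb ha hc sba h1.ne_zero23 hac
  obtain rfl := ((ta d hd h2.ne_zero13).resolve_left hbd.symm).resolve_left hcd.symm
  obtain rfl := ((tb d hd h2.ne_zero23).resolve_left had.symm).resolve_left hcd.symm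
  obtain ⟨c', -, -, -, -, tc⟩ := h.third hc ha hb sca scb hab
  obtain ⟨d', -, -, -, -, td⟩ := h.third hd ha hb sda sdb hab
  set T : Finset V := {a, b, c, d} with hTdef
  have hT : T ⊆ S := by
    intro v hv
    simp only [hTdef, Finset.mem_insert, Finset.mem_singleton] at hv
    rcases hv with rfl | rfl | rfl | rfl <;> assumption
  obtain ⟨f, hfg, hf⟩ := h.sub_extends (Finset.sdiff_ssubset hT ⟨a, by simp [hTdef]⟩)
  obtain ⟨s, q, q1, r, r1, r2, r3, w, w1, w2, w3⟩ := exists_two_triangles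
    (f c' + shift (G.sg c c') + shift (G.sg a c)) (f d' + shift (G.sg d d') + shift (G.sg a d))
  set col : V → ZMod 10 := fun v => if v = a then s else if v = b then
    s + q + shift (G.sg a b) else if v = c then s + r + shift (G.sg a c) else
    s + w + shift (G.sg a d) with hcol
  have ea : col a = s := by simp [hcol]
  have eb : col b = s + q + shift (G.sg a b) := by simp [hcol, hab.symm]
  have ec : col c = s + r + shift (G.sg a c) := by simp [hcol, hac.symm, hbc.symm]
  have ed : col d = s + w + shift (G.sg a d) := by simp [hcol, had.symm, hbd.symm, hcd.symm]
  have nab : near (col b - col a - shift (G.sg b a)) := by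
    rw [ea, eb, G.sg_symm b a]; convert q1 using 1; ring
  have nac : near (col c - col a - shift (G.sg c a)) := by
    rw [ea, ec, G.sg_symm c a]; convert r1 using 1; ring
  have nad : near (col d - col a - shift (G.sg d a)) := by
    rw [ea, ed, G.sg_symm d a]; convert w1 using 1; ring
  have nbc : near (col b - col c - shift (G.sg b c)) := by
    rw [eb, ec]; convert r2 using 1
    linear_combination shift_add_self (G.sg a b) - shift_triple h1
  have nbd : near (col b - col d - shift (G.sg b d)) := by
    rw [eb, ed]; convert w2 using 1
    linear_combination shift_add_self (G.sg a b) - shift_triple h2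
  have scd' : ¬ G.sg d c ≠ 0 := by rw [G.sg_symm]; simpa using scd
  refine h.no_extend_cubic hT hfg hf col ?_ ?_
  · intro u hu v hv hvT h0
    simp only [hTdef, Finset.mem_insert, Finset.mem_singleton, not_or] at hu hvT
    rcases hu with rfl | rfl | rfl | rfl
    · have := ta v hv h0; tauto
    · have := tb v hv h0; tauto
    · obtain rfl := ((tc v hv h0).resolve_left hvT.1).resolve_left hvT.2.1
      rw [ec]; convert r3 using 1
      linear_combination shift_add_self (G.sg a u)
    · obtain rfl := ((td v hv h0).resolve_left hvT.1).resolve_left hvT.2.1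
      rw [ed]; convert w3 using 1
      linear_combination shift_add_self (G.sg a u)
  · intro u hu v hv h0
    simp only [hTdef, Finset.mem_insert, Finset.mem_singleton] at hu hv
    rcases hu with rfl | rfl | rfl | rfl <;> rcases hv with rfl | rfl | rfl | rfl <;>
      first | exact absurd (G.sg_self _) h0 | exact absurd scd h0 | exact absurd h0 scd' |
        assumption | (apply near_symm; assumption)

/-- A negative four-cycle can be coloured last. A chord would yield a positive triangle. -/
theorem not_negative_four_cycle (h : Extremal G S P g) {a b c d : V} (ha : a ∈ S) (hb : b ∈ S)
    (hc : c ∈ S) (hd : d ∈ S) (hac : a ≠ c) (hbd : b ≠ d)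
    (hN : G.sg a b * G.sg b c * G.sg c d * G.sg d a = -1) : False := by
  have sab : G.sg a b ≠ 0 := by intro h0; simp [h0] at hN
  have sbc : G.sg b c ≠ 0 := by intro h0; simp [h0] at hN
  have scd : G.sg c d ≠ 0 := by intro h0; simp [h0] at hN
  have sda : G.sg d a ≠ 0 := by intro h0; simp [h0] at hN
  have sba : G.sg b a ≠ 0 := by rwa [G.sg_symm]
  have scb : G.sg c b ≠ 0 := by rwa [G.sg_symm]
  have sdc : G.sg d c ≠ 0 := by rwa [G.sg_symm]
  have sad : G.sg a d ≠ 0 := by rwa [G.sg_symm]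
  have hab := ne_of_sg sab
  have hbc := ne_of_sg sbc
  have hcd := ne_of_sg scd
  have hda := ne_of_sg sda
  have sac : G.sg a c = 0 := by
    by_contra h0
    rcases sign_chord hN h0 with h1 | h1
    · exact h.not_positive_triangle ha hb hc h1
    · exact h.not_positive_triangle hc hd ha (by rwa [G.sg_symm c a])
  have sbd : G.sg b d = 0 := by
    by_contra h0
    have hN' : G.sg b c * G.sg c d * G.sg d a * G.sg a b = -1 := by rw [← hN]; ac_rfl
    rcases sign_chord hN' h0 with h1 | h1
    · exact h.not_positive_triangle hb hc hd h1
    · exact h.not_positive_triangle hd ha hb (by rwa [G.sg_symm d b])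
  obtain ⟨a', -, -, -, -, ta⟩ := h.third ha hb hd sab sad hbd
  obtain ⟨b', -, -, -, -, tb⟩ := h.third hb ha hc sba sbc hac
  obtain ⟨c', -, -, -, -, tc⟩ := h.third hc hb hd scb scd hbd
  obtain ⟨d', -, -, -, -, td⟩ := h.third hd ha hc sda sdc hac
  set T : Finset V := {a, b, c, d} with hTdef
  have hT : T ⊆ S := by
    intro v hv
    simp only [hTdef, Finset.mem_insert, Finset.mem_singleton] at hv
    rcases hv with rfl | rfl | rfl | rfl <;> assumption
  obtain ⟨f, hfg, hf⟩ := h.sub_extends (Finset.sdiff_ssubset hT ⟨a, by simp [hTdef]⟩)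
  obtain ⟨p, p1, q, q1, q2, r, r1, r2, t, t1, t2, t3⟩ := exists_negative_four_cycle
    (f b' + shift (G.sg b b') + shift (G.sg a b) - (f a' + shift (G.sg a a')))
    (f c' + shift (G.sg c c') + shift (G.sg a b) + shift (G.sg b c) -
      (f a' + shift (G.sg a a')))
    (f d' + shift (G.sg d d') + shift (G.sg a b) + shift (G.sg b c) + shift (G.sg c d) -
      (f a' + shift (G.sg a a')))
  set A := f a' + shift (G.sg a a') with hA
  set col : V → ZMod 10 := fun v => if v = a then A + p else if v = b then
    A + q - shift (G.sg a b) else if v = c then A + r - shift (G.sg a b) - shift (G.sg b c) else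
    A + t - shift (G.sg a b) - shift (G.sg b c) - shift (G.sg c d) with hcol
  have ea : col a = A + p := by simp [hcol]
  have eb : col b = A + q - shift (G.sg a b) := by simp [hcol, hab.symm]
  have ec : col c = A + r - shift (G.sg a b) - shift (G.sg b c) := by
    simp [hcol, hac.symm, hbc.symm]
  have ed : col d = A + t - shift (G.sg a b) - shift (G.sg b c) - shift (G.sg c d) := by
    simp [hcol, hda, hbd.symm, hcd.symm]
  have nab : near (col a - col b - shift (G.sg a b)) := by
    rw [ea, eb]; convert q2 using 1; ring
  have nbc : near (col b - col c - shift (G.sg b c)) := by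
    rw [eb, ec]; convert r2 using 1; ring
  have ncd : near (col c - col d - shift (G.sg c d)) := by
    rw [ec, ed]; convert t2 using 1; ring
  have nda : near (col d - col a - shift (G.sg d a)) := by
    rw [ed, ea]; convert t3 using 1
    linear_combination -shift_quad hN
  have sac' : ¬ G.sg c a ≠ 0 := by rw [G.sg_symm]; simpa using sac
  have sbd' : ¬ G.sg d b ≠ 0 := by rw [G.sg_symm]; simpa using sbd
  refine h.no_extend_cubic hT hfg hf col ?_ ?_
  · intro u hu v hv hvT h0
    simp only [hTdef, Finset.mem_insert, Finset.mem_singleton, not_or] at hu hvT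
    rcases hu with rfl | rfl | rfl | rfl
    · obtain rfl := ((ta v hv h0).resolve_left hvT.2.1).resolve_left hvT.2.2.2
      rw [ea]; convert p1 using 1; rw [hA]; ring
    · obtain rfl := ((tb v hv h0).resolve_left hvT.1).resolve_left hvT.2.2.1
      rw [eb]; convert q1 using 1; ring
    · obtain rfl := ((tc v hv h0).resolve_left hvT.2.1).resolve_left hvT.2.2.2
      rw [ec]; convert r1 using 1; ring
    · obtain rfl := ((td v hv h0).resolve_left hvT.1).resolve_left hvT.2.2.1
      rw [ed]; convert t1 using 1; ring
  · intro u hu v hv h0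
    simp only [hTdef, Finset.mem_insert, Finset.mem_singleton] at hu hv
    rcases hu with rfl | rfl | rfl | rfl <;> rcases hv with rfl | rfl | rfl | rfl <;>
      first | exact absurd (G.sg_self _) h0 | exact absurd sac h0 | exact absurd sbd h0 |
        exact absurd h0 sac' | exact absurd h0 sbd' |
        assumption | (apply near_symm; assumption)

end Extremal
/-! ### Cubic graphs without short cycles -/

theorem pot_insert_le {P F : Finset V} {u x y : V} (hu : u ∉ F) (hd : Disjoint F P) (hxy : x ≠ y)
    (hx : x ∈ F) (hy : y ∈ F) (hux : G.sg u x ≠ 0) (huy : G.sg u y ≠ 0) :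
    G.pot P (insert u F) + 2 ≤ G.pot P F := by
  have h1 := pot_insert (G := G) hu hd
  have h2 := four_le_wts (G := G) (A := F ∪ P) hxy (Finset.mem_union_left _ hx)
    (Finset.mem_union_left _ hy) hux huy
  linarith

theorem pot_insert_three_le {P F : Finset V} {u x y z : V} (hu : u ∉ F) (hd : Disjoint F P)
    (hxy : x ≠ y) (hxz : x ≠ z) (hyz : y ≠ z) (hx : x ∈ F) (hy : y ∈ F) (hz : z ∈ F)
    (hux : G.sg u x ≠ 0) (huy : G.sg u y ≠ 0) (huz : G.sg u z ≠ 0) :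
    G.pot P (insert u F) + 6 ≤ G.pot P F := by
  have h1 := pot_insert (G := G) hu hd
  have hsub : ({x, y, z} : Finset V) ⊆ F ∪ P := by
    intro w hw
    simp only [Finset.mem_insert, Finset.mem_singleton] at hw
    rcases hw with rfl | rfl | rfl <;> exact Finset.mem_union_left _ ‹_›
  have h2 := wts_mono_right (G := G) (A := {u}) hsub
  have h3 : G.wts {u} {x, y, z} = G.wt u x + (G.wt u y + G.wt u z) := by
    rw [wts_singleton, Finset.sum_insert (by simp [hxy, hxz]), Finset.sum_pair hyz]
  have := two_le_wt hux
  have := two_le_wt huy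
  have := two_le_wt huz
  linarith

namespace Extremal

variable {S P : Finset V} {g : V → ZMod 10}

/-- After the deletion of a negative triangle `a b c` the third neighbours of `a` and `b` are joined
by the edge that replaces the path through `a b`. With this edge, a colouring of the remaining graph
extends to the triangle. -/
theorem not_negative_triangle (h : Extremal G S P g) {a b c : V} (ha : a ∈ S) (hb : b ∈ S)
    (hc : c ∈ S) (hN : G.Neg a b c) : False := by
  have sab := hN.ne_zero12
  have sac := hN.ne_zero13
  have sbc := hN.ne_zero23
  have sba := hN.swap12.ne_zero12
  have sca := hN.swap23.swap12.ne_zero12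
  have scb := hN.swap12.swap23.swap12.ne_zero12
  have hab := ne_of_sg sab
  have hac := ne_of_sg sac
  have hbc := ne_of_sg sbc
  obtain ⟨a', ha', na1, na2, saa, ta⟩ := h.third ha hb hc sab sac hbc
  obtain ⟨b', hb', nb1, nb2, sbb, tb⟩ := h.third hb ha hc sba sbc hac
  obtain ⟨c', hc', nc1, nc2, scc, tc⟩ := h.third hc ha hb sca scb hab
  have naa := ne_of_sg saa
  have nbb := ne_of_sg sbb
  have sa'a : G.sg a' a ≠ 0 := by rwa [G.sg_symm]
  have hab' : a' ≠ b' := by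
    rintro rfl
    rcases sign_triangle sab sbb saa with h1 | h1
    · exact h.not_positive_triangle ha hb ha' h1
    · exact h.not_two_negative_triangles ha hb hc ha' na2.symm hN h1
  set s := G.sg a a' * G.sg a b * G.sg b b' with hs
  have hs0 : G.sg a' b' = 0 ∨ G.sg a' b' = s := by
    by_contra hcon
    push Not at hcon
    refine h.not_negative_four_cycle ha' ha hb hb' na1 nb1.symm ?_
    have key : ∀ s t : SignType, s ≠ 0 → t ≠ 0 → t ≠ s → s * t = -1 := by decide
    rw [G.sg_symm a' a, G.sg_symm b' a', ← hs]
    exact key _ _ (mul_ne_zero (mul_ne_zero saa sab) sbb) hcon.1 hcon.2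
  set T : Finset V := {a, b, c} with hTdef
  have hT : T ⊆ S := by
    intro v hv
    simp only [hTdef, Finset.mem_insert, Finset.mem_singleton] at hv
    rcases hv with rfl | rfl | rfl <;> assumption
  have hST := Finset.sdiff_ssubset hT ⟨a, by simp [hTdef]⟩
  have hpot : ∀ F ⊆ S \ T, a' ∈ F → b' ∈ F → 4 ≤ G.pot P F := by
    intro F hF haF hbF
    have hFS : F ⊆ S := hF.trans Finset.sdiff_subset
    have hdis : ∀ {F'}, F' ⊆ S → Disjoint F' P := fun hF' => h.disj.mono_left hF'
    have hnot : ∀ v ∈ T, v ∉ F := fun v hv hvF => (Finset.mem_sdiff.1 (hF hvF)).2 hv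
    have naF := hnot a (by simp [hTdef])
    have nbF := hnot b (by simp [hTdef])
    have ncF := hnot c (by simp [hTdef])
    have e1 := pot_insert (G := G) naF (hdis hFS)
    have e1' := (two_le_wt saa).trans (wt_le_wts (Finset.mem_union_left P haF))
    have s1 : insert a F ⊆ S := Finset.insert_subset ha hFS
    have e2 := pot_insert_le (G := G) (u := b) (F := insert a F) (x := a) (y := b')
      (by simp [hab.symm, nbF]) (hdis s1) nb1.symm (by simp) (by simp [hbF]) sba sbb
    have s2 : insert b (insert a F) ⊆ S := Finset.insert_subset hb s1
    have s3 : insert c (insert b (insert a F)) ⊆ S := Finset.insert_subset hc s2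
    have nc3 : c ∉ insert b (insert a F) := by simp [hac.symm, hbc.symm, ncF]
    by_cases hcF : c' ∈ F
    · have e3 := pot_insert_three_le (G := G) (x := a) (y := b) (z := c') nc3 (hdis s2) hab
        nc1.symm nc2.symm (by simp) (by simp) (by simp [hcF]) sca scb scc
      have := h.pot_nonneg _ s3 ⟨c, by simp⟩
      linarith
    · have e3 := pot_insert_le (G := G) (x := a) (y := b) nc3 (hdis s2) hab
        (by simp) (by simp) sca scb
      have hss : insert c (insert b (insert a F)) ⊂ S := by
        refine s3.ssubset_of_ne fun he => ?_
        rw [← he] at hc'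
        simp only [Finset.mem_insert] at hc'
        have := ne_of_sg scc
        tauto
      have := h.two_le_pot hss ⟨c, by simp⟩
      linarith
  obtain ⟨f, hfg, hf⟩ := h.extends_of_ssubset (G' := G.addEdge a' b' hab' s) hST (fun F hF hFn => by
      have hFS := hF.trans hST.subset
      have hd := h.disj.mono_left hFS
      have h1 := pot_addEdge (G := G) hab' s hd
      by_cases hm : a' ∈ F ∧ b' ∈ F
      · have := hpot F hF hm.1 hm.2
        linarith [h1.1]
      · have := h.pot_nonneg F hFS hFn
        have h2 := h1.2 (by
          have ha2 := h.notMem_P ha'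
          have hb2 := h.notMem_P hb'
          simp only [Finset.mem_union]
          tauto)
        linarith) (by
      by_contra hK
      obtain ⟨-, -, z, hz, t, ht, h1, h2, -, -⟩ :=
        exists_of_not_negK4Free_addEdge (h.k4.mono hST.subset) hK
      exact h.not_two_negative_triangles (hST.subset hz) (hST.subset ht) ha' hb' hab'
        h1.swap12.swap23 h2.swap12.swap23)
  have nT : ∀ v, v ∉ T ↔ v ≠ a ∧ v ≠ b ∧ v ≠ c := by simp [hTdef]
  have ma : a' ∈ S \ T := Finset.mem_sdiff.2 ⟨ha', (nT _).2 ⟨naa.symm, na1, na2⟩⟩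
  have mb : b' ∈ S \ T := Finset.mem_sdiff.2 ⟨hb', (nT _).2 ⟨nb1, nbb.symm, nb2⟩⟩
  have hs1 : s ≠ 0 := mul_ne_zero (mul_ne_zero saa sab) sbb
  have hnear : near (f b' + shift (G.sg b b') + shift (G.sg a b) -
      (f a' + shift (G.sg a a'))) := by
    have h1 := hf.near ma (Finset.mem_union_left _ mb) (by rwa [addEdge_sg_self])
    rw [addEdge_sg_self, hs, shift_mul (by rwa [← hs]), shift_mul (mul_ne_zero saa sab)] at h1
    rw [← near_neg]
    convert h1 using 1
    linear_combination shift_add_self (G.sg a a')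
  obtain ⟨p, p1, q, q1, q2, r, r1, r2, r3⟩ := exists_negative_triangle hnear
    (f c' + shift (G.sg c c') + shift (G.sg a c) - (f a' + shift (G.sg a a')))
  set A := f a' + shift (G.sg a a') with hA
  set col : V → ZMod 10 := fun v => if v = a then A + p else if v = b then
    A + q - shift (G.sg a b) else A + r - shift (G.sg a c) with hcol
  have ea : col a = A + p := by simp [hcol]
  have eb : col b = A + q - shift (G.sg a b) := by simp [hcol, hab.symm]
  have ec : col c = A + r - shift (G.sg a c) := by simp [hcol, hac.symm, hbc.symm]
  have nab : near (col a - col b - shift (G.sg a b)) := by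
    rw [ea, eb]; convert q2 using 1; ring
  have nac : near (col a - col c - shift (G.sg a c)) := by
    rw [ea, ec]; convert r2 using 1; ring
  have nbc : near (col b - col c - shift (G.sg b c)) := by
    rw [eb, ec]; convert r3 using 1
    linear_combination shift_add_self (G.sg a c) - shift_triple hN
  refine h.no_extend_cubic hT hfg (hf.of_addEdge hs0) col ?_ ?_
  · intro u hu v hv hvT h0
    rw [nT] at hvT
    simp only [hTdef, Finset.mem_insert, Finset.mem_singleton] at hu
    rcases hu with rfl | rfl | rfl
    · obtain rfl := ((ta v hv h0).resolve_left hvT.2.1).resolve_left hvT.2.2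
      rw [ea]; convert p1 using 1; rw [hA]; ring
    · obtain rfl := ((tb v hv h0).resolve_left hvT.1).resolve_left hvT.2.2
      rw [eb]; convert q1 using 1; ring
    · obtain rfl := ((tc v hv h0).resolve_left hvT.1).resolve_left hvT.2.1
      rw [ec]; convert r1 using 1; ring
  · intro u hu v hv h0
    simp only [hTdef, Finset.mem_insert, Finset.mem_singleton] at hu hv
    rcases hu with rfl | rfl | rfl <;> rcases hv with rfl | rfl | rfl <;>
      first | exact absurd (G.sg_self _) h0 | assumption | (apply near_symm; assumption)

theorem sg_eq_zero_of_common (h : Extremal G S P g) {a b c : V} (ha : a ∈ S) (hb : b ∈ S)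
    (hc : c ∈ S) (hab : G.sg a b ≠ 0) (hac : G.sg a c ≠ 0) : G.sg b c = 0 :=
  h.sg_eq_zero_of_not_neg ha hb hc hab hac (h.not_negative_triangle ha hb hc)

end Extremal
theorem addEdge_sg {x y : V} (hxy : x ≠ y) (a : SignType) (u v : V) :
    (G.addEdge x y hxy a).sg u v = if s(u, v) = s(x, y) then a else G.sg u v := by
  simp only [addEdge, Sym2.eq_iff]

/-- If at most three pairs are exceptional and every negative triangle has two exceptional sides,
there is no negative `K_4`: at least four of its six sides would be exceptional. -/
theorem negK4Free_of_card_le_three {S : Finset V} {N : Finset (Sym2 V)} (hN : N.card ≤ 3)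
    (h : ∀ p ∈ S, ∀ q ∈ S, ∀ r ∈ S, G.Neg p q r → s(p, q) ∈ N ∨ s(p, r) ∈ N) :
    G.NegK4Free S := by
  rintro p hp q hq r hr s hs ⟨h1, h2, h3, h4⟩
  have hpq := ne_of_sg h1.ne_zero12
  have hpr := ne_of_sg h1.ne_zero13
  have hqr := ne_of_sg h1.ne_zero23
  have hps := ne_of_sg h2.ne_zero13
  have hqs := ne_of_sg h2.ne_zero23
  have hrs := ne_of_sg h3.ne_zero23
  have four : ∀ a b c d : Sym2 V, a ≠ b → a ≠ c → a ≠ d → b ≠ c → b ≠ d → c ≠ d →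
      a ∈ N → b ∈ N → c ∈ N → d ∈ N → False := by
    intro a b c d hab hac had hbc hbd hcd ha hb hc hd
    have hsub : ({a, b, c, d} : Finset (Sym2 V)) ⊆ N := by
      intro z hz
      simp only [Finset.mem_insert, Finset.mem_singleton] at hz
      rcases hz with rfl | rfl | rfl | rfl <;> assumption
    have := Finset.card_le_card hsub
    rw [Finset.card_insert_of_notMem (by simp [hab, hac, had]),
      Finset.card_insert_of_notMem (by simp [hbc, hbd]), Finset.card_pair hcd] at this
    omega
  have ds : ∀ {a b c d : V}, b ≠ c → b ≠ d → s(a, b) ≠ s(c, d) := by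
    intro a b c d h1 h2 he
    rcases Sym2.eq_iff.1 he with ⟨-, h⟩ | ⟨-, h⟩
    exacts [h2 h, h1 h]
  have ds' : ∀ {a b c d : V}, a ≠ c → a ≠ d → s(a, b) ≠ s(c, d) := by
    intro a b c d h1 h2 he
    rcases Sym2.eq_iff.1 he with ⟨h, -⟩ | ⟨h, -⟩
    exacts [h1 h, h2 h]
  have t1 := h p hp q hq r hr h1
  have t2 := h q hq p hp r hr h1.swap12
  have t3 := h r hr p hp q hq h1.swap23.swap12
  have t4 := h p hp q hq s hs h2
  have t5 := h q hq p hp s hs h2.swap12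
  have t6 := h s hs p hp q hq h2.swap23.swap12
  have t7 := h p hp r hr s hs h3
  have t8 := h r hr p hp s hs h3.swap12
  have t9 := h s hs p hp r hr h3.swap23.swap12
  have t10 := h q hq r hr s hs h4
  have t11 := h r hr q hq s hs h4.swap12
  have t12 := h s hs q hq r hr h4.swap23.swap12
  rw [Sym2.eq_swap (a := q) (b := p)] at t2 t5
  rw [Sym2.eq_swap (a := r) (b := p)] at t3 t8
  rw [Sym2.eq_swap (a := r) (b := q)] at t3 t11
  rw [Sym2.eq_swap (a := s) (b := p)] at t6 t9
  rw [Sym2.eq_swap (a := s) (b := q)] at t6 t12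
  rw [Sym2.eq_swap (a := s) (b := r)] at t9 t12
  have d1 : s(p, q) ≠ s(p, r) := ds hpq.symm hqr
  have d2 : s(p, q) ≠ s(q, r) := ds' hpq hpr
  have d3 : s(p, r) ≠ s(q, r) := ds' hpq hpr
  have d4 : s(p, q) ≠ s(p, s) := ds hpq.symm hqs
  have d5 : s(p, q) ≠ s(q, s) := ds' hpq hps
  have d6 : s(p, q) ≠ s(r, s) := ds' hpr hps
  have d7 : s(p, r) ≠ s(p, s) := ds hpr.symm hrs
  have d8 : s(p, r) ≠ s(q, s) := ds' hpq hps
  have d9 : s(p, r) ≠ s(r, s) := ds' hpr hps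
  have d10 : s(q, r) ≠ s(p, s) := ds' hpq.symm hqs
  have d11 : s(q, r) ≠ s(q, s) := ds hqr.symm hrs
  have d12 : s(p, s) ≠ s(q, s) := ds' hpq hps
  have d13 : s(p, s) ≠ s(r, s) := ds' hpr hps
  have d14 : s(q, s) ≠ s(r, s) := ds' hqr hqs
  have d15 : s(q, r) ≠ s(r, s) := ds' hqr hqs
  by_cases hpqN : s(p, q) ∈ N
  · by_cases hprN : s(p, r) ∈ N
    · by_cases hqrN : s(q, r) ∈ N
      · by_cases hpsN : s(p, s) ∈ N
        · exact four _ _ _ _ d1 d2 d4 d3 d7 d10 hpqN hprN hqrN hpsN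
        · exact four _ _ _ _ d1 d2 d5 d3 d8 d11 hpqN hprN hqrN (t6.resolve_left hpsN)
      · exact four _ _ _ _ d1 d5 d6 d8 d9 d14 hpqN hprN
          (t10.resolve_left hqrN) (t11.resolve_left hqrN)
    · exact four _ _ _ _ d2 d4 d6 d10 d15 d13 hpqN
        (t3.resolve_left hprN) (t7.resolve_left hprN) (t8.resolve_left hprN)
  · exact four _ _ _ _ d3 d7 d8 d10 d11 d12 (t1.resolve_left hpqN) (t2.resolve_left hpqN)
      (t4.resolve_left hpqN) (t5.resolve_left hpqN)

/-- The vertex `v` of `S` is joined to `c`, `x`, `y` and to no other vertex of `S`. -/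
structure Arm (G : CGraph V) (S : Finset V) (c v x y : V) : Prop where
  mem : v ∈ S
  mem_x : x ∈ S
  mem_y : y ∈ S
  ne_xy : x ≠ y
  sg_c : G.sg c v ≠ 0
  sg_x : G.sg v x ≠ 0
  sg_y : G.sg v y ≠ 0
  eq_of_sg : ∀ w ∈ S, G.sg v w ≠ 0 → w = c ∨ w = x ∨ w = y

namespace Extremal

variable {S P : Finset V} {g : V → ZMod 10}

theorem exists_arm (h : Extremal G S P g) {c v : V} (hc : c ∈ S) (hv : v ∈ S)
    (h0 : G.sg c v ≠ 0) : ∃ x y, x ≠ c ∧ y ≠ c ∧ G.Arm S c v x y := by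
  have h0' : G.sg v c ≠ 0 := by rwa [G.sg_symm]
  have hcm : c ∈ G.nbrs (S ∪ P) v := mem_nbrs.2 ⟨Finset.mem_union_left _ hc, h0'⟩
  have h2 : ((G.nbrs (S ∪ P) v).erase c).card = 2 := by
    rw [Finset.card_erase_of_mem hcm, (h.cubic hv).1]
  obtain ⟨x, y, hxy, he⟩ := Finset.card_eq_two.1 h2
  have hx : x ∈ (G.nbrs (S ∪ P) v).erase c := by simp [he]
  have hy : y ∈ (G.nbrs (S ∪ P) v).erase c := by simp [he]
  rw [Finset.mem_erase] at hx hy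
  refine ⟨x, y, hx.1, hy.1, hv, h.mem_of_mem_nbrs hv hx.2, h.mem_of_mem_nbrs hv hy.2, hxy, h0,
    (mem_nbrs.1 hx.2).2, (mem_nbrs.1 hy.2).2, fun w hw hw0 => ?_⟩
  by_cases hwc : w = c
  · exact Or.inl hwc
  · have : w ∈ (G.nbrs (S ∪ P) v).erase c :=
      Finset.mem_erase.2 ⟨hwc, mem_nbrs.2 ⟨Finset.mem_union_left _ hw, hw0⟩⟩
    rw [he] at this
    right; simpa using this

/-- Two paths of length two with the same ends have the same sign. -/
theorem path_sign_eq (h : Extremal G S P g) {v w x y : V} (hv : v ∈ S) (hw : w ∈ S) (hx : x ∈ S)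
    (hy : y ∈ S) (hxy : x ≠ y) (hvx : G.sg v x ≠ 0) (hvy : G.sg v y ≠ 0) (hwx : G.sg w x ≠ 0)
    (hwy : G.sg w y ≠ 0) : G.sg v x * G.sg v y = G.sg w x * G.sg w y := by
  by_cases hvw : v = w
  · rw [hvw]
  by_contra hne
  refine h.not_negative_four_cycle hv hx hw hy hvw hxy ?_
  have key : ∀ s t : SignType, s ≠ 0 → t ≠ 0 → t ≠ s → s * t = -1 := by decide
  have := key _ _ (mul_ne_zero hvx hvy) (mul_ne_zero hwx hwy) (Ne.symm hne)
  rw [← this, G.sg_symm x w, G.sg_symm y v]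
  ac_rfl

/-- The colouring step at a vertex `c` with three arms. Two coloured neighbours of an arm with
nearby colours exclude three colours of `c`, so one of the ten colours is left. -/
theorem not_star_colored (h : Extremal G S P g) {c v₁ v₂ v₃ x₁ x₂ x₃ y₁ y₂ y₃ : V} (hc : c ∈ S)
    (hcv : ∀ v ∈ S, G.sg c v ≠ 0 → v = v₁ ∨ v = v₂ ∨ v = v₃) (h12 : v₁ ≠ v₂) (h13 : v₁ ≠ v₃)
    (h23 : v₂ ≠ v₃) (a₁ : G.Arm S c v₁ x₁ y₁) (a₂ : G.Arm S c v₂ x₂ y₂)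
    (a₃ : G.Arm S c v₃ x₃ y₃) {f : V → ZMod 10} (hfg : ∀ v ∈ P, f v = g v)
    (hf : G.Ok (S \ {c, v₁, v₂, v₃}) P f)
    (n₁ : near (f x₁ - f y₁ - shift (G.sg v₁ x₁ * G.sg v₁ y₁)))
    (n₂ : near (f x₂ - f y₂ - shift (G.sg v₂ x₂ * G.sg v₂ y₂)))
    (n₃ : near (f x₃ - f y₃ - shift (G.sg v₃ x₃ * G.sg v₃ y₃))) : False := by
  have key : ∀ {v x y : V}, G.Arm S c v x y → near (f x - f y - shift (G.sg v x * G.sg v y)) →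
      ∃ b : ZMod 10, ∀ C, C ≠ b → C ≠ b + 1 → C ≠ b + 2 → ∃ w,
        near (w - (f x + shift (G.sg v x))) ∧ near (w - (f y + shift (G.sg v y))) ∧
        near (C - w - shift (G.sg c v)) := by
    intro v x y ha hn
    refine exists_excluded_three ?_ _
    rw [shift_mul (mul_ne_zero ha.sg_x ha.sg_y)] at hn
    rw [← near_neg]
    convert hn using 1
    linear_combination shift_add_self (G.sg v x)
  obtain ⟨b₁, k₁⟩ := key a₁ n₁
  obtain ⟨b₂, k₂⟩ := key a₂ n₂
  obtain ⟨b₃, k₃⟩ := key a₃ n₃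
  obtain ⟨C, -, hC⟩ := exists_notMem_of_card (A := (Finset.univ : Finset (ZMod 10)))
    (B := {b₁, b₁ + 1, b₁ + 2} ∪ {b₂, b₂ + 1, b₂ + 2} ∪ {b₃, b₃ + 1, b₃ + 2}) (by
      refine (Finset.card_union_le _ _).trans_lt ?_
      have h1 := Finset.card_union_le ({b₁, b₁ + 1, b₁ + 2} : Finset (ZMod 10))
        {b₂, b₂ + 1, b₂ + 2}
      have h2 : ∀ b : ZMod 10, ({b, b + 1, b + 2} : Finset (ZMod 10)).card ≤ 3 :=
        fun b => Finset.card_le_three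
      have := h2 b₁
      have := h2 b₂
      have := h2 b₃
      rw [Finset.card_univ, ZMod.card]
      omega)
  simp only [Finset.mem_union, Finset.mem_insert, Finset.mem_singleton, not_or] at hC
  obtain ⟨⟨⟨c1, c2, c3⟩, c4, c5, c6⟩, c7, c8, c9⟩ := hC
  obtain ⟨w₁, p1, p2, p3⟩ := k₁ C c1 c2 c3
  obtain ⟨w₂, q1, q2, q3⟩ := k₂ C c4 c5 c6
  obtain ⟨w₃, r1, r2, r3⟩ := k₃ C c7 c8 c9
  have m1 := ne_of_sg a₁.sg_c
  have m2 := ne_of_sg a₂.sg_c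
  have m3 := ne_of_sg a₃.sg_c
  set T : Finset V := {c, v₁, v₂, v₃} with hTdef
  have hT : T ⊆ S := by
    intro v hv
    simp only [hTdef, Finset.mem_insert, Finset.mem_singleton] at hv
    rcases hv with rfl | rfl | rfl | rfl
    exacts [hc, a₁.mem, a₂.mem, a₃.mem]
  set col : V → ZMod 10 := fun v => if v = c then C else if v = v₁ then w₁ else
    if v = v₂ then w₂ else w₃ with hcol
  have ec : col c = C := by simp [hcol]
  have e1 : col v₁ = w₁ := by simp [hcol, m1.symm]
  have e2 : col v₂ = w₂ := by simp [hcol, m2.symm, h12.symm]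
  have e3 : col v₃ = w₃ := by simp [hcol, m3.symm, h13.symm, h23.symm]
  have l1 : near (col c - col v₁ - shift (G.sg c v₁)) := by rw [ec, e1]; exact p3
  have l2 : near (col c - col v₂ - shift (G.sg c v₂)) := by rw [ec, e2]; exact q3
  have l3 : near (col c - col v₃ - shift (G.sg c v₃)) := by rw [ec, e3]; exact r3
  have z12 : G.sg v₁ v₂ = 0 := h.sg_eq_zero_of_common hc a₁.mem a₂.mem a₁.sg_c a₂.sg_c
  have z13 : G.sg v₁ v₃ = 0 := h.sg_eq_zero_of_common hc a₁.mem a₃.mem a₁.sg_c a₃.sg_c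
  have z23 : G.sg v₂ v₃ = 0 := h.sg_eq_zero_of_common hc a₂.mem a₃.mem a₂.sg_c a₃.sg_c
  have z21 : G.sg v₂ v₁ = 0 := by rwa [G.sg_symm]
  have z31 : G.sg v₃ v₁ = 0 := by rwa [G.sg_symm]
  have z32 : G.sg v₃ v₂ = 0 := by rwa [G.sg_symm]
  have out : ∀ {v x y : V} {w : ZMod 10}, G.Arm S c v x y → near (w - (f x + shift (G.sg v x))) →
      near (w - (f y + shift (G.sg v y))) → ∀ u ∈ S, u ≠ c → G.sg v u ≠ 0 →
      near (w - f u - shift (G.sg v u)) := by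
    intro v x y w ha hx hy u hu huc h0
    rw [sub_sub]
    rcases ha.eq_of_sg u hu h0 with rfl | rfl | rfl
    exacts [absurd rfl huc, hx, hy]
  refine h.no_extend_cubic hT hfg hf col ?_ ?_
  · intro u hu v hv hvT h0
    simp only [hTdef, Finset.mem_insert, Finset.mem_singleton, not_or] at hu hvT
    rcases hu with rfl | rfl | rfl | rfl
    · have := hcv v hv h0; tauto
    · rw [e1]; exact out a₁ p1 p2 v hv hvT.1 h0
    · rw [e2]; exact out a₂ q1 q2 v hv hvT.1 h0
    · rw [e3]; exact out a₃ r1 r2 v hv hvT.1 h0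
  · intro u hu v hv h0
    simp only [hTdef, Finset.mem_insert, Finset.mem_singleton] at hu hv
    rcases hu with rfl | rfl | rfl | rfl <;> rcases hv with rfl | rfl | rfl | rfl <;>
      first | exact absurd (G.sg_self _) h0 | exact absurd ‹_› h0 |
        assumption | (apply near_symm; assumption)

/-- Replacing the three arms of a vertex by edges between their ends keeps the potentials
nonnegative. -/
theorem star_pot (h : Extremal G S P g) {c v₁ v₂ v₃ x₁ x₂ x₃ y₁ y₂ y₃ : V} (hc : c ∈ S)
    (h12 : v₁ ≠ v₂) (h13 : v₁ ≠ v₃)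
    (h23 : v₂ ≠ v₃) (a₁ : G.Arm S c v₁ x₁ y₁) (a₂ : G.Arm S c v₂ x₂ y₂)
    (a₃ : G.Arm S c v₃ x₃ y₃) {F : Finset V} (hF : F ⊆ S \ {c, v₁, v₂, v₃}) (hFn : F.Nonempty) :
    0 ≤ (((G.addEdge x₁ y₁ a₁.ne_xy (G.sg v₁ x₁ * G.sg v₁ y₁)).addEdge x₂ y₂ a₂.ne_xy
      (G.sg v₂ x₂ * G.sg v₂ y₂)).addEdge x₃ y₃ a₃.ne_xy (G.sg v₃ x₃ * G.sg v₃ y₃)).pot P F := by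
  have hFS : F ⊆ S := hF.trans Finset.sdiff_subset
  have hd := h.disj.mono_left hFS
  have hnot : ∀ v ∈ F, v ≠ c ∧ v ≠ v₁ ∧ v ≠ v₂ ∧ v ≠ v₃ := by
    intro v hv
    have := (Finset.mem_sdiff.1 (hF hv)).2
    simpa using this
  have ncF : c ∉ F := fun hm => (hnot c hm).1 rfl
  have n1 : v₁ ∉ F := fun hm => (hnot _ hm).2.1 rfl
  have n2 : v₂ ∉ F := fun hm => (hnot _ hm).2.2.1 rfl
  have n3 : v₃ ∉ F := fun hm => (hnot _ hm).2.2.2 rfl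
  have step : ∀ {v x y : V} {F' : Finset V}, G.Arm S c v x y → F ⊆ F' → F' ⊆ S → v ∉ F' →
      x ∈ F ∧ y ∈ F → G.pot P (insert v F') + 2 ≤ G.pot P F' := by
    intro v x y F' ha hFF hFS' hv hxy
    exact pot_insert_le hv (h.disj.mono_left hFS') ha.ne_xy (hFF hxy.1) (hFF hxy.2) ha.sg_x ha.sg_y
  have one : ∀ {v x y : V}, G.Arm S c v x y → v ∉ F → x ∈ F ∧ y ∈ F → 4 ≤ G.pot P F := by
    intro v x y ha hv hxy
    have e1 := step ha subset_rfl hFS hv hxy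
    have := h.two_le_pot (F := insert v F) ((Finset.insert_subset ha.mem hFS).ssubset_of_ne
      fun he => by
        rw [← he, Finset.mem_insert] at hc
        exact hc.elim (ne_of_sg ha.sg_c) ncF) ⟨v, by simp⟩
    linarith
  have two : ∀ {v x y w x' y' u : V}, G.Arm S c v x y → G.Arm S c w x' y' → v ≠ w → v ∉ F →
      w ∉ F → x ∈ F ∧ y ∈ F → x' ∈ F ∧ y' ∈ F → u ∈ S → u ∉ F → u ≠ c → u ≠ v → u ≠ w →
      8 ≤ G.pot P F := by
    intro v x y w x' y' u ha hb hvw hv hw hxy hxy' hu huF huc huv huw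
    have s1 : insert v F ⊆ S := Finset.insert_subset ha.mem hFS
    have s2 : insert w (insert v F) ⊆ S := Finset.insert_subset hb.mem s1
    have e1 := step ha subset_rfl hFS hv hxy
    have e2 := step hb (Finset.subset_insert v F) s1 (by simp [hvw.symm, hw]) hxy'
    have e3 := pot_insert_le (G := G) (u := c) (x := v) (y := w) (F := insert w (insert v F))
      (by simp [ne_of_sg ha.sg_c, ne_of_sg hb.sg_c, ncF]) (h.disj.mono_left s2) hvw
      (by simp) (by simp) ha.sg_c hb.sg_c
    have := h.two_le_pot (F := insert c (insert w (insert v F)))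
      ((Finset.insert_subset hc s2).ssubset_of_ne fun he => by
        rw [← he] at hu
        simp only [Finset.mem_insert] at hu
        tauto) ⟨c, by simp⟩
    linarith
  have three : (x₁ ∈ F ∧ y₁ ∈ F) → (x₂ ∈ F ∧ y₂ ∈ F) → (x₃ ∈ F ∧ y₃ ∈ F) →
      12 ≤ G.pot P F := by
    intro m1 m2 m3
    have s1 : insert v₁ F ⊆ S := Finset.insert_subset a₁.mem hFS
    have s2 : insert v₂ (insert v₁ F) ⊆ S := Finset.insert_subset a₂.mem s1
    have s3 : insert v₃ (insert v₂ (insert v₁ F)) ⊆ S := Finset.insert_subset a₃.mem s2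
    have e1 := step a₁ subset_rfl hFS n1 m1
    have e2 := step a₂ (Finset.subset_insert _ F) s1 (by simp [h12.symm, n2]) m2
    have e3 := step a₃ ((Finset.subset_insert _ F).trans (Finset.subset_insert _ _)) s2
      (by simp [h13.symm, h23.symm, n3]) m3
    have e4 := pot_insert_three_le (G := G) (u := c) (x := v₁) (y := v₂) (z := v₃)
      (F := insert v₃ (insert v₂ (insert v₁ F)))
      (by simp [ne_of_sg a₁.sg_c, ne_of_sg a₂.sg_c, ne_of_sg a₃.sg_c, ncF])
      (h.disj.mono_left s3) h12 h13 h23 (by simp) (by simp) (by simp) a₁.sg_c a₂.sg_c a₃.sg_c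
    have := h.pot_nonneg _ (Finset.insert_subset hc s3) ⟨c, by simp⟩
    linarith
  have zero := h.pot_nonneg F hFS hFn
  have p1 := pot_addEdge (G := G) a₁.ne_xy (G.sg v₁ x₁ * G.sg v₁ y₁) hd
  generalize G.addEdge x₁ y₁ a₁.ne_xy (G.sg v₁ x₁ * G.sg v₁ y₁) = G₁ at p1 ⊢
  have p2 := pot_addEdge (G := G₁) a₂.ne_xy (G.sg v₂ x₂ * G.sg v₂ y₂) hd
  generalize G₁.addEdge x₂ y₂ a₂.ne_xy (G.sg v₂ x₂ * G.sg v₂ y₂) = G₂ at p2 ⊢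
  have p3 := pot_addEdge (G := G₂) a₃.ne_xy (G.sg v₃ x₃ * G.sg v₃ y₃) hd
  generalize G₂.addEdge x₃ y₃ a₃.ne_xy (G.sg v₃ x₃ * G.sg v₃ y₃) = G₃ at p3 ⊢
  have less : ∀ {v x y : V}, G.Arm S c v x y → ¬ (x ∈ F ∧ y ∈ F) → x ∉ F ∪ P ∨ y ∉ F ∪ P := by
    intro v x y ha hm
    rw [Finset.mem_union, Finset.mem_union, or_iff_left (h.notMem_P ha.mem_x),
      or_iff_left (h.notMem_P ha.mem_y)]
    exact not_and_or.1 hm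
  have c1 := ne_of_sg a₁.sg_c
  have c2 := ne_of_sg a₂.sg_c
  have c3 := ne_of_sg a₃.sg_c
  by_cases m1 : x₁ ∈ F ∧ y₁ ∈ F <;> by_cases m2 : x₂ ∈ F ∧ y₂ ∈ F <;>
    by_cases m3 : x₃ ∈ F ∧ y₃ ∈ F
  · linarith [p1.1, p2.1, p3.1, three m1 m2 m3]
  · linarith [p1.1, p2.1, p3.2 (less a₃ m3), two a₁ a₂ h12 n1 n2 m1 m2 a₃.mem n3 c3.symm
      h13.symm h23.symm]
  · linarith [p1.1, p2.2 (less a₂ m2), p3.1, two a₁ a₃ h13 n1 n3 m1 m3 a₂.mem n2 c2.symm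
      h12.symm h23]
  · linarith [p1.1, p2.2 (less a₂ m2), p3.2 (less a₃ m3), one a₁ n1 m1]
  · linarith [p1.2 (less a₁ m1), p2.1, p3.1, two a₂ a₃ h23 n2 n3 m2 m3 a₁.mem n1 c1.symm
      h12 h13]
  · linarith [p1.2 (less a₁ m1), p2.1, p3.2 (less a₃ m3), one a₂ n2 m2]
  · linarith [p1.2 (less a₁ m1), p2.2 (less a₂ m2), p3.1, one a₃ n3 m3]
  · linarith [p1.2 (less a₁ m1), p2.2 (less a₂ m2), p3.2 (less a₃ m3)]

/-- There are no cubic minimal counterexamples. Without triangles and negative four-cycles, a vertex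
`c` and its three neighbours can be deleted, and each neighbour replaced by an edge between its two
other neighbours. A negative triangle has at least two of the three new edges, so there is no
negative `K_4`; a colouring of the smaller graph leaves a colour to `c`. -/
theorem eq_empty (h : Extremal G S P g) : S = ∅ := by
  rw [← Finset.not_nonempty_iff_eq_empty]
  rintro ⟨c, hc⟩
  obtain ⟨v₁, v₂, v₃, h12, h13, h23, hn⟩ := Finset.card_eq_three.1 (h.cubic hc).1
  have hm : ∀ v ∈ G.nbrs (S ∪ P) c, v ∈ S ∧ G.sg c v ≠ 0 := fun v hv =>
    ⟨h.mem_of_mem_nbrs hc hv, (mem_nbrs.1 hv).2⟩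
  obtain ⟨m1, s1⟩ := hm v₁ (by simp [hn])
  obtain ⟨m2, s2⟩ := hm v₂ (by simp [hn])
  obtain ⟨m3, s3⟩ := hm v₃ (by simp [hn])
  have hcv : ∀ v ∈ S, G.sg c v ≠ 0 → v = v₁ ∨ v = v₂ ∨ v = v₃ := by
    intro v hv h0
    have : v ∈ G.nbrs (S ∪ P) c := mem_nbrs.2 ⟨Finset.mem_union_left _ hv, h0⟩
    simpa [hn] using this
  obtain ⟨x₁, y₁, x1c, y1c, a₁⟩ := h.exists_arm hc m1 s1
  obtain ⟨x₂, y₂, x2c, y2c, a₂⟩ := h.exists_arm hc m2 s2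
  obtain ⟨x₃, y₃, x3c, y3c, a₃⟩ := h.exists_arm hc m3 s3
  set T : Finset V := {c, v₁, v₂, v₃} with hTdef
  have hT : T ⊆ S := by
    intro v hv
    simp only [hTdef, Finset.mem_insert, Finset.mem_singleton] at hv
    rcases hv with rfl | rfl | rfl | rfl <;> assumption
  have hST := Finset.sdiff_ssubset hT ⟨c, by simp [hTdef]⟩
  set G' := ((G.addEdge x₁ y₁ a₁.ne_xy (G.sg v₁ x₁ * G.sg v₁ y₁)).addEdge x₂ y₂ a₂.ne_xy
      (G.sg v₂ x₂ * G.sg v₂ y₂)).addEdge x₃ y₃ a₃.ne_xy (G.sg v₃ x₃ * G.sg v₃ y₃) with hG'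
  set N : Finset (Sym2 V) := {s(x₁, y₁), s(x₂, y₂), s(x₃, y₃)} with hNdef
  have old : ∀ u v, s(u, v) ∉ N → G'.sg u v = G.sg u v := by
    intro u v huv
    simp only [hNdef, Finset.mem_insert, Finset.mem_singleton, not_or] at huv
    simp only [hG', addEdge_sg, huv, if_false]
  have swap : ∀ {v x y p q : V}, G.Arm S c v x y → s(p, q) = s(x, y) →
      G.sg v x * G.sg v y = G.sg v p * G.sg v q ∧ G.sg v p ≠ 0 ∧ G.sg v q ≠ 0 ∧ p ∈ S ∧
        q ∈ S := by
    intro v x y p q ha he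
    rcases Sym2.eq_iff.1 he with ⟨rfl, rfl⟩ | ⟨rfl, rfl⟩
    · exact ⟨rfl, ha.sg_x, ha.sg_y, ha.mem_x, ha.mem_y⟩
    · exact ⟨mul_comm _ _, ha.sg_y, ha.sg_x, ha.mem_y, ha.mem_x⟩
  have new : ∀ p q, s(p, q) ∈ N → ∃ v ∈ T, G'.sg p q = G.sg v p * G.sg v q ∧ G.sg v p ≠ 0 ∧
      G.sg v q ≠ 0 ∧ p ∈ S ∧ q ∈ S := by
    intro p q hpq
    simp only [hNdef, Finset.mem_insert, Finset.mem_singleton] at hpq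
    simp only [hG', addEdge_sg]
    split_ifs with e3 e2 e1
    · exact ⟨v₃, by simp [hTdef], swap a₃ e3⟩
    · exact ⟨v₂, by simp [hTdef], swap a₂ e2⟩
    · exact ⟨v₁, by simp [hTdef], swap a₁ e1⟩
    · tauto
  have hk4 : G'.NegK4Free (S \ T) := by
    refine negK4Free_of_card_le_three (N := N) Finset.card_le_three ?_
    intro p hp q hq r hr hNeg
    by_contra hcon
    push Not at hcon
    have hpS := hST.subset hp
    have hqS := hST.subset hq
    have hrS := hST.subset hr
    have hqr := ne_of_sg hNeg.ne_zero23
    by_cases hm : s(q, r) ∈ N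
    · obtain ⟨v, hv, e, -⟩ := new q r hm
      refine h.not_negative_four_cycle hpS hqS (hT hv) hrS
        (fun he => (Finset.mem_sdiff.1 hp).2 (he ▸ hv)) hqr ?_
      unfold Neg at hNeg
      rw [old _ _ hcon.1, old _ _ hcon.2, e] at hNeg
      rw [← hNeg, G.sg_symm q v, G.sg_symm r p]
      ac_rfl
    · unfold Neg at hNeg
      rw [old _ _ hcon.1, old _ _ hcon.2, old _ _ hm] at hNeg
      exact h.not_negative_triangle hpS hqS hrS hNeg
  obtain ⟨f, hfg, hf⟩ := h.extends_of_ssubset (G' := G') hST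
    (fun F hF hFn => h.star_pot hc h12 h13 h23 a₁ a₂ a₃ hF hFn) hk4
  have hok : G.Ok (S \ T) P f := by
    refine hf.of_le (fun u v h0 => old u v fun hm => ?_) (fun u v => subset_rfl)
    obtain ⟨w, hw, -, e1, e2, hu, hv⟩ := new u v hm
    exact h0 (h.sg_eq_zero_of_common (hT hw) hu hv e1 e2)
  have notT : ∀ {v x y : V}, G.Arm S c v x y → x ≠ c → y ≠ c → x ∈ S \ T ∧ y ∈ S \ T := by
    intro v x y ha hxc hyc
    have z : ∀ w, G.sg c w ≠ 0 → w ∈ S → G.sg v w = 0 := fun w h0 hw =>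
      h.sg_eq_zero_of_common hc ha.mem hw ha.sg_c h0
    have zx : ∀ w, G.sg c w ≠ 0 → w ∈ S → x ≠ w ∧ y ≠ w := fun w h0 hw =>
      ⟨fun he => ha.sg_x (he ▸ z w h0 hw), fun he => ha.sg_y (he ▸ z w h0 hw)⟩
    refine ⟨Finset.mem_sdiff.2 ⟨ha.mem_x, ?_⟩, Finset.mem_sdiff.2 ⟨ha.mem_y, ?_⟩⟩
    · simp [hTdef, hxc, (zx _ s1 m1).1, (zx _ s2 m2).1, (zx _ s3 m3).1]
    · simp [hTdef, hyc, (zx _ s1 m1).2, (zx _ s2 m2).2, (zx _ s3 m3).2]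
  have fin : ∀ {v x y : V}, G.Arm S c v x y → x ≠ c → y ≠ c → s(x, y) ∈ N →
      near (f x - f y - shift (G.sg v x * G.sg v y)) := by
    intro v x y ha hxc hyc hm
    obtain ⟨hx, hy⟩ := notT ha hxc hyc
    obtain ⟨w, hw, e, e1, e2, -⟩ := new x y hm
    have := hf.near hx (Finset.mem_union_left _ hy) (by rw [e]; exact mul_ne_zero e1 e2)
    rwa [e, ← h.path_sign_eq ha.mem (hT hw) ha.mem_x ha.mem_y ha.ne_xy ha.sg_x ha.sg_y e1 e2]
      at this
  exact h.not_star_colored hc hcv h12 h13 h23 a₁ a₂ a₃ hfg hok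
    (fin a₁ x1c y1c (by simp [hNdef])) (fin a₂ x2c y2c (by simp [hNdef]))
    (fin a₃ x3c y3c (by simp [hNdef]))

end Extremal

/-- A precolouring extends if all relative potentials are nonnegative and there is no negative
`K_4` among the free vertices. -/
theorem extends_of_pot_nonneg (G : CGraph V) (S P : Finset V) (g : V → ZMod 10)
    (hd : Disjoint S P) (hp : ∀ F ⊆ S, F.Nonempty → 0 ≤ G.pot P F) (hk : G.NegK4Free S) :
    G.Extends S P g := by
  induction hn : S.card using Nat.strong_induction_on generalizing G S P g with
  | _ n ih =>
    by_contra hno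
    have hE : Extremal G S P g := ⟨hd, hp, hk, hno, fun G' S' P' g' hc hd' hp' hk' =>
      ih S'.card (hn ▸ hc) G' S' P' g' hd' hp' hk' rfl⟩
    have h0 := hE.eq_empty
    exact hno ⟨g, fun _ _ => rfl, fun u hu => by simp [h0] at hu⟩

end CGraph

/-! ### From signed multigraphs to constraint graphs -/

variable {α β : Type*} {G : Graph α β} {σ : β → ℤˣ}

/-- The sign of an edge as a value of `SignType`. -/
def usign (s : ℤˣ) : SignType := if s = 1 then 1 else -1

theorem usign_ne_zero (s : ℤˣ) : usign s ≠ 0 := by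
  revert s; decide

theorem circularCliqueAdj_iff (i j : Fin 10) (s : ℤˣ) :
    circularCliqueAdj 10 3 i j s ↔ near ((show ZMod 10 from i) - (show ZMod 10 from j) -
      shift (usign s)) := by
  unfold circularCliqueAdj
  revert i j s
  decide +kernel

/-- A circular `10/3`-colouring is a map to `ZMod 10` in which the ends of an edge differ by a near
element, up to the rotation that belongs to its sign. -/
theorem circularColorable_iff : CircularColorable 10 3 G σ ↔
    ∃ c : α → ZMod 10, ∀ e x y, G.IsLink e x y → near (c x - c y - shift (usign (σ e))) := by
  classical
  constructor
  · rintro ⟨f, hf⟩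
    obtain ⟨c, hc⟩ : ∃ c : α → Fin 10, ∀ x (h : x ∈ V(G)), c x = (f ⟨x, h⟩).1 :=
      ⟨fun x => if h : x ∈ V(G) then (f ⟨x, h⟩).1 else 0, fun x h => dif_pos h⟩
    refine ⟨c, fun e x y h => ?_⟩
    obtain ⟨e', h1, h2⟩ := hf e ⟨x, h.left_mem⟩ ⟨y, h.right_mem⟩ h
    rw [← h2, ← circularCliqueAdj_iff, hc x h.left_mem, hc y h.right_mem]
    exact h1.2
  · rintro ⟨c, hc⟩
    refine ⟨fun x => ⟨c x, Set.mem_univ _⟩, fun e x y h => ?_⟩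
    exact ⟨(s(c x, c y), σ e), ⟨rfl, (circularCliqueAdj_iff _ _ _).2 (hc e x y h)⟩, rfl⟩

/-- A subgraph of a critical graph without colouring is the whole graph. -/
theorem CircularCritical.eq_of_not_colorable {p q : ℕ} (h : CircularCritical p q G σ)
    {H : Graph α β} (hH : H ≤ G) (hn : ¬ CircularColorable p q H σ) : H = G := by
  by_contra hne
  exact hn (h.2 H (lt_of_le_of_ne hH hne))

theorem Iso.of_bijOn {γ δ : Type*} {H : Graph γ δ} {π : δ → ℤˣ} (X : Set α) {f : α → γ}
    {k : β → δ} (hf : Set.BijOn f V(G) V(H)) (hk : Set.BijOn k E(G) E(H))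
    (h : ∀ e x y, G.IsLink e x y → H.IsLink (k e) (f x) (f y))
    (hs : ∀ e ∈ E(G), π (k e) = switch G σ X e) : Iso G σ H π := by
  refine ⟨X, hf.equiv f, hk.equiv k, fun e x y => ⟨fun he => h _ _ _ he, fun he => ?_⟩,
    fun e => hs e e.2⟩
  obtain ⟨a, b, hab⟩ := G.exists_isLink_of_mem_edgeSet e.2
  have h1 := h _ _ _ hab
  change H.IsLink (k e) (f x) (f y) at he
  rcases h1.eq_and_eq_or_eq_and_eq he with ⟨h2, h3⟩ | ⟨h2, h3⟩
  · rwa [← hf.injOn hab.left_mem x.2 h2, ← hf.injOn hab.right_mem y.2 h3]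
  · rw [← hf.injOn hab.left_mem y.2 h2, ← hf.injOn hab.right_mem x.2 h3]
    exact hab.symm

theorem switch_empty (e : β) : switch G σ ∅ e = σ e := by
  simp [switch]

theorem switch_of_isLink {X : Set α} {e : β} {x y : α} (h : G.IsLink e x y) :
    (switch G σ X e = σ e ∧ (x ∈ X ↔ y ∈ X)) ∨ (switch G σ X e = -σ e ∧ ¬ (x ∈ X ↔ y ∈ X)) := by
  unfold switch
  split_ifs with hX
  · right
    obtain ⟨a, b, hab, ha, hb⟩ := hX
    refine ⟨rfl, ?_⟩
    rcases hab.eq_and_eq_or_eq_and_eq h with ⟨rfl, rfl⟩ | ⟨rfl, rfl⟩ <;> tauto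
  · left
    refine ⟨rfl, ?_⟩
    by_contra hn
    apply hX
    by_cases hx : x ∈ X
    · exact ⟨x, y, h, hx, by tauto⟩
    · exact ⟨y, x, h.symm, by tauto, hx⟩

theorem not_near_and_near {d : ZMod 10} : ¬ (near (d - shift (usign 1)) ∧
    near (d - shift (usign (-1)))) := by
  revert d; decide +kernel

/-- In a critical graph other than the digon, parallel edges between distinct vertices have the same
sign. -/
theorem CircularCritical.sign_eq (h : CircularCritical 10 3 G σ)
    (hdigon : ¬ Iso G σ digon id) {e e' : β} {u v : α} (huv : u ≠ v) (he : G.IsLink e u v)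
    (he' : G.IsLink e' u v) : σ e = σ e' := by
  classical
  by_contra hne
  wlog h1 : σ e = 1 generalizing e e'
  · refine this he' he (Ne.symm hne) ?_
    rcases Int.units_eq_one_or (σ e') with h2 | h2
    · exact h2
    · exact absurd (((Int.units_eq_one_or _).resolve_left h1).trans h2.symm) hne
  have h2 : σ e' = -1 := (Int.units_eq_one_or _).resolve_left fun h2 => hne (h1.trans h2.symm)
  have hle : (G.induce {u, v}).restrict {e, e'} ≤ G := Graph.restrict_le.trans
    (Graph.induce_le (by rintro x (rfl | rfl); exacts [he.left_mem, he.right_mem]))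
  have hG := h.eq_of_not_colorable hle (by
    rw [circularColorable_iff]
    rintro ⟨c, hc⟩
    have k1 := hc e u v (by simp [he])
    have k2 := hc e' u v (by simp [he'])
    rw [h1] at k1
    rw [h2] at k2
    exact not_near_and_near ⟨k1, k2⟩)
  have hV : V(G) = {u, v} := by rw [← hG]; rfl
  have hE : ∀ a ∈ E(G), a = e ∨ a = e' := by
    intro a ha
    obtain ⟨x, y, hxy⟩ := G.exists_isLink_of_mem_edgeSet ha
    rw [← hG] at hxy
    simp only [Graph.restrict_isLink] at hxy
    simpa using hxy.1
  apply hdigon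
  have hlink : ∀ a ∈ E(G), G.IsLink a u v := by
    intro a ha
    rcases hE a ha with rfl | rfl <;> assumption
  refine Iso.of_bijOn ∅ (f := fun x => if x = u then (0 : Fin 2) else 1) (k := σ) ?_ ?_ ?_ ?_
  · rw [hV]
    refine ⟨fun x _ => Set.mem_univ _, ?_, ?_⟩
    · rintro x (rfl | rfl) y (rfl | rfl) hxy <;> simp_all
    · intro i _
      fin_cases i
      · exact ⟨u, by simp, by simp⟩
      · exact ⟨v, by simp, by simp [huv.symm]⟩
  · refine ⟨fun a _ => ⟨0, 1, by simp⟩, ?_, ?_⟩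
    · intro a ha b hb hab
      rcases hE a ha with rfl | rfl <;> rcases hE b hb with rfl | rfl <;> simp_all
    · intro s _
      rcases Int.units_eq_one_or s with rfl | rfl
      · exact ⟨e, he.edge_mem, h1⟩
      · exact ⟨e', he'.edge_mem, h2⟩
  · intro a x y hxy
    have := hlink a hxy.edge_mem
    rcases this.eq_and_eq_or_eq_and_eq hxy with ⟨rfl, rfl⟩ | ⟨rfl, rfl⟩ <;>
      simp [digon, huv.symm]
  · intro a _
    rw [switch_empty]; rfl

open Classical in
/-- The constraint graph of a signed graph: loops are dropped, and a positive edge takes precedence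
over a parallel negative one. -/
noncomputable def constraintGraph (G : Graph α β) (σ : β → ℤˣ) : CGraph α where
  sg u v := if u ≠ v ∧ ∃ e, G.IsLink e u v ∧ σ e = 1 then 1 else
    if u ≠ v ∧ ∃ e, G.IsLink e u v ∧ σ e = -1 then -1 else 0
  ne _ _ := ∅
  sg_symm u v := by simp only [G.isLink_comm (x := u), ne_comm (a := u)]
  sg_self u := by simp
  ne_symm _ _ := rfl
  ne_self _ := rfl

theorem exists_isLink_of_sg {u v : α} (h : (constraintGraph G σ).sg u v ≠ 0) :
    ∃ e, G.IsLink e u v ∧ usign (σ e) = (constraintGraph G σ).sg u v := by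
  simp only [constraintGraph] at h ⊢
  split_ifs at h ⊢ with h1 h2
  · obtain ⟨-, e, he, hs⟩ := h1
    exact ⟨e, he, by simp [usign, hs]⟩
  · obtain ⟨-, e, he, hs⟩ := h2
    exact ⟨e, he, by rw [hs]; decide⟩
  · exact absurd rfl h

theorem sg_of_isLink (hs : ∀ {e e' : β} {u v : α}, u ≠ v → G.IsLink e u v → G.IsLink e' u v →
    σ e = σ e') {e : β} {u v : α} (huv : u ≠ v) (he : G.IsLink e u v) :
    (constraintGraph G σ).sg u v = usign (σ e) := by
  have h0 : (constraintGraph G σ).sg u v ≠ 0 := by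
    simp only [constraintGraph]
    rcases Int.units_eq_one_or (σ e) with h1 | h1
    · rw [if_pos ⟨huv, e, he, h1⟩]; decide
    · split_ifs with h2 h3
      · decide
      · decide
      · exact absurd ⟨huv, e, he, h1⟩ h3
  obtain ⟨e', he', h'⟩ := exists_isLink_of_sg h0
  rw [← h', hs huv he he']

theorem not_near_negative_four (p q r : ZMod 10) : ¬ (near p ∧ near q ∧ near r ∧
    near (q - p - 5) ∧ near (r - p - 5) ∧ near (r - q - 5)) := by
  revert p q r; decide +kernel

/-- A negative `K_4` has no colouring. -/
theorem CGraph.not_near_of_negK4 {V : Type*} [DecidableEq V] {Γ : CGraph V} {a b c d : V}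
    (h1 : Γ.Neg a b c) (h2 : Γ.Neg a b d) (h3 : Γ.Neg a c d) (f : V → ZMod 10) :
    ¬ ∀ x ∈ ({a, b, c, d} : Set V), ∀ y ∈ ({a, b, c, d} : Set V), Γ.sg x y ≠ 0 →
      near (f x - f y - shift (Γ.sg x y)) := by
  intro h
  have sub : ∀ {x y : V}, Γ.Neg a x y → near (f x - f y - shift (Γ.sg x y)) →
      near (f a - f y - shift (Γ.sg a y) - (f a - f x - shift (Γ.sg a x)) - 5) := by
    intro x y hN hn
    convert hn using 1
    linear_combination shift_triple hN - shift_add_self (Γ.sg a y)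
  have key : ∀ x ∈ ({a, b, c, d} : Set V), ∀ y ∈ ({a, b, c, d} : Set V), Γ.Neg a x y →
      near (f a - f y - shift (Γ.sg a y) - (f a - f x - shift (Γ.sg a x)) - 5) :=
    fun x hx y hy hN => sub hN (h x hx y hy hN.ne_zero23)
  exact not_near_negative_four _ _ _ ⟨h a (by simp) b (by simp) h1.ne_zero12,
    h a (by simp) c (by simp) h1.ne_zero13, h a (by simp) d (by simp) h2.ne_zero13,
    key b (by simp) c (by simp) h1, key b (by simp) d (by simp) h2, key c (by simp) d (by simp) h3⟩

/-- A critical graph other than the digon and the negative `K_4` contains no negative `K_4`. -/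
theorem CircularCritical.negK4Free (h : CircularCritical 10 3 G σ)
    (hs : ∀ {e e' : β} {u v : α}, u ≠ v → G.IsLink e u v → G.IsLink e' u v → σ e = σ e')
    (hK4 : ¬ Iso G σ completeFour (fun _ => -1)) (S : Finset α) :
    (constraintGraph G σ).NegK4Free S := by
  classical
  rintro a - b - c - d - ⟨h1, h2, h3, h4⟩
  set Γ := constraintGraph G σ with hΓ
  have hab := CGraph.ne_of_sg h1.ne_zero12
  have hac := CGraph.ne_of_sg h1.ne_zero13
  have hbc := CGraph.ne_of_sg h1.ne_zero23
  have had := CGraph.ne_of_sg h2.ne_zero13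
  have hbd := CGraph.ne_of_sg h2.ne_zero23
  have hcd := CGraph.ne_of_sg h3.ne_zero23
  set Q : Set α := {a, b, c, d} with hQ
  have hadj : ∀ x ∈ Q, ∀ y ∈ Q, x ≠ y → Γ.sg x y ≠ 0 := by
    have s1 := h1.ne_zero12
    have s2 := h1.ne_zero13
    have s3 := h1.ne_zero23
    have s4 := h2.ne_zero13
    have s5 := h2.ne_zero23
    have s6 := h3.ne_zero23
    rintro x (rfl | rfl | rfl | rfl) y (rfl | rfl | rfl | rfl) hxy <;>
      first | exact absurd rfl hxy | assumption | (rw [Γ.sg_symm]; assumption)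
  have hneg : ∀ x ∈ Q, ∀ y ∈ Q, x ≠ a → y ≠ a → x ≠ y → Γ.Neg a x y := by
    rintro x (rfl | rfl | rfl | rfl) y (rfl | rfl | rfl | rfl) hx hy hxy <;>
      first | contradiction | assumption | (apply CGraph.Neg.swap23; assumption)
  -- one edge is chosen for each pair
  obtain ⟨e₀, -, -⟩ := exists_isLink_of_sg h1.ne_zero12
  have : Nonempty β := ⟨e₀⟩
  set ed : α → α → β := fun x y => Classical.epsilon fun e => G.IsLink e x y with hed
  have ed_link : ∀ x ∈ Q, ∀ y ∈ Q, x ≠ y → G.IsLink (ed x y) x y := by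
    intro x hx y hy hxy
    obtain ⟨e, he, -⟩ := exists_isLink_of_sg (hadj x hx y hy hxy)
    exact Classical.epsilon_spec (p := fun e => G.IsLink e x y) ⟨e, he⟩
  have ed_comm : ∀ x y, ed x y = ed y x := by
    intro x y
    simp only [hed, G.isLink_comm (x := x)]
  have ed_sg : ∀ x ∈ Q, ∀ y ∈ Q, x ≠ y → Γ.sg x y = usign (σ (ed x y)) := fun x hx y hy hxy =>
    sg_of_isLink hs hxy (ed_link x hx y hy hxy)
  set F : Set β := {e | ∃ x ∈ Q, ∃ y ∈ Q, x ≠ y ∧ e = ed x y} with hF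
  have hQV : Q ⊆ V(G) := by
    rintro x (rfl | rfl | rfl | rfl)
    · exact (ed_link x (by simp [hQ]) b (by simp [hQ]) hab).left_mem
    · exact (ed_link a (by simp [hQ]) x (by simp [hQ]) hab).right_mem
    · exact (ed_link a (by simp [hQ]) x (by simp [hQ]) hac).right_mem
    · exact (ed_link a (by simp [hQ]) x (by simp [hQ]) had).right_mem
  have hG := h.eq_of_not_colorable (Graph.restrict_le.trans (Graph.induce_le hQV) :
      (G.induce Q).restrict F ≤ G) (by
    rw [circularColorable_iff]
    rintro ⟨f, hf⟩
    refine CGraph.not_near_of_negK4 h1 h2 h3 f fun x hx y hy h0 => ?_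
    have hxy := CGraph.ne_of_sg h0
    rw [ed_sg x hx y hy hxy]
    exact hf _ x y ⟨⟨x, hx, y, hy, hxy, rfl⟩, ed_link x hx y hy hxy, hx, hy⟩)
  have hV : V(G) = Q := by rw [← hG]; rfl
  have hlink : ∀ {e x y}, G.IsLink e x y → x ∈ Q ∧ y ∈ Q ∧ x ≠ y ∧ e = ed x y := by
    intro e x y he
    rw [← hG] at he
    obtain ⟨⟨x', hx', y', hy', hxy', rfl⟩, he', -, -⟩ := he
    rcases (ed_link x' hx' y' hy' hxy').eq_and_eq_or_eq_and_eq he' with ⟨rfl, rfl⟩ | ⟨rfl, rfl⟩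
    · exact ⟨hx', hy', hxy', rfl⟩
    · exact ⟨hy', hx', hxy'.symm, ed_comm _ _⟩
  apply hK4
  set f : α → Fin 4 := fun x => if x = a then 0 else if x = b then 1 else if x = c then 2 else 3
    with hf
  have fa : f a = 0 := by simp [hf]
  have fb : f b = 1 := by simp [hf, hab.symm]
  have fc : f c = 2 := by simp [hf, hac.symm, hbc.symm]
  have fd : f d = 3 := by simp [hf, had.symm, hbd.symm, hcd.symm]
  have finj : Set.InjOn f Q := by
    rintro x (rfl | rfl | rfl | rfl) y (rfl | rfl | rfl | rfl) hxy <;>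
      first | rfl | (simp [fa, fb, fc, fd] at hxy)
  have fsurj : ∀ i, ∃ x ∈ Q, f x = i := by
    intro i
    fin_cases i
    · exact ⟨a, by simp [hQ], fa⟩
    · exact ⟨b, by simp [hQ], fb⟩
    · exact ⟨c, by simp [hQ], fc⟩
    · exact ⟨d, by simp [hQ], fd⟩
  have hex : ∀ e, ∃ t : Sym2 (Fin 4), ∀ x y, G.IsLink e x y → t = s(f x, f y) := by
    intro e
    by_cases h : ∃ x y, G.IsLink e x y
    · obtain ⟨x', y', he'⟩ := h
      refine ⟨s(f x', f y'), fun x y he => ?_⟩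
      rcases he'.eq_and_eq_or_eq_and_eq he with ⟨rfl, rfl⟩ | ⟨rfl, rfl⟩
      · rfl
      · exact Sym2.eq_swap
    · exact ⟨s(0, 0), fun x y he => absurd ⟨x, y, he⟩ h⟩
  choose k hk using hex
  refine Iso.of_bijOn {x | x ∈ Q ∧ x ≠ a ∧ Γ.sg a x = 1} (f := f) (k := k) ?_ ?_ ?_ ?_
  · rw [hV]
    exact ⟨fun _ _ => Set.mem_univ _, finj, fun i _ => fsurj i⟩
  · refine ⟨fun e he => ?_, fun e he e' he' hee => ?_, ?_⟩
    · obtain ⟨x, y, hxy⟩ := G.exists_isLink_of_mem_edgeSet he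
      obtain ⟨hx, hy, hne, -⟩ := hlink hxy
      exact ⟨f x, f y, hk e x y hxy, fun h => hne (finj hx hy h)⟩
    · obtain ⟨x, y, hxy⟩ := G.exists_isLink_of_mem_edgeSet he
      obtain ⟨x', y', hxy'⟩ := G.exists_isLink_of_mem_edgeSet he'
      obtain ⟨hx, hy, hne, e1⟩ := hlink hxy
      obtain ⟨hx', hy', hne', e2⟩ := hlink hxy'
      rw [hk e x y hxy, hk e' x' y' hxy'] at hee
      rcases Sym2.eq_iff.1 hee with ⟨h1, h2⟩ | ⟨h1, h2⟩
      · rw [e1, e2, finj hx hx' h1, finj hy hy' h2]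
      · rw [e1, e2, finj hx hy' h1, finj hy hx' h2, ed_comm]
    · rintro s ⟨i, j, rfl, hij⟩
      obtain ⟨x, hx, rfl⟩ := fsurj i
      obtain ⟨y, hy, rfl⟩ := fsurj j
      have := ed_link x hx y hy fun h => hij (by rw [h])
      exact ⟨ed x y, this.edge_mem, hk _ _ _ this⟩
  · intro e x y hxy
    obtain ⟨hx, hy, hne, -⟩ := hlink hxy
    exact ⟨hk e x y hxy, fun h => hne (finj hx hy h)⟩
  · -- switching makes all edges at `a` negative, hence all edges, since the triangles are negative
    intro e he
    obtain ⟨x, y, hxy⟩ := G.exists_isLink_of_mem_edgeSet he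
    obtain ⟨hx, hy, hne, rfl⟩ := hlink hxy
    have e1 := ed_sg x hx y hy hne
    have hu : ∀ s : ℤˣ, (s = 1 ↔ usign s = 1) ∧ (s = -1 ↔ usign s = -1) := by decide
    have h0 : ∀ z ∈ Q, z ≠ a → Γ.sg a z = 1 ∨ Γ.sg a z = -1 := by
      intro z hz hza
      have := hadj a (by simp [hQ]) z hz hza.symm
      revert this
      generalize Γ.sg a z = t
      revert t; decide
    have goal : ((x ∈ {x | x ∈ Q ∧ x ≠ a ∧ Γ.sg a x = 1} ↔
        y ∈ {x | x ∈ Q ∧ x ≠ a ∧ Γ.sg a x = 1}) ↔ Γ.sg x y = -1) := by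
      simp only [Set.mem_ofPred_eq, hx, hy, true_and]
      by_cases hxa : x = a
      · subst hxa
        rcases h0 y hy hne.symm with h5 | h5 <;> simp [h5, hne.symm]
      · by_cases hya : y = a
        · subst hya
          rw [Γ.sg_symm x y]
          rcases h0 x hx hne with h5 | h5 <;> simp [h5, hne]
        · have := hneg x hx y hy hxa hya hne
          simp only [ne_eq, hxa, hya, not_false_eq_true, true_and]
          unfold CGraph.Neg at this
          revert this
          generalize Γ.sg a x = p
          generalize Γ.sg x y = q
          generalize Γ.sg a y = r
          revert p q r
          decide
    rw [e1] at goal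
    rcases switch_of_isLink (σ := σ) (X := {x | x ∈ Q ∧ x ≠ a ∧ Γ.sg a x = 1}) hxy with
      ⟨h5, h6⟩ | ⟨h5, h6⟩
    · rw [h5]; exact ((hu _).2.2 (goal.1 h6)).symm
    · rw [h5]
      rw [goal, ← (hu _).2] at h6
      rw [(Int.units_eq_one_or _).resolve_right h6]

/-- The weight of the constraint graph counts every pair of adjacent vertices four times, so it is
at most four times the number of edges. -/
theorem wts_constraintGraph_le [DecidableEq α] (S : Finset α) (hE : E(G).Finite) :
    (constraintGraph G σ).wts S S ≤ 4 * (E(G).ncard : ℤ) := by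
  classical
  set Γ := constraintGraph G σ with hΓ
  set A := (S ×ˢ S).filter fun p => Γ.sg p.1 p.2 ≠ 0 with hA
  have h1 : Γ.wts S S = 2 * (A.card : ℤ) := by
    unfold CGraph.wts
    rw [← Finset.sum_product', hA, Finset.card_filter]
    push_cast
    rw [Finset.mul_sum]
    refine Finset.sum_congr rfl fun p _ => ?_
    have hne : Γ.ne p.1 p.2 = ∅ := rfl
    simp only [CGraph.wt, hne]
    split_ifs <;> simp_all
  have h2 : A.card * 1 ≤ hE.toFinset.card * 2 := by
    refine Finset.card_mul_le_card_mul (fun p e => G.IsLink e p.1 p.2) (fun p hp => ?_)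
      fun e he => ?_
    · obtain ⟨e, he, -⟩ := exists_isLink_of_sg (Finset.mem_filter.1 hp).2
      exact Finset.card_pos.2 ⟨e, by simp [Finset.bipartiteAbove, he, he.edge_mem]⟩
    · obtain ⟨x, y, hxy⟩ := G.exists_isLink_of_mem_edgeSet (hE.mem_toFinset.1 he)
      refine (Finset.card_le_card (t := {(x, y), (y, x)}) fun p hp => ?_).trans Finset.card_le_two
      have hp2 := (Finset.mem_filter.1 hp).2
      rcases hxy.eq_and_eq_or_eq_and_eq hp2 with ⟨h1, h2⟩ | ⟨h1, h2⟩ <;> simp [h1, h2]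
  rw [h1, Set.ncard_eq_toFinset_card _ hE]
  have : (A.card : ℤ) * 1 ≤ hE.toFinset.card * 2 := by exact_mod_cast h2
  linarith

/-- A critical graph has negative potential. Otherwise a set `H` of minimal potential is empty or
spans a proper subgraph, so it has a colouring; by minimality the potentials relative to `H` are
nonnegative, and the colouring of `H` extends to all vertices. -/
theorem CircularCritical.pot_neg (h : CircularCritical 10 3 G σ) [DecidableEq α]
    (hs : ∀ {e e' : β} {u v : α}, u ≠ v → G.IsLink e u v → G.IsLink e' u v → σ e = σ e')
    (hloop : ∀ e x, G.IsLoopAt e x → σ e = 1) {S : Finset α} (hS : (S : Set α) = V(G))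
    (hK : (constraintGraph G σ).NegK4Free S) : (constraintGraph G σ).pot ∅ S < 0 := by
  set Γ := constraintGraph G σ with hΓ
  by_contra hneg
  push Not at hneg
  have hne : ∀ u v, Γ.ne u v = ∅ := fun _ _ => rfl
  have hcol : ∀ f : α → ZMod 10, ¬ Γ.Ok S ∅ f := by
    intro f hf
    apply h.1
    rw [circularColorable_iff]
    refine ⟨f, fun e x y he => ?_⟩
    by_cases hxy : x = y
    · subst hxy
      rw [hloop e x he, sub_self]
      decide
    · have hsg := sg_of_isLink hs hxy he
      rw [← hsg]
      have hx : x ∈ S := by rw [← Finset.mem_coe, hS]; exact he.left_mem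
      have hy : y ∈ S := by rw [← Finset.mem_coe, hS]; exact he.right_mem
      exact hf.near hx (Finset.mem_union_left _ hy) (by rw [hsg]; exact usign_ne_zero _)
  obtain ⟨H, hHS, hHne, hmin⟩ : ∃ H ⊆ S, (H = ∅ ∨ H ≠ S) ∧ ∀ F ⊆ S, Γ.pot ∅ H ≤ Γ.pot ∅ F := by
    obtain ⟨H, hH, hmin⟩ := Finset.exists_min_image S.powerset (Γ.pot ∅) ⟨∅, by simp⟩
    rw [Finset.mem_powerset] at hH
    by_cases hHS : H = S
    · refine ⟨∅, by simp, Or.inl rfl, fun F hF => ?_⟩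
      rw [CGraph.pot_empty]
      exact hneg.trans (hHS ▸ hmin F (Finset.mem_powerset.2 hF))
    · exact ⟨H, hH, Or.inr hHS, fun F hF => hmin F (Finset.mem_powerset.2 hF)⟩
  obtain ⟨g, hg⟩ : ∃ g, Γ.Ok H ∅ g := by
    rcases hHne with rfl | hHne
    · exact ⟨0, fun u hu => by simp at hu⟩
    · have hHV : (H : Set α) ⊆ V(G) := by rw [← hS]; exact_mod_cast hHS
      have hlt : G.induce H < G := by
        refine lt_of_le_of_ne (Graph.induce_le hHV) fun he => hHne ?_
        have : (H : Set α) = V(G) := by rw [← he]; rfl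
        exact_mod_cast this.trans hS.symm
      obtain ⟨g, hg⟩ := circularColorable_iff.1 (h.2 _ hlt)
      refine ⟨g, fun u hu v hv => ⟨fun h0 => ?_, by simp [hne]⟩⟩
      obtain ⟨e, he, hes⟩ := exists_isLink_of_sg h0
      rw [← hes]
      rw [Finset.union_empty] at hv
      exact hg e u v ⟨he, hu, hv⟩
  obtain ⟨f, hfg, hf⟩ := Γ.extends_of_pot_nonneg (S \ H) H g Finset.sdiff_disjoint
    (fun F hF _ => by
      have hd : Disjoint H F := Finset.disjoint_sdiff.mono_right hF
      have h1 := CGraph.pot_union (G := Γ) hd (Finset.disjoint_empty_left H)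
      have h2 := hmin (H ∪ F) (Finset.union_subset hHS (hF.trans Finset.sdiff_subset))
      rw [Finset.empty_union] at h1
      linarith) (hK.mono Finset.sdiff_subset)
  refine hcol f fun u hu v hv => ?_
  rw [Finset.union_empty] at hv
  by_cases huH : u ∈ H
  · by_cases hvH : v ∈ H
    · rw [hfg u huH, hfg v hvH]
      exact hg u huH v (by simpa using hvH)
    · exact CGraph.compat_comm (hf v (by simp [hv, hvH]) u (by simp [huH]))
  · exact hf u (by simp [hu, huH]) v (by simp [hv])

end SignedGraph

theorem mainTheorem1 {α β : Type*} (G : Graph α β) (σ : β → ℤˣ)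
    (hV : V(G).Finite) (hE : E(G).Finite)
    (hloop : ∀ e x, G.IsLoopAt e x → σ e = 1)
    (hcrit : SignedGraph.CircularCritical 10 3 G σ)
    (hdigon : ¬ SignedGraph.Iso G σ SignedGraph.digon id)
    (hK4 : ¬ SignedGraph.Iso G σ SignedGraph.completeFour (fun _ => -1)) :
    (3 * (V(G).ncard : ℚ) + 1) / 2 ≤ (E(G).ncard : ℚ) ∧
      3 * (V(G).ncard : ℤ) - 2 * (E(G).ncard : ℤ) ≤ -1 := by
  classical
  have hs : ∀ {e e' : β} {u v : α}, u ≠ v → G.IsLink e u v → G.IsLink e' u v → σ e = σ e' :=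
    fun huv he he' => hcrit.sign_eq hdigon huv he he'
  have h1 := hcrit.pot_neg hs hloop (S := hV.toFinset) (by simp) (hcrit.negK4Free hs hK4 _)
  have h2 := SignedGraph.wts_constraintGraph_le (G := G) (σ := σ) hV.toFinset hE
  have h3 : 3 * (V(G).ncard : ℤ) - 2 * (E(G).ncard : ℤ) ≤ -1 := by
    rw [Set.ncard_eq_toFinset_card _ hV]
    have h0 : (SignedGraph.constraintGraph G σ).wts hV.toFinset ∅ = 0 := by
      simp [SignedGraph.CGraph.wts]
    unfold SignedGraph.CGraph.pot at h1
    linarith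
  refine ⟨?_, h3⟩
  have h4 : (3 * (V(G).ncard : ℚ) - 2 * (E(G).ncard : ℚ)) ≤ -1 := by exact_mod_cast h3
  linarith
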